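/- **Setting.** All spaces $X,Y,Z,\dots$ are nonempty standard Borel spaces (this covers finite sets, $\mathbb{R}^d$, compact subsets of $\mathbb{R}^d$, and their finite products). A channel $\Phi$ from $X$ to $Y$ is a Markov kernel $\Phi(\cdot|x)$; for a probability distribution $p$ on $X$, $\Phi(p)$ is the output distribution. A signed kernel $\Delta$ is a map $\Delta=c(\Psi_1-\Psi_2)$ with $c\in\mathbb{R}$ and channels $\Psi_1,\Psi_2$. Composition with channels, $\Delta\otimes\mathbf I$ and $\Delta(p)$ are defined by linearity. $\|\cdot\|_1$ is the total variation norm of signed measures, and $\|\Lambda\|_{\mathrm{cb}}=\sup_{Z,\,p}\|(\Lambda\otimes\mathbf I_Z)(p)\|_1$, over all measurable spaces $Z$ and probability distributions $p$ on $X\times Z$. For a probability $p$ and a signed measure $\delta$ put $J_p(\delta)=\int (d\delta/dp)^2\,dp$ if $\delta\ll p$, and $J_p(\delta)=\infty$ otherwise. Let $$G^{\min}_\Phi(\Delta)=\sup_{p}J_{\Phi(p)}(\Delta(p)),$$ the supremum being over all probability distributions $p$ on the input space. The tangent space $\mathcal T_\Phi$ consists of the signed kernels $\Delta$ with $G^{\min}_\Phi(\Delta)<\infty$.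 Write $\Phi^{\otimes n}$ for the $n$-fold product channel and $\Delta^{(n)}=\sum_{i=1}^n\Phi^{\otimes(i-1)}\otimes\Delta\otimes\Phi^{\otimes(n-i)}$. A *channel metric* $G$ assigns to every channel $\Phi$ a function $G_\Phi:\mathcal T_\Phi\to[0,\infty)$ that is the square of a norm. Consider the following axioms, for all channels $\Phi$ and all $\Delta\in\mathcal T_\Phi$. * (M1) $G_{\Phi\circ\Psi}(\Delta\circ\Psi)\le G_\Phi(\Delta)$ for all channels $\Psi$ into the input space of $\Phi$. * (M2) $G_{\Psi\circ\Phi}(\Psi\circ\Delta)\le G_\Phi(\Delta)$ for all channels $\Psi$ from the output space of $\Phi$. * (E) $G_{\Phi\otimes\mathbf I_Z}(\Delta\otimes\mathbf I_Z)=G_\Phi(\Delta)$ for all $Z$. * (A) $\lim_{n\to\infty}\frac1nG_{\Phi^{\otimes n}}(\Delta^{(n)})=G_\Phi(\Delta)$. * (C) If $\Phi^n$ are channels from $X^n$ to $Y^n$ and $\Delta^n\in\mathcal T_{\Phi^n}$ with $\|\Phi^n-\Phi^{\otimes n}\|_{\mathrm{cb}}\to0$ and $\frac1{\sqrt n}\|\Delta^n-\Delta^{(n)}\|_{\mathrm{cb}}\to0$,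 then $\liminf_{n\to\infty}\frac1n\bigl(G_{\Phi^n}(\Delta^n)-G_{\Phi^{\otimes n}}(\Delta^{(n)})\bigr)\ge0$. * (N0) For the channel with one-point input and output distribution $\mathrm N(0,1)$, and for the tangent $\delta\mathrm N(0,1)$ given by the signed measure $x\,\mathrm N(0,1)(dx)$, the value of $G$ is $1$. * (C2) If $(\Phi_t)_{t>0}$ are channels with the same input and output spaces as $\Phi$ and $\Delta_t\in\mathcal T_{\Phi_t}$ with $\lim_{t\downarrow0}\|\Phi_t-\Phi\|_{\mathrm{cb}}=\lim_{t\downarrow0}\|\Delta_t-\Delta\|_{\mathrm{cb}}=0$, then $\liminf_{t\downarrow0}G_{\Phi_t}(\Delta_t)\ge G_\Phi(\Delta)$. (In particular (C2) holds if always $\lim_{t\downarrow0}G_{\Phi_t}(\Delta_t)=G_\Phi(\Delta)$.) **Theorem.** Let $\Omega_{\mathrm{in}}\subset\mathbb{R}^d$ be compact and nonempty, let $\Omega_{\mathrm{out}}$ be a finite set, let $\Phi$ be a channel from $\Omega_{\mathrm{in}}$ to $\Omega_{\mathrm{out}}$ and let $\Delta\in\mathcal T_\Phi$. Suppose that for some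 function $f$ with $\lim_{t\downarrow0}f(t)=0$ $$\max\{\|\Phi(\cdot|x)-\Phi(\cdot|x')\|_1,\ \|\Delta(\cdot|x)-\Delta(\cdot|x')\|_1\}\le f(\|x-x'\|)\qquad(x,x'\in\Omega_{\mathrm{in}}),$$ where $\|x-x'\|$ is the Euclidean norm. If a channel metric $G$ satisfies (M1), (M2), (E), (A), (C), (N0) and (C2), then $$G_\Phi(\Delta)=G^{\min}_\Phi(\Delta).$$ -/

import Mathlib

open MeasureTheory ProbabilityTheory Filter Topology
open scoped ENNReal NNReal

noncomputable section

namespace ChannelGeometry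

/-- A tangent direction of the set of channels from `X` to `Y`, i.e. a signed kernel
`Δ = pos - neg` with total mass zero at every input. Up to a uniformly bounded common part of
`pos` and `neg`, this is the same thing as `c • (Ψ₁ - Ψ₂)` with a constant `c` and two Markov
kernels `Ψ₁`, `Ψ₂`. The signed kernel itself is `SignedChannel.signed`; two presentations of the
same signed kernel are never distinguished by a metric (see `ChannelMetric.homogeneous`). -/
structure SignedChannel (X Y : Type) [MeasurableSpace X] [MeasurableSpace Y] where
  pos : Kernel X Y
  neg : Kernel X Y
  finite_pos : IsFiniteKernel pos
  finite_neg : IsFiniteKernel neg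
  mass_eq : ∀ x, pos x Set.univ = neg x Set.univ

attribute [instance] SignedChannel.finite_pos SignedChannel.finite_neg

/-- The `L¹`-norm (total variation norm) of a signed measure. -/
def tvNorm {Y : Type} [MeasurableSpace Y] (s : SignedMeasure Y) : ℝ≥0∞ :=
  s.totalVariation Set.univ

/-- Fisher information `J_p(δ) = ∫ (dδ/dp)² dp` of a signed measure `δ` at `p`; it is `∞` if `δ` is
not absolutely continuous with respect to `p`. -/
def fisherInfo {Y : Type} [MeasurableSpace Y] (p : Measure Y) (δ : SignedMeasure Y) : ℝ≥0∞ :=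
  open Classical in
  if δ.totalVariation ≪ p then ∫⁻ y, ENNReal.ofReal ((δ.rnDeriv p y) ^ 2) ∂p else ⊤

/-- The product kernel `κ₁ ⊗ ⋯ ⊗ κₙ`. -/
def piKernel {X Y : Type} [MeasurableSpace X] [MeasurableSpace Y] {n : ℕ}
    (κ : Fin n → Kernel X Y) [∀ i, IsFiniteKernel (κ i)] : Kernel (Fin n → X) (Fin n → Y) where
  toFun x := Measure.pi (fun i => κ i (x i))
  measurable' := by
    refine Measurable.measure_of_isPiSystem generateFrom_pi.symm isPiSystem_pi ?_ ?_
    · rintro _ ⟨s, hs, rfl⟩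
      simp only [Measure.pi_pi]
      refine Finset.measurable_prod _ fun i _ => ?_
      exact (Kernel.measurable_coe (κ i) (hs i (Set.mem_univ i))).comp (measurable_pi_apply i)
    · simp only [Measure.pi_univ]
      refine Finset.measurable_prod _ fun i _ => ?_
      exact (Kernel.measurable_coe (κ i) MeasurableSet.univ).comp (measurable_pi_apply i)

lemma piKernel_univ {X Y : Type} [MeasurableSpace X] [MeasurableSpace Y] {n : ℕ}
    (κ : Fin n → Kernel X Y) [∀ i, IsFiniteKernel (κ i)] (x : Fin n → X) :
    piKernel κ x Set.univ = ∏ i, κ i (x i) Set.univ :=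
  Measure.pi_univ _

instance {X Y : Type} [MeasurableSpace X] [MeasurableSpace Y] {n : ℕ}
    (κ : Fin n → Kernel X Y) [∀ i, IsFiniteKernel (κ i)] : IsFiniteKernel (piKernel κ) := by
  refine ⟨⟨∏ i, (κ i).bound, ?_, fun x => ?_⟩⟩
  · exact ENNReal.prod_lt_top fun i _ => Kernel.bound_lt_top (κ i)
  · rw [piKernel_univ]
    exact Finset.prod_le_prod' fun i _ => Kernel.measure_le_bound (κ i) (x i) Set.univ

instance {X Y : Type} [MeasurableSpace X] [MeasurableSpace Y] {n : ℕ}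
    (κ : Fin n → Kernel X Y) [∀ i, IsMarkovKernel (κ i)] : IsMarkovKernel (piKernel κ) :=
  ⟨fun x => ⟨by simp [piKernel_univ]⟩⟩

/-- The memoryless channel `Φ^{⊗n}`. -/
def channelPow {X Y : Type} [MeasurableSpace X] [MeasurableSpace Y]
    (Φ : Kernel X Y) [IsMarkovKernel Φ] (n : ℕ) : Kernel (Fin n → X) (Fin n → Y) :=
  piKernel (fun _ : Fin n => Φ)

instance {X Y : Type} [MeasurableSpace X] [MeasurableSpace Y]
    (Φ : Kernel X Y) [IsMarkovKernel Φ] (n : ℕ) : IsMarkovKernel (channelPow Φ n) := by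
  unfold channelPow; infer_instance

/-- The kernels `Φ, …, Φ, κ, Φ, …, Φ` with `κ` in position `i`. -/
def slot {X Y : Type} [MeasurableSpace X] [MeasurableSpace Y] {n : ℕ}
    (Φ κ : Kernel X Y) (i : Fin n) (j : Fin n) : Kernel X Y :=
  if j = i then κ else Φ

instance {X Y : Type} [MeasurableSpace X] [MeasurableSpace Y] {n : ℕ}
    (Φ κ : Kernel X Y) [IsFiniteKernel Φ] [IsFiniteKernel κ] (i j : Fin n) :
    IsFiniteKernel (slot Φ κ i j) := by
  unfold slot; split_ifs <;> infer_instance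

lemma isFiniteKernel_finset_sum {X Y ι : Type} [MeasurableSpace X] [MeasurableSpace Y]
    (s : Finset ι) (κ : ι → Kernel X Y) (h : ∀ i, IsFiniteKernel (κ i)) :
    IsFiniteKernel (∑ i ∈ s, κ i) := by
  classical
  induction s using Finset.induction_on with
  | empty => rw [Finset.sum_empty]; infer_instance
  | insert a s ha ih => rw [Finset.sum_insert ha]; infer_instance

lemma slot_mass {X Y : Type} [MeasurableSpace X] [MeasurableSpace Y] {n : ℕ}
    (Φ κ η : Kernel X Y) (h : ∀ x, κ x Set.univ = η x Set.univ) (i j : Fin n) (x : X) :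
    slot Φ κ i j x Set.univ = slot Φ η i j x Set.univ := by
  unfold slot; split_ifs
  · exact h x
  · rfl

namespace SignedChannel

variable {X Y : Type} [MeasurableSpace X] [MeasurableSpace Y]

/-- The signed measure `Δ(·|x)`. -/
def signed (Δ : SignedChannel X Y) (x : X) : SignedMeasure Y :=
  (Δ.pos x).toSignedMeasure - (Δ.neg x).toSignedMeasure

/-- The signed output measure `Δ(p)` for a random input with distribution `p`. -/
def apply (Δ : SignedChannel X Y) (p : ProbabilityMeasure X) : SignedMeasure Y :=
  (Δ.pos ∘ₘ (p : Measure X)).toSignedMeasure - (Δ.neg ∘ₘ (p : Measure X)).toSignedMeasure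

/-- The difference `Φ - Φ'` of two channels. -/
def ofChannels (Φ Φ' : Kernel X Y) [IsMarkovKernel Φ] [IsMarkovKernel Φ'] :
    SignedChannel X Y where
  pos := Φ
  neg := Φ'
  finite_pos := inferInstance
  finite_neg := inferInstance
  mass_eq x := by simp

/-- The difference `Δ - Δ'`. -/
def sub (Δ Δ' : SignedChannel X Y) : SignedChannel X Y where
  pos := Δ.pos + Δ'.neg
  neg := Δ.neg + Δ'.pos
  finite_pos := inferInstance
  finite_neg := inferInstance
  mass_eq x := by simp [Δ.mass_eq x, Δ'.mass_eq x]

/-- `Δ ∘ Ψ`: a channel acts first. -/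
def precomp {X' : Type} [MeasurableSpace X'] (Δ : SignedChannel X Y) (Ψ : Kernel X' X)
    [IsMarkovKernel Ψ] : SignedChannel X' Y where
  pos := Δ.pos ∘ₖ Ψ
  neg := Δ.neg ∘ₖ Ψ
  finite_pos := inferInstance
  finite_neg := inferInstance
  mass_eq x := by simp [Kernel.comp_apply' _ _ _ MeasurableSet.univ, Δ.mass_eq]

/-- `Ψ ∘ Δ`: a channel acts on the output. -/
def postcomp {Y' : Type} [MeasurableSpace Y'] (Δ : SignedChannel X Y) (Ψ : Kernel Y Y')
    [IsMarkovKernel Ψ] : SignedChannel X Y' where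
  pos := Ψ ∘ₖ Δ.pos
  neg := Ψ ∘ₖ Δ.neg
  finite_pos := inferInstance
  finite_neg := inferInstance
  mass_eq x := by simp [Kernel.comp_apply' _ _ _ MeasurableSet.univ, Δ.mass_eq]

/-- `Δ ⊗ I` with the identity channel on `Z`. -/
def tensorId (Δ : SignedChannel X Y) (Z : Type) [MeasurableSpace Z] :
    SignedChannel (X × Z) (Y × Z) where
  pos := Δ.pos ∥ₖ Kernel.id
  neg := Δ.neg ∥ₖ Kernel.id
  finite_pos := inferInstance
  finite_neg := inferInstance
  mass_eq x := by simp [Kernel.parallelComp_apply_univ, Δ.mass_eq]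

/-- `Δ^{(n)} = Δ ⊗ Φ^{⊗(n-1)} + Φ ⊗ Δ ⊗ Φ^{⊗(n-2)} + ⋯ + Φ^{⊗(n-1)} ⊗ Δ`. -/
def pow (Φ : Kernel X Y) [IsMarkovKernel Φ] (Δ : SignedChannel X Y) (n : ℕ) :
    SignedChannel (Fin n → X) (Fin n → Y) where
  pos := ∑ i : Fin n, piKernel (slot Φ Δ.pos i)
  neg := ∑ i : Fin n, piKernel (slot Φ Δ.neg i)
  finite_pos := isFiniteKernel_finset_sum _ _ fun _ => inferInstance
  finite_neg := isFiniteKernel_finset_sum _ _ fun _ => inferInstance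
  mass_eq x := by
    simp only [Kernel.finsetSum_apply', piKernel_univ]
    exact Finset.sum_congr rfl fun i _ => Finset.prod_congr rfl fun j _ =>
      slot_mass Φ Δ.pos Δ.neg Δ.mass_eq i j (x j)

/-- The completely bounded norm `sup_p ‖(Λ ⊗ I)(p)‖₁`, over all ancillas `Z` and all probability
distributions `p` on `X × Z`. -/
def cbNorm (Λ : SignedChannel X Y) : ℝ≥0∞ :=
  ⨆ (Z : Type) (_ : MeasurableSpace Z) (p : ProbabilityMeasure (X × Z)),
    tvNorm ((Λ.tensorId Z).apply p)

end SignedChannel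

/-- `G^min_Φ(Δ) = sup_p J_{Φ(p)}(Δ(p))`, over all input distributions `p`. -/
def gMin {X Y : Type} [MeasurableSpace X] [MeasurableSpace Y]
    (Φ : Kernel X Y) (Δ : SignedChannel X Y) : ℝ≥0∞ :=
  ⨆ p : ProbabilityMeasure X, fisherInfo (Φ ∘ₘ (p : Measure X)) (Δ.apply p)

/-- `Δ` belongs to the tangent space at `Φ`: the Fisher information of the output is bounded. -/
def IsTangent {X Y : Type} [MeasurableSpace X] [MeasurableSpace Y]
    (Φ : Kernel X Y) (Δ : SignedChannel X Y) : Prop :=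
  gMin Φ Δ < ⊤

/-- A channel metric: for all channels `Φ` between nonempty standard Borel spaces, the square
`Δ ↦ G_Φ(Δ)` of a norm on the tangent space at `Φ`. The values of `toFun` outside of this domain
are never used. Taking `a = 1` in `homogeneous` shows that `G_Φ(Δ)` depends on `Δ` only through
the signed kernel `x ↦ Δ(·|x)`. -/
structure ChannelMetric where
  toFun : ∀ {X Y : Type} [MeasurableSpace X] [MeasurableSpace Y],
    Kernel X Y → SignedChannel X Y → ℝ
  nonneg : ∀ {X Y : Type} [MeasurableSpace X] [StandardBorelSpace X] [Nonempty X]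
    [MeasurableSpace Y] [StandardBorelSpace Y] [Nonempty Y]
    (Φ : Kernel X Y) [IsMarkovKernel Φ] (Δ : SignedChannel X Y),
    IsTangent Φ Δ → 0 ≤ toFun Φ Δ
  homogeneous : ∀ {X Y : Type} [MeasurableSpace X] [StandardBorelSpace X] [Nonempty X]
    [MeasurableSpace Y] [StandardBorelSpace Y] [Nonempty Y]
    (Φ : Kernel X Y) [IsMarkovKernel Φ] (Δ Δ' : SignedChannel X Y) (a : ℝ),
    IsTangent Φ Δ → (∀ x, Δ'.signed x = a • Δ.signed x) → toFun Φ Δ' = a ^ 2 * toFun Φ Δ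
  triangle : ∀ {X Y : Type} [MeasurableSpace X] [StandardBorelSpace X] [Nonempty X]
    [MeasurableSpace Y] [StandardBorelSpace Y] [Nonempty Y]
    (Φ : Kernel X Y) [IsMarkovKernel Φ] (Δ₁ Δ₂ Δ : SignedChannel X Y),
    IsTangent Φ Δ₁ → IsTangent Φ Δ₂ → (∀ x, Δ.signed x = Δ₁.signed x + Δ₂.signed x) →
    √(toFun Φ Δ) ≤ √(toFun Φ Δ₁) + √(toFun Φ Δ₂)
  definite : ∀ {X Y : Type} [MeasurableSpace X] [StandardBorelSpace X] [Nonempty X]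
    [MeasurableSpace Y] [StandardBorelSpace Y] [Nonempty Y]
    (Φ : Kernel X Y) [IsMarkovKernel Φ] (Δ : SignedChannel X Y),
    IsTangent Φ Δ → toFun Φ Δ = 0 → ∀ x, Δ.signed x = 0

instance : CoeFun ChannelMetric (fun _ => ∀ {X Y : Type} [MeasurableSpace X] [MeasurableSpace Y],
    Kernel X Y → SignedChannel X Y → ℝ) :=
  ⟨ChannelMetric.toFun⟩

/-- The derivative at `θ = 0` of the Gaussian shift family `N(θ, 1)`, namely the signed measure
`x N(0,1)(dx)`, regarded as a tangent of a channel with one-point input. -/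
def gaussianShift : SignedChannel Unit ℝ where
  pos := Kernel.const Unit ((gaussianReal 0 1).withDensity fun x => ENNReal.ofReal x)
  neg := Kernel.const Unit ((gaussianReal 0 1).withDensity fun x => ENNReal.ofReal (-x))
  finite_pos := by
    have h : Integrable (fun x : ℝ => x) (gaussianReal 0 1) :=
      (memLp_id_gaussianReal 1).integrable le_rfl
    have := isFiniteMeasure_withDensity_ofReal h.2
    infer_instance
  finite_neg := by
    have h : Integrable (fun x : ℝ => x) (gaussianReal 0 1) :=
      (memLp_id_gaussianReal 1).integrable le_rfl
    have := isFiniteMeasure_withDensity_ofReal h.neg.2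
    infer_instance
  mass_eq _ := by
    have h : (gaussianReal 0 1).map (fun x => -x) = gaussianReal 0 1 := by
      rw [gaussianReal_map_neg, neg_zero]
    simp only [Kernel.const_apply, withDensity_apply _ MeasurableSet.univ, Measure.restrict_univ]
    conv_lhs => rw [← h]
    rw [lintegral_map (by fun_prop) (by fun_prop)]

namespace ChannelMetric

/-- (M1): monotonicity under processing of the input. -/
def M1 (G : ChannelMetric) : Prop :=
  ∀ {X' X Y : Type} [MeasurableSpace X'] [StandardBorelSpace X'] [Nonempty X']
    [MeasurableSpace X] [StandardBorelSpace X] [Nonempty X]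
    [MeasurableSpace Y] [StandardBorelSpace Y] [Nonempty Y]
    (Φ : Kernel X Y) [IsMarkovKernel Φ] (Δ : SignedChannel X Y)
    (Ψ : Kernel X' X) [IsMarkovKernel Ψ],
    IsTangent Φ Δ → G (Φ ∘ₖ Ψ) (Δ.precomp Ψ) ≤ G Φ Δ

/-- (M2): monotonicity under processing of the output. -/
def M2 (G : ChannelMetric) : Prop :=
  ∀ {X Y Y' : Type} [MeasurableSpace X] [StandardBorelSpace X] [Nonempty X]
    [MeasurableSpace Y] [StandardBorelSpace Y] [Nonempty Y]
    [MeasurableSpace Y'] [StandardBorelSpace Y'] [Nonempty Y']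
    (Φ : Kernel X Y) [IsMarkovKernel Φ] (Δ : SignedChannel X Y)
    (Ψ : Kernel Y Y') [IsMarkovKernel Ψ],
    IsTangent Φ Δ → G (Ψ ∘ₖ Φ) (Δ.postcomp Ψ) ≤ G Φ Δ

/-- (E): invariance under tensoring with an identity channel. -/
def E (G : ChannelMetric) : Prop :=
  ∀ {X Y Z : Type} [MeasurableSpace X] [StandardBorelSpace X] [Nonempty X]
    [MeasurableSpace Y] [StandardBorelSpace Y] [Nonempty Y]
    [MeasurableSpace Z] [StandardBorelSpace Z] [Nonempty Z]
    (Φ : Kernel X Y) [IsMarkovKernel Φ] (Δ : SignedChannel X Y),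
    IsTangent Φ Δ → G (Φ ∥ₖ (Kernel.id : Kernel Z Z)) (Δ.tensorId Z) = G Φ Δ

/-- (A): asymptotic weak additivity. -/
def A (G : ChannelMetric) : Prop :=
  ∀ {X Y : Type} [MeasurableSpace X] [StandardBorelSpace X] [Nonempty X]
    [MeasurableSpace Y] [StandardBorelSpace Y] [Nonempty Y]
    (Φ : Kernel X Y) [IsMarkovKernel Φ] (Δ : SignedChannel X Y),
    IsTangent Φ Δ →
    Tendsto (fun n : ℕ => (1 / (n : ℝ)) * G (channelPow Φ n) (Δ.pow Φ n)) atTop (𝓝 (G Φ Δ))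

/-- (C): weak asymptotic continuity. -/
def C (G : ChannelMetric) : Prop :=
  ∀ {X Y : Type} [MeasurableSpace X] [StandardBorelSpace X] [Nonempty X]
    [MeasurableSpace Y] [StandardBorelSpace Y] [Nonempty Y]
    (Φ : Kernel X Y) [IsMarkovKernel Φ] (Δ : SignedChannel X Y)
    (Φ' : (n : ℕ) → Kernel (Fin n → X) (Fin n → Y)) [∀ n, IsMarkovKernel (Φ' n)]
    (Δ' : (n : ℕ) → SignedChannel (Fin n → X) (Fin n → Y)),
    IsTangent Φ Δ → (∀ n, IsTangent (Φ' n) (Δ' n)) →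
    Tendsto (fun n => (SignedChannel.ofChannels (Φ' n) (channelPow Φ n)).cbNorm) atTop (𝓝 0) →
    Tendsto (fun n : ℕ => ((Δ' n).sub (Δ.pow Φ n)).cbNorm / ENNReal.ofReal √(n : ℝ))
      atTop (𝓝 0) →
    0 ≤ liminf (fun n : ℕ =>
      (((1 / (n : ℝ)) * (G (Φ' n) (Δ' n) - G (channelPow Φ n) (Δ.pow Φ n)) : ℝ) : EReal)) atTop

/-- (N0): normalization on the Gaussian shift family. -/
def N0 (G : ChannelMetric) : Prop :=
  G (Kernel.const Unit (gaussianReal 0 1)) gaussianShift = 1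

/-- (C2): continuity from below. This is the inequality `≥` in
`lim_{t → 0} G_{Φ_t}(Δ_t) = G_Φ(Δ)`; the equality fails already for the Fisher information of
distributions on two points, at the boundary of the simplex. -/
def C2 (G : ChannelMetric) : Prop :=
  ∀ {X Y : Type} [MeasurableSpace X] [StandardBorelSpace X] [Nonempty X]
    [MeasurableSpace Y] [StandardBorelSpace Y] [Nonempty Y]
    (Φ : Kernel X Y) [IsMarkovKernel Φ] (Δ : SignedChannel X Y)
    (Φ' : ℝ → Kernel X Y) [∀ t, IsMarkovKernel (Φ' t)] (Δ' : ℝ → SignedChannel X Y),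
    IsTangent Φ Δ → (∀ t, IsTangent (Φ' t) (Δ' t)) →
    Tendsto (fun t => (SignedChannel.ofChannels (Φ' t) Φ).cbNorm) (𝓝[>] 0) (𝓝 0) →
    Tendsto (fun t => ((Δ' t).sub Δ).cbNorm) (𝓝[>] 0) (𝓝 0) →
    ((G Φ Δ : ℝ) : EReal) ≤ liminf (fun t => ((G (Φ' t) (Δ' t) : ℝ) : EReal)) (𝓝[>] 0)

end ChannelMetric

end ChannelGeometry

end

noncomputable section

/-! The Gaussian shift is a unit of currency: by (N0) it has value 1, and by the central limit
theorem `n` uses of a channel in a tangent direction can be converted from and into Gaussian shifts,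
up to errors that (C) ignores. Monotonicity turns each conversion into an inequality, and (A) makes
it exact per use.

Lower bound (`ChannelMetric.gMin_le`). By (M1) an input distribution may be fixed, so it suffices to
bound `G` below by the Fisher information `J` of a distribution on a finite set; by homogeneity
assume `J > 1`. The normalized score `S` of `n` samples is nearly `N(0, J)`. Hence `S / J` plus
independent Gaussian noise of variance `1 - 1/J` is nearly `N(0,1)`, and the tangent becomes nearly
`√n r N(0,1)(dr)`. This is what the normalized sum of `n` Gaussian shifts produces; the sum is
sufficient, so `gaussianSplit` restores all `n` variables. Now (M2), (C), (A) and (N0) give `1 ≤ G`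
(`one_le_of_one_lt`), and rescaling gives `J ≤ G`.

Upper bound (`ChannelMetric.le_gMin`). Let the score be bounded, with variance at most `γ < 1` at
every input. For an input sequence `x` let `S` be the normalized score, with variance `v ≤ γ`, and
let `R` be `S` plus Gaussian noise of variance `1 - v`, so that `R` is nearly `N(0,1)`. Sampling the
output from its posterior given `R` and `x` (`bayesKernel`) reproduces `Φ^{⊗n}` exactly when `R` has
its true law, and since `E[R | y] = S(y)` the weight `√n R` reproduces `Δ^{(n)}` exactly. Feeding in
a genuine `N(0,1)` variable costs an error that is small uniformly in `x`. The simulation consumes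
one Gaussian shift scaled by `√n`, of value at most `n` by (M1), (M2), (E) and (N0), so (C) and (A)
give `G ≤ 1` and rescaling gives `G ≤ γ`. Mixing the output with uniform noise makes the score
bounded and keeps its variance below `gMin`; (C2) removes the noise.

Both conversions rest on a uniform central limit theorem in weighted `L¹`
(`exists_charDefect_bound`, `eventually_product_approx`). The added Gaussian noise has variance
bounded below, so Fourier inversion gives uniform closeness of densities, and second moments control
the tails. -/

namespace ChannelGeometry

/-! ### Fourier inversion for Gaussian densities -/

section GaussianFourier

open Complex in
lemma integral_cexp_gaussianPDFReal {w : ℝ≥0} (hw : w ≠ 0) (u : ℝ) :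
    ∫ t : ℝ, cexp (I * t * u - w * t ^ 2 / 2) = 2 * Real.pi * gaussianPDFReal 0 w u := by
  have hw' : (0 : ℝ) < w := by positivity
  have h1 : (-(w / 2 : ℂ)).re < 0 := by
    have : (-(w / 2 : ℂ)) = ((-(w / 2) : ℝ) : ℂ) := by push_cast; rfl
    rw [this, ofReal_re]; linarith
  have h := integral_cexp_quadratic h1 (I * u) 0
  have hwc : (w : ℂ) ≠ 0 := by exact_mod_cast hw
  calc _ = ∫ t : ℝ, cexp (-(w / 2 : ℂ) * t ^ 2 + I * u * t + 0) := by
        congr 1; ext t; congr 1; ring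
    _ = _ := by
        rw [h, gaussianPDFReal]
        have e1 : (Real.pi / - -(w / 2 : ℂ)) ^ (1 / 2 : ℂ) = ((√(2 * Real.pi / w) : ℝ) : ℂ) := by
          rw [Real.sqrt_eq_rpow, ofReal_cpow (by positivity)]
          congr 1
          · push_cast; field_simp
          · push_cast; rfl
        have e2 : (0 - (I * u) ^ 2 / (4 * -(w / 2 : ℂ)))
            = ((-(u - 0) ^ 2 / (2 * w) : ℝ) : ℂ) := by
          rw [mul_pow, I_sq]; push_cast; field_simp; ring
        rw [e1, e2, ← ofReal_exp, ← ofReal_mul]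
        have e3 : √(2 * Real.pi / w) = 2 * Real.pi * (√(2 * Real.pi * w))⁻¹ := by
          rw [Real.sqrt_div (by positivity), Real.sqrt_mul (by positivity) (w : ℝ)]
          have : √(2 * Real.pi) ^ 2 = 2 * Real.pi := Real.sq_sqrt (by positivity)
          have : (0 : ℝ) < √(2 * Real.pi) := by positivity
          have : (0 : ℝ) < √(w : ℝ) := by positivity
          field_simp
          linarith
        rw [e3]; push_cast; ring

lemma integrable_abs_pow_mul_exp {a : ℝ} (ha : 0 < a) (k : ℕ) :
    Integrable (fun t : ℝ => |t| ^ k * Real.exp (-(a * t ^ 2 / 2))) := by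
  have h := integrable_rpow_mul_exp_neg_mul_sq (b := a / 2) (by positivity) (s := k)
    (by have : (0 : ℝ) ≤ k := by positivity
        linarith)
  refine h.norm.congr (ae_of_all _ fun t => ?_)
  simp only [Real.rpow_natCast, norm_mul, norm_pow, Real.norm_eq_abs, Real.abs_exp]
  congr 2; ring

open Complex in
lemma norm_cexp_gaussian (w : ℝ≥0) (u t : ℝ) :
    ‖cexp (I * t * u - w * t ^ 2 / 2)‖ = Real.exp (-(w * t ^ 2 / 2)) := by
  rw [norm_exp]
  congr 1
  have : I * t * u - w * t ^ 2 / 2 = ((-(w * t ^ 2 / 2) : ℝ) : ℂ) + ((t * u : ℝ) : ℂ) * I := by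
    push_cast; ring
  rw [this]
  simp only [add_re, ofReal_re, mul_re, I_re, I_im, ofReal_im]
  ring

open Complex in
lemma integrable_pow_mul_cexp_gaussian {w : ℝ≥0} (hw : w ≠ 0) (u : ℝ) (k : ℕ) :
    Integrable (fun t : ℝ => (t : ℂ) ^ k * cexp (I * t * u - w * t ^ 2 / 2)) := by
  have hw' : (0 : ℝ) < w := by positivity
  refine (integrable_abs_pow_mul_exp hw' k).mono' ?_ (ae_of_all _ fun t => ?_)
  · exact (by fun_prop : Continuous _).aestronglyMeasurable
  · rw [norm_mul, norm_cexp_gaussian, norm_pow, norm_real, Real.norm_eq_abs]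

-- Integration by parts: the derivative of the Gaussian exponential has integral zero. This is the
-- inversion formula for the derivative of the density.
open Complex in
lemma integral_mul_cexp_gaussianPDFReal {w : ℝ≥0} (hw : w ≠ 0) (u : ℝ) :
    w * ∫ t : ℝ, t * cexp (I * t * u - w * t ^ 2 / 2)
      = I * u * (2 * Real.pi * gaussianPDFReal 0 w u) := by
  have i0 := integrable_pow_mul_cexp_gaussian hw u 0
  have i1 := integrable_pow_mul_cexp_gaussian hw u 1
  simp only [pow_zero, one_mul, pow_one] at i0 i1
  have hd : ∀ t : ℝ, HasDerivAt (fun t : ℝ => cexp (I * t * u - w * t ^ 2 / 2))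
      (I * u * cexp (I * t * u - w * t ^ 2 / 2)
        - w * (t * cexp (I * t * u - w * t ^ 2 / 2))) t := by
    intro t
    have h1 : HasDerivAt (fun z : ℂ => cexp (I * z * u - w * z ^ 2 / 2))
        (cexp (I * t * u - w * t ^ 2 / 2) * (I * 1 * u - w * (2 * t) / 2)) (t : ℂ) := by
      refine HasDerivAt.cexp ?_
      refine HasDerivAt.sub ?_ ?_
      · exact ((hasDerivAt_id (t : ℂ)).const_mul I).mul_const _
      · simpa using (((hasDerivAt_pow 2 (t : ℂ))).const_mul (w : ℂ)).div_const 2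
    convert h1.comp_ofReal using 1
    ring
  have h := integral_eq_zero_of_hasDerivAt_of_integrable hd
    ((i0.const_mul _).sub (i1.const_mul _)) i0
  rw [integral_sub (i0.const_mul _) (i1.const_mul _), integral_const_mul, integral_const_mul,
    integral_cexp_gaussianPDFReal hw, sub_eq_zero] at h
  exact h.symm

end GaussianFourier

/-! ### Smoothed finitely supported laws compared with `N(0,1)` -/

section GaussianMixture

lemma gaussianPDFReal_eq_zero_sub (s : ℝ) (w : ℝ≥0) (r : ℝ) :
    gaussianPDFReal s w r = gaussianPDFReal 0 w (r - s) := by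
  simp [gaussianPDFReal]

lemma integrable_sq_mul_gaussianPDFReal (s : ℝ) {w : ℝ≥0} (hw : w ≠ 0) :
    Integrable (fun r => r ^ 2 * gaussianPDFReal s w r) := by
  have h : Integrable (fun r : ℝ => r ^ 2) (gaussianReal s w) :=
    (memLp_id_gaussianReal (μ := s) (v := w) 2).integrable_sq
  rw [gaussianReal_of_var_ne_zero s hw] at h
  rw [integrable_withDensity_iff (measurable_gaussianPDF s w)
    (ae_of_all _ fun _ => gaussianPDF_lt_top)] at h
  simpa [toReal_gaussianPDF] using h

lemma integral_sq_mul_gaussianPDFReal (s : ℝ) {w : ℝ≥0} (hw : w ≠ 0) :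
    ∫ r, r ^ 2 * gaussianPDFReal s w r = s ^ 2 + w := by
  have h := variance_eq_sub (memLp_id_gaussianReal (μ := s) (v := w) 2)
  rw [variance_id_gaussianReal] at h
  have h1 : ∫ x, id x ∂gaussianReal s w = s := integral_id_gaussianReal
  rw [h1] at h
  have h2 := integral_gaussianReal_eq_integral_smul (μ := s) hw (f := fun r : ℝ => r ^ 2)
  simp only [smul_eq_mul] at h2
  have h3 : ∫ x, (id ^ 2 : ℝ → ℝ) x ∂gaussianReal s w = ∫ x, x ^ 2 ∂gaussianReal s w := rfl
  rw [h3, h2] at h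
  simp_rw [mul_comm (_ ^ 2) (gaussianPDFReal s w _)]
  linarith

lemma integral_mul_gaussianPDFReal (s : ℝ) {w : ℝ≥0} (hw : w ≠ 0) :
    ∫ r, r * gaussianPDFReal s w r = s := by
  have h := integral_gaussianReal_eq_integral_smul (μ := s) hw (f := fun r : ℝ => r)
  rw [integral_id_gaussianReal] at h
  simp only [smul_eq_mul, mul_comm (gaussianPDFReal _ _ _)] at h
  exact h.symm

lemma integrable_mul_gaussianPDFReal (s : ℝ) {w : ℝ≥0} (hw : w ≠ 0) :
    Integrable fun r => r * gaussianPDFReal s w r := by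
  refine ((integrable_gaussianPDFReal s w).add (integrable_sq_mul_gaussianPDFReal s hw)).mono'
    (by fun_prop) (ae_of_all _ fun r => ?_)
  have h0 := gaussianPDFReal_nonneg s w r
  rw [norm_mul, Real.norm_eq_abs, Real.norm_eq_abs, abs_of_nonneg h0, Pi.add_apply]
  have : |r| ≤ 1 + r ^ 2 := by
    have := sq_nonneg (|r| - 1)
    have := sq_abs r
    nlinarith [abs_nonneg r]
  nlinarith

variable {Ω : Type} [Fintype Ω]

/-- The density of `S + W` where `S` has the finitely supported law with weights `P` and `W` is an
independent centred Gaussian variable with variance `w`. -/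
def mixDensity (P S : Ω → ℝ) (w : ℝ≥0) (r : ℝ) : ℝ := ∑ ω, P ω * gaussianPDFReal (S ω) w r

/-- The density of the image of the signed measure with weights `P ω * S ω` under Gaussian
smoothing of `S`. -/
def mixScore (P S : Ω → ℝ) (w : ℝ≥0) (r : ℝ) : ℝ :=
  ∑ ω, P ω * S ω * gaussianPDFReal (S ω) w r

lemma mixDensity_nonneg {P : Ω → ℝ} (hP : ∀ ω, 0 ≤ P ω) (S : Ω → ℝ) (w : ℝ≥0) (r : ℝ) :
    0 ≤ mixDensity P S w r :=
  Finset.sum_nonneg fun ω _ => mul_nonneg (hP ω) (gaussianPDFReal_nonneg _ _ _)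

lemma mixDensity_pos {P : Ω → ℝ} (hP : ∀ ω, 0 ≤ P ω) (hP1 : ∑ ω, P ω = 1) (S : Ω → ℝ) {w : ℝ≥0}
    (hw : w ≠ 0) (r : ℝ) : 0 < mixDensity P S w r := by
  obtain ⟨ω, -, hω⟩ := Finset.exists_ne_zero_of_sum_ne_zero (hP1.trans_ne one_ne_zero)
  exact Finset.sum_pos' (fun ω _ => mul_nonneg (hP ω) (gaussianPDFReal_nonneg _ _ _))
    ⟨ω, Finset.mem_univ _, mul_pos ((hP ω).lt_of_ne' hω) (gaussianPDFReal_pos _ _ _ hw)⟩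

lemma integrable_mixDensity (P S : Ω → ℝ) (w : ℝ≥0) : Integrable (mixDensity P S w) :=
  integrable_finsetSum _ fun _ _ => (integrable_gaussianPDFReal _ _).const_mul _

lemma integrable_mixScore (P S : Ω → ℝ) (w : ℝ≥0) : Integrable (mixScore P S w) :=
  integrable_finsetSum _ fun _ _ => (integrable_gaussianPDFReal _ _).const_mul _

lemma integrable_sq_mul_mixDensity (P S : Ω → ℝ) {w : ℝ≥0} (hw : w ≠ 0) :
    Integrable (fun r => r ^ 2 * mixDensity P S w r) := by
  simp only [mixDensity, Finset.mul_sum]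
  refine integrable_finsetSum _ fun ω _ => ?_
  refine ((integrable_sq_mul_gaussianPDFReal (S ω) hw).const_mul (P ω)).congr (ae_of_all _ ?_)
  intro r; ring

lemma integral_mixDensity {P : Ω → ℝ} (hP1 : ∑ ω, P ω = 1) (S : Ω → ℝ) {w : ℝ≥0} (hw : w ≠ 0) :
    ∫ r, mixDensity P S w r = 1 := by
  simp only [mixDensity]
  rw [integral_finsetSum _ fun _ _ => (integrable_gaussianPDFReal _ _).const_mul _]
  simp only [integral_const_mul, integral_gaussianPDFReal_eq_one _ hw, mul_one, hP1]

lemma integral_sq_mul_mixDensity {P : Ω → ℝ} (hP1 : ∑ ω, P ω = 1) (S : Ω → ℝ) {w : ℝ≥0}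
    (hw : w ≠ 0) : ∫ r, r ^ 2 * mixDensity P S w r = ∑ ω, P ω * S ω ^ 2 + w := by
  have h : ∀ r, r ^ 2 * mixDensity P S w r
      = ∑ ω, P ω * (r ^ 2 * gaussianPDFReal (S ω) w r) := fun r => by
    simp only [mixDensity, Finset.mul_sum]
    exact Finset.sum_congr rfl fun ω _ => by ring
  simp only [h]
  rw [integral_finsetSum _ fun _ _ => (integrable_sq_mul_gaussianPDFReal _ hw).const_mul _]
  simp only [integral_const_mul, integral_sq_mul_gaussianPDFReal _ hw, mul_add,
    Finset.sum_add_distrib, ← Finset.sum_mul, hP1, one_mul]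

/-- The difference between the characteristic function of `S` (at `-t`) and that of a centred
Gaussian variable with variance `v`. -/
def charDefect (P S : Ω → ℝ) (v : ℝ≥0) (t : ℝ) : ℂ :=
  ∑ ω, (P ω : ℂ) * Complex.exp (-(Complex.I * t * S ω)) - Complex.exp (-(v * t ^ 2 / 2))

-- The factor `exp(-w t²/2)` with `w ≥ ε` makes the integral converge with a bound depending on `ε`
-- only. The exponents `k = 0` and `k = 1` serve the density and the score; `|t|^k ≤ 1 + |t|` covers
-- both with one constant.
open Complex in
lemma norm_integral_charDefect_le {ε η : ℝ} (hε : 0 < ε) (P S : Ω → ℝ) {v w : ℝ≥0}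
    (hw : ε ≤ w) (hE : ∀ t, ‖charDefect P S v t‖ ≤ η * (|t| ^ 3 + |t| ^ 4)) {k : ℕ} (hk : k ≤ 1)
    (r : ℝ) :
    ‖∫ t : ℝ, (t : ℂ) ^ k * cexp (I * t * r - w * t ^ 2 / 2) * charDefect P S v t‖
      ≤ η * ∫ t : ℝ, (|t| ^ 3 + 2 * |t| ^ 4 + |t| ^ 5) * Real.exp (-(ε * t ^ 2 / 2)) := by
  rw [← integral_const_mul]
  have hη : 0 ≤ η := by
    -- At `t = 1` the bound on the defect is `2 η`.
    have := (norm_nonneg _).trans (hE 1)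
    simp at this; linarith
  refine norm_integral_le_of_norm_le ?_ (ae_of_all _ fun t => ?_)
  · refine Integrable.const_mul ?_ _
    have := ((integrable_abs_pow_mul_exp hε 3).add
      ((integrable_abs_pow_mul_exp hε 4).const_mul 2)).add (integrable_abs_pow_mul_exp hε 5)
    refine this.congr (ae_of_all _ fun t => ?_)
    simp only [Pi.add_apply]; ring
  · rw [norm_mul, norm_mul, norm_cexp_gaussian, norm_pow, norm_real, Real.norm_eq_abs]
    have h1 : Real.exp (-(w * t ^ 2 / 2)) ≤ Real.exp (-(ε * t ^ 2 / 2)) := by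
      apply Real.exp_le_exp.2
      have := mul_le_mul_of_nonneg_right hw (sq_nonneg t)
      linarith
    have h2 : |t| ^ k ≤ 1 + |t| := by
      interval_cases k <;> simp
    calc |t| ^ k * Real.exp (-(w * t ^ 2 / 2)) * ‖charDefect P S v t‖
        ≤ (1 + |t|) * Real.exp (-(ε * t ^ 2 / 2)) * (η * (|t| ^ 3 + |t| ^ 4)) := by
          gcongr
          exact hE t
      _ = _ := by ring

-- Multiplying by `exp(-w t²/2)` smooths `S` by `N(0, w)` and, because `v + w = 1`, turns the
-- comparison law `N(0, v)` into `N(0, 1)`.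
open Complex in
lemma integral_cexp_mul_charDefect (P S : Ω → ℝ) {v w : ℝ≥0} (hw : w ≠ 0) (hvw : v + w = 1)
    (r : ℝ) (k : ℕ) :
    ∫ t : ℝ, (t : ℂ) ^ k * cexp (I * t * r - w * t ^ 2 / 2) * charDefect P S v t
      = ∑ ω, P ω * (∫ t : ℝ, (t : ℂ) ^ k * cexp (I * t * (r - S ω : ℝ) - w * t ^ 2 / 2))
        - ∫ t : ℝ, (t : ℂ) ^ k * cexp (I * t * r - (1 : ℝ≥0) * t ^ 2 / 2) := by
  simp only [← integral_const_mul]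
  rw [← integral_finsetSum _ fun ω _ =>
      (integrable_pow_mul_cexp_gaussian hw (r - S ω) k).const_mul _,
    ← integral_sub (integrable_finsetSum _ fun ω _ =>
      (integrable_pow_mul_cexp_gaussian hw (r - S ω) k).const_mul _)
      (integrable_pow_mul_cexp_gaussian one_ne_zero r k)]
  congr 1; ext t
  rw [charDefect, mul_sub, Finset.mul_sum]
  congr 1
  · refine Finset.sum_congr rfl fun ω _ => ?_
    rw [mul_left_comm, mul_assoc, mul_assoc, ← Complex.exp_add]
    congr 4
    push_cast; ring_nf
  · rw [mul_assoc, ← Complex.exp_add, ← hvw]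
    congr 2
    push_cast; ring_nf

/-- The Fourier constant in the Gaussian approximation bounds. -/
def smoothingConst (ε : ℝ) : ℝ :=
  ∫ t : ℝ, (|t| ^ 3 + 2 * |t| ^ 4 + |t| ^ 5) * Real.exp (-(ε * t ^ 2 / 2))

lemma smoothingConst_nonneg (ε : ℝ) : 0 ≤ smoothingConst ε :=
  integral_nonneg fun t => by simp only [Pi.zero_apply]; positivity

/-- The case `k = 0`: the integral is `2π` times the difference of the densities, and the factor `2π
≥ 1` is discarded. -/
lemma abs_mixDensity_sub_le {ε η : ℝ} (hε : 0 < ε) (P S : Ω → ℝ) {v w : ℝ≥0} (hvw : v + w = 1)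
    (hw : ε ≤ w) (hE : ∀ t, ‖charDefect P S v t‖ ≤ η * (|t| ^ 3 + |t| ^ 4)) (r : ℝ) :
    |mixDensity P S w r - gaussianPDFReal 0 1 r| ≤ η * smoothingConst ε := by
  have hw0 : w ≠ 0 := by rintro rfl; simp at hw; linarith
  have h := norm_integral_charDefect_le hε P S hw hE zero_le_one r
  rw [integral_cexp_mul_charDefect P S hw0 hvw] at h
  simp only [pow_zero, one_mul, integral_cexp_gaussianPDFReal hw0,
    integral_cexp_gaussianPDFReal (one_ne_zero : (1 : ℝ≥0) ≠ 0)] at h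
  have e : ∑ ω, (P ω : ℂ) * (2 * Real.pi * gaussianPDFReal 0 w (r - S ω))
      - 2 * Real.pi * gaussianPDFReal 0 1 r
      = ((2 * Real.pi * (mixDensity P S w r - gaussianPDFReal 0 1 r) : ℝ) : ℂ) := by
    simp only [mixDensity, gaussianPDFReal_eq_zero_sub (S _) w r]
    push_cast
    rw [mul_sub, Finset.mul_sum]
    congr 1
    exact Finset.sum_congr rfl fun ω _ => by ring
  rw [e, Complex.norm_real, Real.norm_eq_abs, abs_mul, abs_of_pos (by positivity)] at h
  have h2 : (1 : ℝ) ≤ 2 * Real.pi := by linarith [Real.pi_gt_three]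
  calc _ ≤ 2 * Real.pi * |mixDensity P S w r - gaussianPDFReal 0 1 r| :=
        le_mul_of_one_le_left (abs_nonneg _) h2
    _ ≤ _ := h

/-- The case `k = 1` controls the quantity `D` below, built from `r - S`. Writing `S = r - (r - S)`
and `v = 1 - w` expresses the score difference as `r` times the density difference minus `D`; the
factor `1 + |r|` comes from this. -/
lemma abs_mixScore_sub_le {ε η : ℝ} (hε : 0 < ε) (P S : Ω → ℝ) {v w : ℝ≥0} (hvw : v + w = 1)
    (hw : ε ≤ w) (hE : ∀ t, ‖charDefect P S v t‖ ≤ η * (|t| ^ 3 + |t| ^ 4)) (r : ℝ) :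
    |mixScore P S w r - v * (r * gaussianPDFReal 0 1 r)|
      ≤ (1 + |r|) * (η * smoothingConst ε) := by
  have hw0 : w ≠ 0 := by rintro rfl; simp at hw; linarith
  have h := norm_integral_charDefect_le hε P S hw hE le_rfl r
  have hw1 : (w : ℝ) ≤ 1 := by
    have : (v : ℝ) + w = 1 := by exact_mod_cast hvw
    linarith [v.2]
  have h' : ‖(w : ℂ) * ∫ t : ℝ, (t : ℂ) ^ 1 * Complex.exp (Complex.I * t * r - w * t ^ 2 / 2)
      * charDefect P S v t‖ ≤ η * smoothingConst ε := by
    rw [norm_mul]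
    have : ‖(w : ℂ)‖ = w := by simp
    rw [this]
    exact (mul_le_of_le_one_left (norm_nonneg _) hw1).trans h
  rw [integral_cexp_mul_charDefect P S hw0 hvw] at h'
  have h1 := integral_mul_cexp_gaussianPDFReal (one_ne_zero : (1 : ℝ≥0) ≠ 0) r
  simp only [NNReal.coe_one, Complex.ofReal_one, one_mul] at h1
  rw [mul_sub, Finset.mul_sum] at h'
  simp only [pow_one, NNReal.coe_one, Complex.ofReal_one, mul_left_comm (w : ℂ) (P _ : ℂ),
    integral_mul_cexp_gaussianPDFReal hw0, one_mul, h1] at h'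
  set D : ℝ := ∑ ω, P ω * ((r - S ω) * gaussianPDFReal (S ω) w r)
    - w * (r * gaussianPDFReal 0 1 r) with hD
  have e : ∑ ω, (P ω : ℂ) * (Complex.I * (r - S ω : ℝ)
        * (2 * Real.pi * gaussianPDFReal 0 w (r - S ω)))
      - w * (Complex.I * r * (2 * Real.pi * gaussianPDFReal 0 1 r))
      = Complex.I * ((2 * Real.pi * D : ℝ) : ℂ) := by
    simp only [hD, gaussianPDFReal_eq_zero_sub (S _) w r]
    push_cast
    rw [mul_sub, mul_sub, Finset.mul_sum, Finset.mul_sum]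
    congr 1
    · exact Finset.sum_congr rfl fun ω _ => by ring
    · ring
  rw [e, norm_mul, Complex.norm_I, one_mul, Complex.norm_real, Real.norm_eq_abs, abs_mul,
    abs_of_pos (by positivity)] at h'
  have h2 : (1 : ℝ) ≤ 2 * Real.pi := by linarith [Real.pi_gt_three]
  have hD' : |D| ≤ η * smoothingConst ε :=
    (le_mul_of_one_le_left (abs_nonneg _) h2).trans h'
  have key : mixScore P S w r - v * (r * gaussianPDFReal 0 1 r)
      = r * (mixDensity P S w r - gaussianPDFReal 0 1 r) - D := by
    have hv : (v : ℝ) = 1 - w := by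
      have : (v : ℝ) + w = 1 := by exact_mod_cast hvw
      linarith
    simp only [hD, mixScore, mixDensity, hv, mul_sub, Finset.mul_sum]
    have : ∀ ω, P ω * ((r - S ω) * gaussianPDFReal (S ω) w r)
      = r * (P ω * gaussianPDFReal (S ω) w r) - P ω * S ω * gaussianPDFReal (S ω) w r :=
      fun ω => by ring
    simp only [this, Finset.sum_sub_distrib]
    ring
  rw [key]
  calc _ ≤ |r * (mixDensity P S w r - gaussianPDFReal 0 1 r)| + |D| := abs_sub _ _
    _ ≤ |r| * (η * smoothingConst ε) + η * smoothingConst ε := by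
        rw [abs_mul]
        gcongr
        exact abs_mixDensity_sub_le hε P S hvw hw hE r
    _ = _ := by ring

/-- The pointwise bound is used on `[-M, M]` and Markov's inequality outside. This converts uniform
closeness into `L¹` closeness. -/
lemma integral_abs_le_of_tail {g : ℝ → ℝ} {B C M : ℝ} (hM : 0 < M) (hB : 0 ≤ B)
    (hg : Integrable g) (hg1 : Integrable fun r => |r| * |g r|)
    (hb : ∀ r, |g r| ≤ B * (1 + |r|)) (hC : ∫ r, |r| * |g r| ≤ C) :
    ∫ r, |g r| ≤ 2 * M * (B * (1 + M)) + C / M := by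
  have hi : Integrable (Set.indicator (Set.Icc (-M) M) fun _ => B * (1 + M)) := by
    rw [integrable_indicator_iff measurableSet_Icc]
    exact integrableOn_const (by simp)
  calc ∫ r, |g r| ≤ ∫ r, (Set.indicator (Set.Icc (-M) M) (fun _ => B * (1 + M)) r
        + M⁻¹ * (|r| * |g r|)) := by
        refine integral_mono hg.abs (hi.add (hg1.const_mul _)) fun r => ?_
        by_cases hr : r ∈ Set.Icc (-M) M
        · have : |r| ≤ M := abs_le.2 hr
          simp only [hr, Set.indicator_of_mem]
          have h1 : |g r| ≤ B * (1 + M) := (hb r).trans (by gcongr)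
          have : 0 ≤ M⁻¹ * (|r| * |g r|) := by positivity
          linarith
        · have : M < |r| := by
            by_contra h
            exact hr (abs_le.1 (not_lt.1 h))
          simp only [hr, not_false_eq_true, Set.indicator_of_notMem, zero_add]
          rw [← mul_assoc]
          refine le_mul_of_one_le_left (abs_nonneg _) ?_
          rw [inv_mul_eq_div, one_le_div hM]
          exact this.le
    _ = 2 * M * (B * (1 + M)) + M⁻¹ * ∫ r, |r| * |g r| := by
        rw [integral_add hi (hg1.const_mul _), integral_const_mul,
          integral_indicator measurableSet_Icc, setIntegral_const]
        simp [measureReal_def, Real.volume_Icc]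
        rw [ENNReal.toReal_ofReal (by linarith)]
        left; ring
    _ ≤ _ := by
        rw [div_eq_inv_mul]
        gcongr

/-- Both densities have second moment `v + w = 1`, so the tail estimate applies even to the
difference weighted by `1 + |r|`. The weight is needed for tangents, whose densities carry a factor
`r`. -/
lemma integral_weighted_abs_mixDensity_sub_le {ε η M : ℝ} (hε : 0 < ε) (hM : 0 < M) {P : Ω → ℝ}
    (hP : ∀ ω, 0 ≤ P ω) (hP1 : ∑ ω, P ω = 1) {S : Ω → ℝ} {v w : ℝ≥0} (hvw : v + w = 1)
    (hS : ∑ ω, P ω * S ω ^ 2 = v) (hw : ε ≤ w)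
    (hE : ∀ t, ‖charDefect P S v t‖ ≤ η * (|t| ^ 3 + |t| ^ 4)) :
    ∫ r, (1 + |r|) * |mixDensity P S w r - gaussianPDFReal 0 1 r|
      ≤ 2 * M * (η * smoothingConst ε * (1 + M)) + 4 / M := by
  have hw0 : w ≠ 0 := by rintro rfl; simp at hw; linarith
  have hvw' : (v : ℝ) + w = 1 := by exact_mod_cast hvw
  have hB : 0 ≤ η * smoothingConst ε :=
    (abs_nonneg _).trans (abs_mixDensity_sub_le hε P S hvw hw hE 0)
  have i0 := (integrable_mixDensity P S w).add (integrable_gaussianPDFReal 0 1)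
  have i2 := (integrable_sq_mul_mixDensity P S hw0).add
    (integrable_sq_mul_gaussianPDFReal 0 (one_ne_zero : (1 : ℝ≥0) ≠ 0))
  set h : ℝ → ℝ := fun r => mixDensity P S w r - gaussianPDFReal 0 1 r with hh
  have hm : Measurable h := by
    simp only [hh, mixDensity]
    fun_prop
  have hle : ∀ r, |h r| ≤ mixDensity P S w r + gaussianPDFReal 0 1 r := fun r => by
    refine (abs_sub _ _).trans_eq ?_
    rw [abs_of_nonneg (mixDensity_nonneg hP S w r), abs_of_nonneg (gaussianPDFReal_nonneg _ _ _)]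
  have hnn : ∀ r, 0 ≤ mixDensity P S w r + gaussianPDFReal 0 1 r := fun r =>
    (abs_nonneg _).trans (hle r)
  -- From `|r| (1 + |r|) ≤ 1/2 + (3/2) r²`. The masses add up to 2 and so do the second moments,
  -- hence `∫ U = 1 + 3 = 4`.
  set U : ℝ → ℝ := fun r => 2⁻¹ * (mixDensity P S w r + gaussianPDFReal 0 1 r)
    + 3 / 2 * (r ^ 2 * mixDensity P S w r + r ^ 2 * gaussianPDFReal 0 1 r) with hU
  have iU : Integrable U := (i0.const_mul _).add (i2.const_mul _)
  have hUint : ∫ r, U r = 4 := by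
    have e0 : ∫ r, (mixDensity P S w r + gaussianPDFReal 0 1 r) = 2 := by
      rw [integral_add (integrable_mixDensity P S w) (integrable_gaussianPDFReal 0 1),
        integral_mixDensity hP1 S hw0, integral_gaussianPDFReal_eq_one _ one_ne_zero]
      norm_num
    have e2 : ∫ r, (r ^ 2 * mixDensity P S w r + r ^ 2 * gaussianPDFReal 0 1 r) = 2 := by
      rw [integral_add (integrable_sq_mul_mixDensity P S hw0)
        (integrable_sq_mul_gaussianPDFReal 0 one_ne_zero), integral_sq_mul_mixDensity hP1 S hw0,
        integral_sq_mul_gaussianPDFReal 0 one_ne_zero, hS, hvw']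
      norm_num
    have i0' : Integrable fun r => 2⁻¹ * (mixDensity P S w r + gaussianPDFReal 0 1 r) :=
      i0.const_mul _
    have i2' : Integrable fun r => (3 / 2 : ℝ) * (r ^ 2 * mixDensity P S w r
      + r ^ 2 * gaussianPDFReal 0 1 r) := i2.const_mul _
    rw [hU, integral_add i0' i2', integral_const_mul, integral_const_mul, e0, e2]
    norm_num
  have habs : ∀ r : ℝ, |(1 + |r|) * h r| = (1 + |r|) * |h r| := fun r => by
    rw [abs_mul, abs_of_nonneg (by positivity : 0 ≤ 1 + |r|)]
  have hbound1 : ∀ r : ℝ, |r| * |(1 + |r|) * h r| ≤ U r := fun r => by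
    rw [habs]
    have h1 : |r| * (1 + |r|) ≤ 2⁻¹ + 3 / 2 * r ^ 2 := by
      have := sq_nonneg (|r| - 1)
      have := sq_abs r
      nlinarith
    calc |r| * ((1 + |r|) * |h r|) = |r| * (1 + |r|) * |h r| := by ring
      _ ≤ (2⁻¹ + 3 / 2 * r ^ 2) * (mixDensity P S w r + gaussianPDFReal 0 1 r) := by
          gcongr
          exact hle r
      _ = U r := by simp only [hU]; ring
  have hbound0 : ∀ r : ℝ, |(1 + |r|) * h r| ≤ 3 * U r := fun r => by
    rw [habs]
    have h1 : 1 + |r| ≤ 3 * (2⁻¹ + 3 / 2 * r ^ 2) := by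
      have := sq_nonneg (|r| - 1)
      have := sq_abs r
      nlinarith
    calc (1 + |r|) * |h r|
        ≤ (3 * (2⁻¹ + 3 / 2 * r ^ 2)) * (mixDensity P S w r + gaussianPDFReal 0 1 r) := by
          gcongr
          exact hle r
      _ = 3 * U r := by simp only [hU]; ring
  have ig : Integrable fun r : ℝ => (1 + |r|) * h r :=
    (iU.const_mul 3).mono' (by fun_prop) (ae_of_all _ hbound0)
  have ig1 : Integrable fun r : ℝ => |r| * |(1 + |r|) * h r| :=
    iU.mono' (by fun_prop) (ae_of_all _ fun r => by
      rw [Real.norm_eq_abs, abs_of_nonneg (by positivity)]; exact hbound1 r)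
  have := integral_abs_le_of_tail hM hB ig ig1 (C := 4) (fun r => ?_)
    ((integral_mono ig1 iU hbound1).trans_eq hUint)
  · simpa only [habs] using this
  · rw [habs, mul_comm]
    exact mul_le_mul_of_nonneg_right (abs_mixDensity_sub_le hε P S hvw hw hE r) (by positivity)

/-- By `|r S| ≤ (S² + r²) / 2` the first absolute moment of the score is controlled by the variance
of `S` and the second moment of the smoothed law. -/
lemma integral_abs_mixScore_sub_le {ε η M : ℝ} (hε : 0 < ε) (hM : 0 < M) {P : Ω → ℝ}
    (hP : ∀ ω, 0 ≤ P ω) (hP1 : ∑ ω, P ω = 1) {S : Ω → ℝ} {v w : ℝ≥0} (hvw : v + w = 1)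
    (hS : ∑ ω, P ω * S ω ^ 2 = v) (hw : ε ≤ w)
    (hE : ∀ t, ‖charDefect P S v t‖ ≤ η * (|t| ^ 3 + |t| ^ 4)) :
    ∫ r, |mixScore P S w r - v * (r * gaussianPDFReal 0 1 r)|
      ≤ 2 * M * (η * smoothingConst ε * (1 + M)) + 4 / M := by
  have hw0 : w ≠ 0 := by rintro rfl; simp at hw; linarith
  have hvw' : (v : ℝ) + w = 1 := by exact_mod_cast hvw
  have hB : 0 ≤ η * smoothingConst ε :=
    (abs_nonneg _).trans (abs_mixDensity_sub_le hε P S hvw hw hE 0)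
  set g : ℝ → ℝ := fun r => mixScore P S w r - v * (r * gaussianPDFReal 0 1 r) with hg
  have hm : Measurable g := by
    simp only [hg, mixScore]
    fun_prop
  set V : ℝ → ℝ := fun r => mixDensity (fun ω => P ω * S ω ^ 2) S w r with hV
  have iV : Integrable V := integrable_mixDensity _ _ _
  have hVint : ∫ r, V r = v := by
    simp only [hV, mixDensity]
    rw [integral_finsetSum _ fun _ _ => (integrable_gaussianPDFReal _ _).const_mul _]
    simp only [integral_const_mul, integral_gaussianPDFReal_eq_one _ hw0, mul_one, hS]
  have i2 := integrable_sq_mul_mixDensity P S hw0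
  have i1 := (integrable_sq_mul_gaussianPDFReal 0 (one_ne_zero : (1 : ℝ≥0) ≠ 0)).const_mul (v : ℝ)
  have i0 := (integrable_gaussianPDFReal 0 1).const_mul (v : ℝ)
  have hsc : ∀ r : ℝ, |r| * |mixScore P S w r|
      ≤ 2⁻¹ * (V r + r ^ 2 * mixDensity P S w r) := fun r => by
    rw [← abs_mul, mixScore, Finset.mul_sum]
    refine (Finset.abs_sum_le_sum_abs _ _).trans ?_
    simp only [hV, mixDensity]
    rw [Finset.mul_sum, ← Finset.sum_add_distrib, Finset.mul_sum]
    refine Finset.sum_le_sum fun ω _ => ?_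
    have h0 : 0 ≤ P ω * gaussianPDFReal (S ω) w r :=
      mul_nonneg (hP ω) (gaussianPDFReal_nonneg _ _ _)
    have h1 : |r * S ω| ≤ 2⁻¹ * (S ω ^ 2 + r ^ 2) := by
      rw [abs_le]
      constructor <;> nlinarith [sq_nonneg (r - S ω), sq_nonneg (r + S ω)]
    calc |r * (P ω * S ω * gaussianPDFReal (S ω) w r)|
        = |r * S ω| * (P ω * gaussianPDFReal (S ω) w r) := by
          have h2 : r * (P ω * S ω * gaussianPDFReal (S ω) w r)
              = r * S ω * (P ω * gaussianPDFReal (S ω) w r) := by ring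
          rw [h2, abs_mul, abs_of_nonneg h0]
      _ ≤ 2⁻¹ * (S ω ^ 2 + r ^ 2) * (P ω * gaussianPDFReal (S ω) w r) := by gcongr
      _ = _ := by ring
  set U : ℝ → ℝ := fun r => 2⁻¹ * (V r + r ^ 2 * mixDensity P S w r)
    + v * (r ^ 2 * gaussianPDFReal 0 1 r) with hU
  have iU' : Integrable fun r => 2⁻¹ * (V r + r ^ 2 * mixDensity P S w r) :=
    (iV.add i2).const_mul _
  have iU : Integrable U := iU'.add i1
  have hUint : ∫ r, U r ≤ 4 := by
    rw [hU, integral_add iU' i1, integral_const_mul, integral_const_mul, integral_add iV i2, hVint,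
      integral_sq_mul_mixDensity hP1 S hw0, integral_sq_mul_gaussianPDFReal 0 one_ne_zero, hS,
      NNReal.coe_one]
    have := w.2
    have := v.2
    simp only [NNReal.val_eq_coe] at *
    linarith
  have hbound1 : ∀ r : ℝ, |r| * |g r| ≤ U r := fun r => by
    have h2 : |r| * |v * (r * gaussianPDFReal 0 1 r)| = v * (r ^ 2 * gaussianPDFReal 0 1 r) := by
      rw [abs_mul, abs_mul, NNReal.abs_eq, abs_of_nonneg (gaussianPDFReal_nonneg _ _ _), ← sq_abs]
      ring
    calc |r| * |g r| ≤ |r| * (|mixScore P S w r| + |v * (r * gaussianPDFReal 0 1 r)|) := by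
          gcongr
          exact abs_sub _ _
      _ ≤ U r := by
          rw [mul_add, h2]
          exact add_le_add (hsc r) le_rfl
  have ig : Integrable g := by
    refine (integrable_mixScore P S w).sub (Integrable.const_mul ?_ _)
    exact integrable_mul_gaussianPDFReal 0 one_ne_zero
  have ig1 : Integrable fun r : ℝ => |r| * |g r| :=
    iU.mono' (by fun_prop) (ae_of_all _ fun r => by
      rw [Real.norm_eq_abs, abs_of_nonneg (by positivity)]; exact hbound1 r)
  refine integral_abs_le_of_tail hM hB ig ig1 (C := 4) (fun r => ?_)
    ((integral_mono ig1 iU hbound1).trans hUint)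
  rw [mul_comm _ (1 + |r|)]
  exact abs_mixScore_sub_le hε P S hvw hw hE r

/-- Uniform Gaussian approximation: if the characteristic function of `S` is close to that of
`N(0, v)`, the smoothed law of `S` and the smoothed score are close to those of `N(0, 1)`. -/
theorem exists_charDefect_bound {ε δ : ℝ} (hε : 0 < ε) (hδ : 0 < δ) :
    ∃ η > 0, ∀ {Ω : Type} [Fintype Ω] (P S : Ω → ℝ) (v w : ℝ≥0), (∀ ω, 0 ≤ P ω) →
      ∑ ω, P ω = 1 → v + w = 1 → ∑ ω, P ω * S ω ^ 2 = v → ε ≤ w →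
      (∀ t, ‖charDefect P S v t‖ ≤ η * (|t| ^ 3 + |t| ^ 4)) →
      ∫ r, (1 + |r|) * |mixDensity P S w r - gaussianPDFReal 0 1 r| ≤ δ ∧
      ∫ r, |mixScore P S w r - v * (r * gaussianPDFReal 0 1 r)| ≤ δ := by
  -- The tail term `4 / M` becomes `δ / 2`, and `η` is then chosen so that the bulk term is at most
  -- `δ / 2`. The `+ 1` keeps the denominator of `η` positive without knowing that the constant is.
  set M : ℝ := 8 / δ with hM
  have hM0 : 0 < M := by positivity
  have hK := smoothingConst_nonneg ε
  set η : ℝ := δ / 2 / (2 * M * ((smoothingConst ε + 1) * (1 + M))) with hη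
  have hη0 : 0 < η := by positivity
  have hfin : 2 * M * (η * smoothingConst ε * (1 + M)) + 4 / M ≤ δ := by
    have h1 : 2 * M * (η * smoothingConst ε * (1 + M))
        ≤ 2 * M * (η * (smoothingConst ε + 1) * (1 + M)) := by
      gcongr; linarith
    have h2 : 2 * M * (η * (smoothingConst ε + 1) * (1 + M)) = δ / 2 := by
      rw [hη]; field_simp
    have h3 : 4 / M = δ / 2 := by rw [hM]; field_simp; norm_num
    linarith
  refine ⟨η, hη0, fun P S v w hP hP1 hvw hS hw hE => ⟨?_, ?_⟩⟩
  · exact (integral_weighted_abs_mixDensity_sub_le hε hM0 hP hP1 hvw hS hw hE).trans hfin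
  · exact (integral_abs_mixScore_sub_le hε hM0 hP hP1 hvw hS hw hE).trans hfin

end GaussianMixture

/-! ### Characteristic functions of sums of independent bounded variables -/

section ProductWeights

open Finset

/-- Telescoping: factors are exchanged one at a time while all others stay in the unit disc. -/
lemma norm_prod_sub_prod_le_sum {ι : Type} (s : Finset ι) {a b : ι → ℂ}
    (ha : ∀ i, ‖a i‖ ≤ 1) (hb : ∀ i, ‖b i‖ ≤ 1) :
    ‖∏ i ∈ s, a i - ∏ i ∈ s, b i‖ ≤ ∑ i ∈ s, ‖a i - b i‖ := by
  classical
  induction s using Finset.induction_on with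
  | empty => simp
  | insert j s hj ih =>
    rw [prod_insert hj, prod_insert hj, sum_insert hj]
    have h1 : ‖∏ i ∈ s, b i‖ ≤ 1 := by
      rw [norm_prod]
      exact prod_le_one (fun _ _ => norm_nonneg _) fun i _ => hb i
    have e : a j * ∏ i ∈ s, a i - b j * ∏ i ∈ s, b i
        = (a j - b j) * ∏ i ∈ s, b i + a j * (∏ i ∈ s, a i - ∏ i ∈ s, b i) := by ring
    rw [e]
    refine (norm_add_le _ _).trans (add_le_add ?_ ?_)
    · rw [norm_mul]
      exact mul_le_of_le_one_right (norm_nonneg _) h1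
    · rw [norm_mul]
      exact (mul_le_of_le_one_left (norm_nonneg _) (ha j)).trans ih

/-- For `|x| ≤ 1` this is the Taylor remainder; for `|x| > 1` every term separately is at most a
multiple of `|x|³`. -/
lemma norm_cexp_sub_taylor_two_le (x : ℝ) :
    ‖Complex.exp (-(Complex.I * x)) - (1 - Complex.I * x - x ^ 2 / 2)‖ ≤ 4 * |x| ^ 3 := by
  have hn : ‖-(Complex.I * (x : ℂ))‖ = |x| := by
    rw [norm_neg, norm_mul, Complex.norm_I, one_mul, Complex.norm_real, Real.norm_eq_abs]
  rcases le_or_gt |x| 1 with hx | hx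
  · have h := Complex.exp_bound (x := -(Complex.I * x)) (by rw [hn]; exact hx) (n := 3)
      (by norm_num)
    rw [hn] at h
    have e : ∑ m ∈ range 3, (-(Complex.I * (x : ℂ))) ^ m / (m.factorial : ℂ)
        = 1 - Complex.I * x - x ^ 2 / 2 := by
      simp only [sum_range_succ, sum_range_zero, Nat.factorial]
      rw [neg_sq, mul_pow, Complex.I_sq]
      push_cast
      ring
    rw [e] at h
    refine h.trans ?_
    rw [mul_comm]
    gcongr
    norm_num [Nat.factorial]
  · have h1 : ‖Complex.exp (-(Complex.I * x))‖ = 1 := by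
      have : -(Complex.I * (x : ℂ)) = ((-x : ℝ) : ℂ) * Complex.I := by push_cast; ring
      rw [this, Complex.norm_exp_ofReal_mul_I]
    have h2 : ‖(1 - Complex.I * x - x ^ 2 / 2 : ℂ)‖ ≤ 1 + |x| + |x| ^ 2 / 2 := by
      refine (norm_sub_le _ _).trans (add_le_add ((norm_sub_le _ _).trans ?_) ?_)
      · rw [norm_one, ← norm_neg (Complex.I * (x : ℂ)), hn]
      · simp
    refine (norm_sub_le _ _).trans ?_
    rw [h1]
    have h3 : 1 ≤ |x| ^ 3 := one_le_pow₀ hx.le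
    have h4 : |x| ≤ |x| ^ 3 := le_self_pow₀ hx.le (by norm_num)
    have h5 : |x| ^ 2 ≤ |x| ^ 3 := pow_le_pow_right₀ hx.le (by norm_num)
    linarith

/-- The upper estimate is `exp(-y) ≤ 1/(1+y) ≤ 1 - y + y²`. -/
lemma abs_exp_neg_sub_le {y : ℝ} (hy : 0 ≤ y) : |Real.exp (-y) - (1 - y)| ≤ y ^ 2 := by
  have h1 := Real.add_one_le_exp (-y)
  have h2 := Real.add_one_le_exp y
  rw [abs_of_nonneg (by linarith)]
  have h3 : Real.exp (-y) ≤ (1 + y)⁻¹ := by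
    rw [Real.exp_neg]
    exact inv_anti₀ (by linarith) (by linarith)
  have h4 : (1 + y)⁻¹ ≤ 1 - y + y ^ 2 := by
    rw [inv_le_iff_one_le_mul₀ (by linarith)]
    nlinarith [pow_nonneg hy 3]
  linarith

variable {ι Y : Type} [Fintype ι] [Fintype Y]

lemma sum_prod_mul [DecidableEq ι] {R : Type} [CommRing R] (g : ι → Y → R) :
    ∑ y : ι → Y, ∏ i, g i (y i) = ∏ i, ∑ b, g i b := by
  rw [Finset.prod_univ_sum, Fintype.piFinset_univ]

lemma sum_prod_mul_apply [DecidableEq ι] {p : ι → Y → ℝ} (hp : ∀ i, ∑ b, p i b = 1) (j : ι)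
    (f : Y → ℝ) : ∑ y : ι → Y, (∏ i, p i (y i)) * f (y j) = ∑ b, p j b * f b := by
  have h := sum_prod_mul (fun i b => p i b * if i = j then f b else 1)
  simp only [prod_mul_distrib, prod_ite_eq', mem_univ, if_true] at h
  rw [h, ← mul_prod_erase univ _ (mem_univ j)]
  simp only [if_true]
  rw [prod_eq_one, mul_one]
  intro i hi
  simp [ne_of_mem_erase hi, hp]

lemma sum_prod_mul_apply_mul_apply [DecidableEq ι] {p : ι → Y → ℝ} {ξ : ι → Y → ℝ}
    (hξ : ∀ i, ∑ b, p i b * ξ i b = 0) {j k : ι} (hjk : j ≠ k) :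
    ∑ y : ι → Y, (∏ i, p i (y i)) * (ξ j (y j) * ξ k (y k)) = 0 := by
  have h := sum_prod_mul
    (fun i b => p i b * ((if i = j then ξ i b else 1) * (if i = k then ξ i b else 1)))
  simp only [prod_mul_distrib, prod_ite_eq', mem_univ, if_true] at h
  rw [h]
  refine prod_eq_zero (mem_univ j) ?_
  simpa [hjk] using hξ j

lemma sum_prod_mul_sum_sq [DecidableEq ι] {p : ι → Y → ℝ} (hp : ∀ i, ∑ b, p i b = 1)
    {ξ : ι → Y → ℝ} (hξ : ∀ i, ∑ b, p i b * ξ i b = 0) :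
    ∑ y : ι → Y, (∏ i, p i (y i)) * (∑ i, ξ i (y i)) ^ 2 = ∑ i, ∑ b, p i b * ξ i b ^ 2 := by
  have h : ∀ y : ι → Y, (∏ i, p i (y i)) * (∑ i, ξ i (y i)) ^ 2
      = ∑ j, ∑ k, (∏ i, p i (y i)) * (ξ j (y j) * ξ k (y k)) := fun y => by
    rw [sq, sum_mul_sum]; simp only [mul_sum]
  rw [sum_congr rfl fun y _ => h y, sum_comm]
  simp only [sq]
  refine sum_congr rfl fun j _ => ?_
  rw [sum_comm, sum_eq_single j]
  · exact sum_prod_mul_apply hp j fun b => ξ j b * ξ j b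
  · intro k _ hk
    exact sum_prod_mul_apply_mul_apply hξ hk.symm
  · simp

/-- Both terms are compared with `1 - σ t²/2`. The mean vanishes, so the Taylor remainder costs `4
β³ |t|³`; the Gaussian factor costs at most `σ² t⁴ ≤ β⁴ t⁴`. -/
lemma norm_charDefect_single_le {p ξ : Y → ℝ} (hp0 : ∀ b, 0 ≤ p b) (hp : ∑ b, p b = 1)
    (hξ : ∑ b, p b * ξ b = 0) {β : ℝ} (hβ : ∀ b, |ξ b| ≤ β) (t : ℝ) :
    ‖∑ b, (p b : ℂ) * Complex.exp (-(Complex.I * t * ξ b))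
      - Complex.exp (-((∑ b, p b * ξ b ^ 2 : ℝ) * t ^ 2 / 2))‖
      ≤ 4 * β ^ 3 * |t| ^ 3 + β ^ 4 * |t| ^ 4 := by
  set σ : ℝ := ∑ b, p b * ξ b ^ 2 with hσ
  have hβ0 : 0 ≤ β := by
    by_contra h
    have : IsEmpty Y := ⟨fun b => absurd ((abs_nonneg _).trans (hβ b)) h⟩
    simp at hp
  have hσ0 : 0 ≤ σ := sum_nonneg fun b _ => mul_nonneg (hp0 b) (sq_nonneg _)
  have hσβ : σ ≤ β ^ 2 := by
    calc σ ≤ ∑ b, p b * β ^ 2 := sum_le_sum fun b _ => by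
          have := hp0 b
          have := sq_le_sq' (neg_le_of_abs_le (hβ b)) (le_of_abs_le (hβ b))
          gcongr
      _ = β ^ 2 := by rw [← sum_mul, hp, one_mul]
  have e1 : ∑ b, (p b : ℂ) * (1 - Complex.I * (t * ξ b : ℝ) - (t * ξ b : ℝ) ^ 2 / 2)
      = (1 - σ * t ^ 2 / 2 : ℂ) := by
    have hp' : ∑ b, (p b : ℂ) = 1 := by exact_mod_cast hp
    have hξ' : ∑ b, (p b : ℂ) * ξ b = 0 := by exact_mod_cast hξ
    have hσ' : (σ : ℂ) = ∑ b, (p b : ℂ) * ξ b ^ 2 := by rw [hσ]; push_cast; rfl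
    have : ∀ b, (p b : ℂ) * (1 - Complex.I * (t * ξ b : ℝ) - (t * ξ b : ℝ) ^ 2 / 2)
        = p b - Complex.I * t * (p b * ξ b) - t ^ 2 / 2 * (p b * ξ b ^ 2) := fun b => by
      push_cast; ring
    simp only [this, sum_sub_distrib, ← mul_sum, hp', hξ', ← hσ']
    ring
  have hA : ‖∑ b, (p b : ℂ) * Complex.exp (-(Complex.I * t * ξ b)) - (1 - σ * t ^ 2 / 2)‖
      ≤ 4 * β ^ 3 * |t| ^ 3 := by
    rw [← e1, ← sum_sub_distrib]
    refine (norm_sum_le _ _).trans ?_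
    calc _ ≤ ∑ b, p b * (4 * β ^ 3 * |t| ^ 3) := sum_le_sum fun b _ => by
          rw [← mul_sub, norm_mul, Complex.norm_real, Real.norm_eq_abs, abs_of_nonneg (hp0 b)]
          refine mul_le_mul_of_nonneg_left ?_ (hp0 b)
          have := norm_cexp_sub_taylor_two_le (t * ξ b)
          have e2 : Complex.I * ((t * ξ b : ℝ) : ℂ) = Complex.I * t * ξ b := by push_cast; ring
          rw [e2] at this ⊢
          refine this.trans ?_
          rw [abs_mul, mul_pow]
          have := pow_le_pow_left₀ (abs_nonneg _) (hβ b) 3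
          nlinarith [pow_nonneg (abs_nonneg t) 3]
      _ = _ := by rw [← sum_mul, hp, one_mul]
  have hB : ‖(1 - σ * t ^ 2 / 2 : ℂ) - Complex.exp (-(σ * t ^ 2 / 2))‖ ≤ β ^ 4 * |t| ^ 4 := by
    have h := abs_exp_neg_sub_le (y := σ * t ^ 2 / 2) (by positivity)
    have e3 : (1 - σ * t ^ 2 / 2 : ℂ) - Complex.exp (-(σ * t ^ 2 / 2))
        = ((-(Real.exp (-(σ * t ^ 2 / 2)) - (1 - σ * t ^ 2 / 2)) : ℝ) : ℂ) := by
      push_cast; ring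
    rw [e3, Complex.norm_real, Real.norm_eq_abs, abs_neg]
    refine h.trans ?_
    have h1 : σ ^ 2 ≤ β ^ 4 := by
      calc σ ^ 2 ≤ (β ^ 2) ^ 2 := by gcongr
        _ = β ^ 4 := by ring
    have h2 : |t| ^ 4 = t ^ 4 := by
      rw [← abs_pow, abs_of_nonneg (by positivity)]
    rw [h2]
    have h3 : 0 ≤ t ^ 4 := by positivity
    calc (σ * t ^ 2 / 2) ^ 2 = σ ^ 2 * t ^ 4 / 4 := by ring
      _ ≤ σ ^ 2 * t ^ 4 := by
          have : 0 ≤ σ ^ 2 * t ^ 4 := by positivity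
          linarith
      _ ≤ _ := by gcongr
  calc _ ≤ _ := norm_sub_le_norm_sub_add_norm_sub _ (1 - σ * t ^ 2 / 2 : ℂ) _
    _ ≤ _ := add_le_add hA hB

/-- Independence factorizes both characteristic functions, and each factor is replaced by the
Gaussian one of equal variance. -/
lemma norm_charDefect_prod_le [DecidableEq ι] {p ξ : ι → Y → ℝ} (hp0 : ∀ i b, 0 ≤ p i b)
    (hp : ∀ i, ∑ b, p i b = 1) (hξ : ∀ i, ∑ b, p i b * ξ i b = 0) {β : ℝ}
    (hβ : ∀ i b, |ξ i b| ≤ β) {v : ℝ≥0} (hv : (v : ℝ) = ∑ i, ∑ b, p i b * ξ i b ^ 2) (t : ℝ) :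
    ‖charDefect (fun y : ι → Y => ∏ i, p i (y i)) (fun y => ∑ i, ξ i (y i)) v t‖
      ≤ Fintype.card ι * (4 * β ^ 3 * |t| ^ 3 + β ^ 4 * |t| ^ 4) := by
  have e1 : ∑ y : ι → Y, ((∏ i, p i (y i) : ℝ) : ℂ)
      * Complex.exp (-(Complex.I * t * (∑ i, ξ i (y i) : ℝ)))
      = ∏ i, ∑ b, (p i b : ℂ) * Complex.exp (-(Complex.I * t * ξ i b)) := by
    rw [← sum_prod_mul]
    refine sum_congr rfl fun y _ => ?_
    rw [prod_mul_distrib, ← Complex.exp_sum]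
    push_cast
    rw [mul_sum, sum_neg_distrib]
  have e2 : Complex.exp (-(v * t ^ 2 / 2))
      = ∏ i, Complex.exp (-((∑ b, p i b * ξ i b ^ 2 : ℝ) * t ^ 2 / 2)) := by
    rw [← Complex.exp_sum, sum_neg_distrib, ← sum_div, ← sum_mul, ← Complex.ofReal_sum, ← hv]
  rw [charDefect, e1, e2]
  refine (norm_prod_sub_prod_le_sum _ (fun i => ?_) fun i => ?_).trans ?_
  · refine (norm_sum_le _ _).trans ((sum_le_sum fun b _ => ?_).trans (hp i).le)
    have : -(Complex.I * t * ξ i b) = ((-(t * ξ i b) : ℝ) : ℂ) * Complex.I := by push_cast; ring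
    rw [norm_mul, this, Complex.norm_exp_ofReal_mul_I, mul_one, Complex.norm_real,
      Real.norm_eq_abs, abs_of_nonneg (hp0 i b)]
  · have : -((∑ b, p i b * ξ i b ^ 2 : ℝ) * t ^ 2 / 2 : ℂ)
        = ((-((∑ b, p i b * ξ i b ^ 2) * t ^ 2 / 2) : ℝ) : ℂ) := by push_cast; rfl
    rw [this, ← Complex.ofReal_exp, Complex.norm_real, Real.norm_eq_abs, Real.abs_exp]
    apply Real.exp_le_one_iff.2
    have : 0 ≤ ∑ b, p i b * ξ i b ^ 2 := sum_nonneg fun b _ => mul_nonneg (hp0 i b) (sq_nonneg _)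
    have : 0 ≤ (∑ b, p i b * ξ i b ^ 2) * t ^ 2 / 2 := by positivity
    linarith
  · refine (sum_le_sum fun i _ => norm_charDefect_single_le (hp0 i) (hp i) (hξ i) (hβ i) t).trans ?_
    rw [sum_const, nsmul_eq_mul, card_univ]

end ProductWeights

/-- Uniform Gaussian approximation for sums of `n` independent centred variables bounded by
`b / √n`. -/
theorem eventually_product_approx {ε δ : ℝ} (b : ℝ) (hε : 0 < ε) (hδ : 0 < δ) :
    ∀ᶠ n : ℕ in atTop, ∀ {Y : Type} [Fintype Y] (p ξ : Fin n → Y → ℝ) (v w : ℝ≥0),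
      (∀ i y, 0 ≤ p i y) → (∀ i, ∑ y, p i y = 1) → (∀ i, ∑ y, p i y * ξ i y = 0) →
      (∀ i y, |ξ i y| ≤ b / √n) → v + w = 1 → ∑ i, ∑ y, p i y * ξ i y ^ 2 = (v : ℝ) → ε ≤ w →
      ∫ r, (1 + |r|) * |mixDensity (fun y : Fin n → Y => ∏ i, p i (y i))
          (fun y => ∑ i, ξ i (y i)) w r - gaussianPDFReal 0 1 r| ≤ δ ∧
      ∫ r, |mixScore (fun y : Fin n → Y => ∏ i, p i (y i)) (fun y => ∑ i, ξ i (y i)) w r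
          - v * (r * gaussianPDFReal 0 1 r)| ≤ δ := by
  obtain ⟨η, hη, H⟩ := exists_charDefect_bound hε hδ
  have hβ : Tendsto (fun n : ℕ => b / √(n : ℝ)) atTop (𝓝 0) :=
    (Real.tendsto_sqrt_atTop.comp tendsto_natCast_atTop_atTop).const_div_atTop b
  -- With `β = b/√n` one has `n β² = b²`, so the product bound `n (4 β³ |t|³ + β⁴ |t|⁴)` is at most
  -- `b² (4 β + β²) (|t|³ + |t|⁴)`. The coefficient tends to zero irrespective of `p` and `ξ`.
  have hlim : Tendsto (fun n : ℕ => b ^ 2 * (4 * |b / √(n : ℝ)| + (b / √(n : ℝ)) ^ 2)) atTop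
      (𝓝 0) := by
    have := ((hβ.abs.const_mul 4).add (hβ.pow 2)).const_mul (b ^ 2)
    simpa using this
  filter_upwards [hlim.eventually_le_const hη, eventually_gt_atTop 0] with n hn hn0
  intro Y _ p ξ v w hp0 hp hξ hb hvw hv hw
  classical
  have : Nonempty (Fin n) := ⟨⟨0, hn0⟩⟩
  obtain ⟨i0⟩ := this
  refine H _ _ v w (fun y => Finset.prod_nonneg fun i _ => hp0 i _) ?_ hvw ?_ hw fun t => ?_
  · rw [sum_prod_mul]; simp [hp]
  · rw [sum_prod_mul_sum_sq hp hξ, hv]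
  refine (norm_charDefect_prod_le hp0 hp hξ hb hv.symm t).trans ?_
  obtain ⟨y0⟩ : Nonempty Y := by
    by_contra h
    have := hp i0
    rw [not_nonempty_iff] at h
    simp at this
  have hb0 : 0 ≤ b / √(n : ℝ) := (abs_nonneg _).trans (hb i0 y0)
  rw [abs_of_nonneg hb0] at hn
  set β := b / √(n : ℝ) with hβd
  have hn' : (0 : ℝ) < n := by exact_mod_cast hn0
  have hb2 : b ^ 2 = n * β ^ 2 := by
    rw [hβd, div_pow, Real.sq_sqrt hn'.le]; field_simp
  rw [Fintype.card_fin]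
  have h3 : 0 ≤ |t| ^ 3 := by positivity
  have h4 : 0 ≤ |t| ^ 4 := by positivity
  have hβ3 : 0 ≤ β ^ 3 := by positivity
  have hβ4 : 0 ≤ β ^ 4 := by positivity
  calc (n : ℝ) * (4 * β ^ 3 * |t| ^ 3 + β ^ 4 * |t| ^ 4)
      ≤ n * ((4 * β ^ 3 + β ^ 4) * (|t| ^ 3 + |t| ^ 4)) := by
        gcongr
        nlinarith [mul_nonneg hβ3 h4, mul_nonneg hβ4 h3]
    _ = b ^ 2 * (4 * β + β ^ 2) * (|t| ^ 3 + |t| ^ 4) := by rw [hb2]; ring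
    _ ≤ _ := by gcongr

/-! ### Signed kernels: evaluation, completely bounded norm, Fisher information -/

section SignedChannels

variable {X Y : Type} [MeasurableSpace X] [MeasurableSpace Y]

lemma measureReal_bind (κ : Kernel X Y) (μ : Measure X) [IsFiniteKernel κ] {B : Set Y}
    (hB : MeasurableSet B) : (κ ∘ₘ μ).real B = ∫ x, (κ x).real B ∂μ := by
  simp only [measureReal_def]
  rw [Measure.bind_apply hB κ.aemeasurable, integral_toReal]
  · exact (Kernel.measurable_coe κ hB).aemeasurable
  · exact ae_of_all _ fun x => measure_lt_top _ _

lemma measurable_kernel_real (κ : Kernel X Y) {B : Set Y} (hB : MeasurableSet B) :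
    Measurable fun x => (κ x).real B :=
  (Kernel.measurable_coe κ hB).ennreal_toReal

lemma integrable_kernel_real (κ : Kernel X Y) [IsFiniteKernel κ] (μ : Measure X)
    [IsFiniteMeasure μ] {B : Set Y} (hB : MeasurableSet B) :
    Integrable (fun x => (κ x).real B) μ := by
  refine Integrable.of_bound (measurable_kernel_real κ hB).aestronglyMeasurable
    κ.bound.toReal (ae_of_all _ fun x => ?_)
  rw [Real.norm_eq_abs, abs_of_nonneg measureReal_nonneg]
  exact ENNReal.toReal_mono (Kernel.bound_lt_top κ).ne (Kernel.measure_le_bound κ x B)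

namespace SignedChannel

lemma signed_apply (Δ : SignedChannel X Y) (x : X) {B : Set Y} (hB : MeasurableSet B) :
    Δ.signed x B = (Δ.pos x).real B - (Δ.neg x).real B :=
  Measure.toSignedMeasure_sub_apply hB

lemma measurable_signed (Δ : SignedChannel X Y) {B : Set Y} (hB : MeasurableSet B) :
    Measurable fun x => Δ.signed x B := by
  simp only [Δ.signed_apply _ hB]
  exact (measurable_kernel_real _ hB).sub (measurable_kernel_real _ hB)

lemma integrable_signed (Δ : SignedChannel X Y) (μ : Measure X) [IsFiniteMeasure μ] {B : Set Y}
    (hB : MeasurableSet B) : Integrable (fun x => Δ.signed x B) μ := by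
  simp only [Δ.signed_apply _ hB]
  exact (integrable_kernel_real _ _ hB).sub (integrable_kernel_real _ _ hB)

lemma apply_apply (Δ : SignedChannel X Y) (p : ProbabilityMeasure X) {B : Set Y}
    (hB : MeasurableSet B) : Δ.apply p B = ∫ x, Δ.signed x B ∂(p : Measure X) := by
  rw [apply, Measure.toSignedMeasure_sub_apply hB, measureReal_bind _ _ hB,
    measureReal_bind _ _ hB, ← integral_sub (integrable_kernel_real _ _ hB)
    (integrable_kernel_real _ _ hB)]
  simp only [Δ.signed_apply _ hB]

lemma precomp_signed_apply {X' : Type} [MeasurableSpace X'] (Δ : SignedChannel X Y)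
    (Ψ : Kernel X' X) [IsMarkovKernel Ψ] (x : X') {B : Set Y} (hB : MeasurableSet B) :
    (Δ.precomp Ψ).signed x B = ∫ z, Δ.signed z B ∂(Ψ x) := by
  simp only [Δ.signed_apply _ hB, signed_apply _ _ hB, precomp, Kernel.comp_apply]
  rw [measureReal_bind _ _ hB, measureReal_bind _ _ hB,
    ← integral_sub (integrable_kernel_real _ _ hB) (integrable_kernel_real _ _ hB)]

lemma postcomp_signed_apply {Y' : Type} [MeasurableSpace Y'] (Δ : SignedChannel X Y)
    (Ψ : Kernel Y Y') [IsMarkovKernel Ψ] (x : X) {B : Set Y'} (hB : MeasurableSet B) :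
    (Δ.postcomp Ψ).signed x B
      = ∫ y, (Ψ y).real B ∂(Δ.pos x) - ∫ y, (Ψ y).real B ∂(Δ.neg x) := by
  rw [signed_apply _ _ hB, postcomp, Kernel.comp_apply, Kernel.comp_apply,
    measureReal_bind _ _ hB, measureReal_bind _ _ hB]

lemma signed_univ (Δ : SignedChannel X Y) (x : X) : Δ.signed x Set.univ = 0 := by
  rw [signed_apply _ _ MeasurableSet.univ, measureReal_def, measureReal_def, Δ.mass_eq, sub_self]

lemma tensorId_signed_apply {Z : Type} [MeasurableSpace Z] (Δ : SignedChannel X Y) (x : X × Z)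
    {B : Set (Y × Z)} (hB : MeasurableSet B) :
    (Δ.tensorId Z).signed x B = Δ.signed x.1 {y | (y, x.2) ∈ B} := by
  have hB' : MeasurableSet {y | (y, x.2) ∈ B} := measurable_prodMk_right hB
  rw [signed_apply _ _ hB, signed_apply _ _ hB']
  simp only [tensorId, Kernel.parallelComp_apply, Kernel.id_apply, measureReal_def]
  rw [Measure.prod_dirac, Measure.prod_dirac, Measure.map_apply measurable_prodMk_right hB,
    Measure.map_apply measurable_prodMk_right hB]
  rfl

end SignedChannel

/-- On a Hahn decomposition the total variation is the sum of a value of `s` and a value of `-s`. -/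
lemma tvNorm_le {s : SignedMeasure Y} {C : ℝ} (h1 : ∀ B, MeasurableSet B → s B ≤ C)
    (h2 : ∀ B, MeasurableSet B → -s B ≤ C) : tvNorm s ≤ ENNReal.ofReal (2 * C) := by
  have hC : 0 ≤ C := by simpa using h1 ∅ MeasurableSet.empty
  obtain ⟨i, hi₁, hi₂, hi₃, hpos, hneg⟩ := s.toJordanDecomposition_spec
  rw [tvNorm, SignedMeasure.totalVariation, Measure.add_apply, hpos, hneg, two_mul,
    ENNReal.ofReal_add hC hC]
  refine add_le_add ?_ ?_
  · rw [SignedMeasure.toMeasureOfZeroLE_apply _ _ _ MeasurableSet.univ, ENNReal.ofReal]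
    simp only [ENNReal.coe_le_coe]
    rw [← NNReal.coe_le_coe, Real.coe_toNNReal _ hC]
    exact h1 _ (hi₁.inter MeasurableSet.univ)
  · rw [SignedMeasure.toMeasureOfLEZero_apply _ _ _ MeasurableSet.univ, ENNReal.ofReal]
    simp only [ENNReal.coe_le_coe]
    rw [← NNReal.coe_le_coe, Real.coe_toNNReal _ hC]
    exact h2 _ (hi₁.compl.inter MeasurableSet.univ)

/-- The ancilla adds nothing to a pointwise bound: at `(x, z)` the extended kernel evaluates
`Λ(·|x)` on a section of `B`, and averaging over inputs preserves the bound. One sign suffices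
because `Λ(·|x)` has total mass zero. -/
lemma SignedChannel.cbNorm_le {Λ : SignedChannel X Y} {C : ℝ}
    (h : ∀ x B, MeasurableSet B → Λ.signed x B ≤ C) : Λ.cbNorm ≤ ENNReal.ofReal (2 * C) := by
  have h' : ∀ x B, MeasurableSet B → -Λ.signed x B ≤ C := fun x B hB => by
    have := VectorMeasure.of_add_of_sdiff (v := Λ.signed x) hB MeasurableSet.univ
      (Set.subset_univ B)
    rw [Λ.signed_univ] at this
    have := h x (Set.univ \ B) (MeasurableSet.univ.diff hB)
    linarith
  refine iSup_le fun Z => iSup_le fun _ => iSup_le fun p =>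
    tvNorm_le (fun B hB => ?_) fun B hB => ?_
  · rw [SignedChannel.apply_apply _ _ hB]
    calc _ ≤ ∫ _, C ∂(p : Measure (X × Z)) := by
          refine integral_mono (SignedChannel.integrable_signed _ _ hB) (integrable_const _)
            fun x => ?_
          simp only
          rw [SignedChannel.tensorId_signed_apply _ _ hB]
          exact h _ _ (measurable_prodMk_right hB)
      _ = C := by simp
  · rw [SignedChannel.apply_apply _ _ hB, ← integral_neg]
    calc _ ≤ ∫ _, C ∂(p : Measure (X × Z)) := by
          refine integral_mono (SignedChannel.integrable_signed _ _ hB).neg (integrable_const _)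
            fun x => ?_
          simp only
          rw [SignedChannel.tensorId_signed_apply _ _ hB]
          exact h' _ _ (measurable_prodMk_right hB)
      _ = C := by simp

lemma ennrealToMeasure_toENNRealVectorMeasure (p : Measure Y) :
    p.toENNRealVectorMeasure.ennrealToMeasure = p :=
  VectorMeasure.equivMeasure.right_inv p

lemma fisherInfo_withDensity (p : Measure Y) [IsFiniteMeasure p] {h : Y → ℝ}
    (hi : Integrable h p) :
    fisherInfo p (p.withDensityᵥ h) = ∫⁻ y, ENNReal.ofReal (h y ^ 2) ∂p := by
  have hac := p.withDensityᵥ_absolutelyContinuous h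
  have hac' : SignedMeasure.totalVariation (p.withDensityᵥ h) ≪ p := by
    have := (SignedMeasure.absolutelyContinuous_ennreal_iff _ _).1 hac
    rwa [ennrealToMeasure_toENNRealVectorMeasure] at this
  rw [fisherInfo, if_pos hac']
  have hae := Integrable.ae_eq_of_withDensityᵥ_eq (SignedMeasure.integrable_rnDeriv _ p) hi
    (SignedMeasure.withDensityᵥ_rnDeriv_eq _ p hac)
  refine lintegral_congr_ae ?_
  filter_upwards [hae] with y hy
  rw [hy]

lemma withDensityᵥ_rnDeriv_of_totalVariation_ac {p : Measure Y} [IsFiniteMeasure p]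
    {δ : SignedMeasure Y} (h : δ.totalVariation ≪ p) : p.withDensityᵥ (δ.rnDeriv p) = δ := by
  refine SignedMeasure.withDensityᵥ_rnDeriv_eq _ p
    ((SignedMeasure.absolutelyContinuous_ennreal_iff _ _).2 ?_)
  rwa [ennrealToMeasure_toENNRealVectorMeasure]

lemma totalVariation_ac_of_abs_le {p : Measure Y} [IsFiniteMeasure p] {δ : SignedMeasure Y}
    {C : ℝ} (h : ∀ B, MeasurableSet B → |δ B| ≤ C * p.real B) : δ.totalVariation ≪ p := by
  have : δ ≪ᵥ p.toENNRealVectorMeasure := by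
    refine VectorMeasure.AbsolutelyContinuous.mk fun B hB h0 => ?_
    rw [Measure.toENNRealVectorMeasure_apply_measurable hB] at h0
    have := h B hB
    rw [measureReal_def, h0, ENNReal.toReal_zero, mul_zero] at this
    exact abs_nonpos_iff.1 this
  have := (SignedMeasure.absolutelyContinuous_ennreal_iff _ _).1 this
  rwa [ennrealToMeasure_toENNRealVectorMeasure] at this

/-- Domination by `C p` on all sets forces the density to lie in `[-C, C]` almost everywhere. -/
lemma fisherInfo_le_of_abs_le {p : Measure Y} [IsProbabilityMeasure p] {δ : SignedMeasure Y}
    {C : ℝ} (h : ∀ B, MeasurableSet B → |δ B| ≤ C * p.real B) :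
    fisherInfo p δ ≤ ENNReal.ofReal (C ^ 2) := by
  have hac := totalVariation_ac_of_abs_le h
  have hw := withDensityᵥ_rnDeriv_of_totalVariation_ac hac
  have hi := SignedMeasure.integrable_rnDeriv δ p
  rw [fisherInfo, if_pos hac]
  have hset : ∀ B, MeasurableSet B → ∫ y in B, δ.rnDeriv p y ∂p = δ B := fun B hB => by
    rw [← withDensityᵥ_apply hi hB, hw]
  have h1 : δ.rnDeriv p ≤ᵐ[p] fun _ => C := by
    refine ae_le_of_forall_setIntegral_le hi (integrable_const _) fun B hB _ => ?_
    rw [hset B hB, setIntegral_const, smul_eq_mul, mul_comm]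
    exact (le_abs_self _).trans (h B hB)
  have h2 : (fun _ => -C) ≤ᵐ[p] δ.rnDeriv p := by
    refine ae_le_of_forall_setIntegral_le (integrable_const _) hi fun B hB _ => ?_
    rw [hset B hB, setIntegral_const, smul_eq_mul, mul_neg, mul_comm, neg_le]
    exact (neg_le_abs _).trans (h B hB)
  calc _ ≤ ∫⁻ _, ENNReal.ofReal (C ^ 2) ∂p := by
        refine lintegral_mono_ae ?_
        filter_upwards [h1, h2] with y hy1 hy2
        exact ENNReal.ofReal_le_ofReal (sq_le_sq' hy2 hy1)
    _ = _ := by simp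

instance (Φ : Kernel X Y) [IsMarkovKernel Φ] (p : ProbabilityMeasure X) :
    IsProbabilityMeasure (Φ ∘ₘ (p : Measure X)) := by infer_instance

lemma gMin_le_of_abs_le {Φ : Kernel X Y} [IsMarkovKernel Φ] {Δ : SignedChannel X Y} {C : ℝ}
    (h : ∀ x B, MeasurableSet B → |Δ.signed x B| ≤ C * (Φ x).real B) :
    gMin Φ Δ ≤ ENNReal.ofReal (C ^ 2) := by
  refine iSup_le fun p => fisherInfo_le_of_abs_le fun B hB => ?_
  rw [Δ.apply_apply _ hB, measureReal_bind _ _ hB, ← integral_const_mul]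
  exact abs_integral_le_integral_abs.trans (integral_mono (Δ.integrable_signed _ hB).abs
    ((integrable_kernel_real _ _ hB).const_mul _) fun x => h x B hB)

lemma isTangent_of_abs_le {Φ : Kernel X Y} [IsMarkovKernel Φ] {Δ : SignedChannel X Y} {C : ℝ}
    (h : ∀ x B, MeasurableSet B → |Δ.signed x B| ≤ C * (Φ x).real B) : IsTangent Φ Δ :=
  (gMin_le_of_abs_le h).trans_lt ENNReal.ofReal_lt_top

/-- The distributions `Ψ(p)` form a subfamily of those in the supremum for `Φ`. -/
lemma gMin_precomp_le {X' : Type} [MeasurableSpace X'] (Φ : Kernel X Y) (Δ : SignedChannel X Y)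
    (Ψ : Kernel X' X) [IsMarkovKernel Ψ] : gMin (Φ ∘ₖ Ψ) (Δ.precomp Ψ) ≤ gMin Φ Δ := by
  refine iSup_le fun p => ?_
  have hq : IsProbabilityMeasure (Ψ ∘ₘ (p : Measure X')) := inferInstance
  refine le_trans (le_of_eq ?_) (le_iSup _ (⟨Ψ ∘ₘ (p : Measure X'), hq⟩ : ProbabilityMeasure X))
  simp only [SignedChannel.apply, SignedChannel.precomp, ProbabilityMeasure.coe_mk,
    Measure.comp_assoc]

lemma IsTangent.precomp {X' : Type} [MeasurableSpace X'] {Φ : Kernel X Y} {Δ : SignedChannel X Y}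
    (h : IsTangent Φ Δ) (Ψ : Kernel X' X) [IsMarkovKernel Ψ] :
    IsTangent (Φ ∘ₖ Ψ) (Δ.precomp Ψ) :=
  (gMin_precomp_le Φ Δ Ψ).trans_lt h

/-- Since `h` depends on the output only, `Δ(p)` has density `h` with respect to `Φ(p)` for every
`p`, and the Fisher information is an average of the pointwise ones. -/
lemma isTangent_of_density {Φ : Kernel X Y} [IsMarkovKernel Φ] {Δ : SignedChannel X Y}
    {h : Y → ℝ} (hm : Measurable h)
    (hpos : ∀ x, Δ.pos x = (Φ x).withDensity fun y => ENNReal.ofReal (h y))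
    (hneg : ∀ x, Δ.neg x = (Φ x).withDensity fun y => ENNReal.ofReal (-h y)) {C : ℝ≥0}
    (hC : ∀ x, ∫⁻ y, ENNReal.ofReal (h y ^ 2) ∂(Φ x) ≤ C) : IsTangent Φ Δ := by
  refine lt_of_le_of_lt (iSup_le fun p => ?_) (ENNReal.coe_lt_top (r := C))
  set P := Φ ∘ₘ (p : Measure X) with hP
  have hL2 : ∫⁻ y, ENNReal.ofReal (h y ^ 2) ∂P ≤ C := by
    rw [hP, Measure.lintegral_bind Φ.aemeasurable (by fun_prop)]
    calc _ ≤ ∫⁻ _, (C : ℝ≥0∞) ∂(p : Measure X) := lintegral_mono hC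
      _ = C := by simp
  have hi : Integrable h P := by
    have : MemLp h 2 P := by
      rw [memLp_two_iff_integrable_sq hm.aestronglyMeasurable]
      refine ⟨by fun_prop, ?_⟩
      rw [hasFiniteIntegral_iff_ofReal (ae_of_all _ fun y => sq_nonneg _)]
      exact hL2.trans_lt ENNReal.coe_lt_top
    exact this.integrable (by norm_num)
  have key : ∀ {κ : Kernel X Y} {g : Y → ℝ≥0∞} (_ : Measurable g)
      (_ : ∀ x, κ x = (Φ x).withDensity g), κ ∘ₘ (p : Measure X) = P.withDensity g := by
    intro κ g hg hκ
    ext B hB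
    rw [Measure.bind_apply hB κ.aemeasurable, withDensity_apply _ hB, hP,
      ← lintegral_indicator hB, Measure.lintegral_bind Φ.aemeasurable
      (hg.indicator hB).aemeasurable]
    refine lintegral_congr fun x => ?_
    rw [hκ, withDensity_apply _ hB, lintegral_indicator hB]
  have e : Δ.apply p = P.withDensityᵥ h := by
    rw [withDensityᵥ_eq_withDensity_pos_part_sub_withDensity_neg_part hi, SignedChannel.apply]
    congr 1
    · congr 1; exact key (by fun_prop) hpos
    · congr 1; exact key (by fun_prop) hneg
  rw [e, fisherInfo_withDensity P hi]
  exact hL2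

end SignedChannels

/-! ### Scores and Fisher information for finite outputs -/

section FiniteOutput

open Finset

variable {X Y : Type} [MeasurableSpace X] [MeasurableSpace Y]

lemma apply_singleton_eq_zero_of_fisherInfo_lt_top {p : Measure Y} [IsFiniteMeasure p]
    {δ : SignedMeasure Y} (h : fisherInfo p δ < ⊤) (y : Y) (hy : p.real {y} = 0) : δ {y} = 0 := by
  have hac : δ.totalVariation ≪ p := by
    by_contra hn
    rw [fisherInfo, if_neg hn] at h
    exact lt_irrefl _ h
  refine SignedMeasure.null_of_totalVariation_zero _ (hac ?_)
  rwa [measureReal_eq_zero_iff] at hy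

lemma sq_integral_le_integral_sq {μ : Measure X} [IsProbabilityMeasure μ] {f : X → ℝ}
    (hf : Integrable f μ) (hf2 : Integrable (fun x => f x ^ 2) μ) :
    (∫ x, f x ∂μ) ^ 2 ≤ ∫ x, f x ^ 2 ∂μ := by
  set m := ∫ x, f x ∂μ
  have h : 0 ≤ ∫ x, (f x - m) ^ 2 ∂μ := integral_nonneg fun x => sq_nonneg _
  have e : ∀ x, (f x - m) ^ 2 = f x ^ 2 - 2 * m * f x + m ^ 2 := fun x => by ring
  simp only [e] at h
  have i1 : Integrable (fun x => f x ^ 2 - 2 * m * f x) μ := hf2.sub (hf.const_mul _)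
  rw [integral_add i1 (integrable_const _), integral_sub hf2 (hf.const_mul _), integral_const_mul,
    integral_const] at h
  simp only [probReal_univ, smul_eq_mul, one_mul] at h
  change 0 ≤ _ - 2 * m * m + _ at h
  linarith

/-- The logarithmic derivative `dΔ(·|x) / dΦ(·|x)` of a channel with finite output. -/
def score (Φ : Kernel X Y) (Δ : SignedChannel X Y) (x : X) (y : Y) : ℝ :=
  Δ.signed x {y} / (Φ x).real {y}

lemma measurable_score [MeasurableSingletonClass Y] (Φ : Kernel X Y) (Δ : SignedChannel X Y)
    (y : Y) : Measurable fun x => score Φ Δ x y :=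
  (Δ.measurable_signed (measurableSet_singleton y)).div
    (measurable_kernel_real Φ (measurableSet_singleton y))

/-- Point masses are admissible inputs. -/
lemma fisherInfo_le_gMin (Φ : Kernel X Y) (Δ : SignedChannel X Y) (x : X) :
    fisherInfo (Φ x) (Δ.signed x) ≤ gMin Φ Δ := by
  refine le_trans (le_of_eq ?_)
    (le_iSup _ (⟨Measure.dirac x, inferInstance⟩ : ProbabilityMeasure X))
  simp [SignedChannel.apply, SignedChannel.signed, Measure.dirac_bind (Kernel.measurable _)]

/-- The division by zero in `score` is harmless: finite Fisher information makes `Δ(y|x)` vanish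
wherever `Φ(y|x)` does. -/
lemma IsTangent.signed_eq {Φ : Kernel X Y} [IsMarkovKernel Φ] {Δ : SignedChannel X Y}
    (h : IsTangent Φ Δ) (x : X) (y : Y) :
    Δ.signed x {y} = (Φ x).real {y} * score Φ Δ x y := by
  rw [score]
  by_cases hy : (Φ x).real {y} = 0
  · rw [hy, apply_singleton_eq_zero_of_fisherInfo_lt_top
      ((fisherInfo_le_gMin Φ Δ x).trans_lt h) y hy, zero_mul]
  · field_simp

lemma piKernel_real_singleton {n : ℕ} (κ : Fin n → Kernel X Y) [∀ i, IsFiniteKernel (κ i)]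
    (x : Fin n → X) (y : Fin n → Y) :
    (piKernel κ x).real {y} = ∏ i, (κ i (x i)).real {y i} := by
  simp only [measureReal_def]
  rw [← ENNReal.toReal_prod]
  congr 1
  exact Measure.pi_singleton _ y

lemma channelPow_real_singleton (Φ : Kernel X Y) [IsMarkovKernel Φ] (n : ℕ) (x : Fin n → X)
    (y : Fin n → Y) : (channelPow Φ n x).real {y} = ∏ i, (Φ (x i)).real {y i} :=
  piKernel_real_singleton _ x y

/-- The Leibniz rule for the logarithmic derivative: scores of independent uses add up. -/
lemma IsTangent.pow_signed_singleton [MeasurableSingletonClass Y] {Φ : Kernel X Y}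
    [IsMarkovKernel Φ] {Δ : SignedChannel X Y} (h : IsTangent Φ Δ) (n : ℕ) (x : Fin n → X)
    (y : Fin n → Y) :
    (Δ.pow Φ n).signed x {y} = (∏ i, (Φ (x i)).real {y i}) * ∑ i, score Φ Δ (x i) (y i) := by
  have hr : ∀ κ : Kernel X Y, ∀ _ : IsFiniteKernel κ,
      ((∑ i : Fin n, piKernel (slot Φ κ i)) x).real {y}
      = ∑ i : Fin n, (κ (x i)).real {y i} * ∏ j ∈ univ.erase i, (Φ (x j)).real {y j} :=
      fun κ hκ => by
    rw [measureReal_def, Kernel.finsetSum_apply', ENNReal.toReal_sum fun i _ => measure_ne_top _ _]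
    refine sum_congr rfl fun i _ => ?_
    rw [← measureReal_def, piKernel_real_singleton, ← mul_prod_erase univ _ (mem_univ i)]
    congr 1
    · simp [slot]
    · refine prod_congr rfl fun j hj => ?_
      simp [slot, ne_of_mem_erase hj]
  rw [SignedChannel.signed_apply _ _ (measurableSet_singleton y)]
  simp only [SignedChannel.pow]
  rw [hr _ inferInstance, hr _ inferInstance, ← sum_sub_distrib, mul_sum]
  refine sum_congr rfl fun i _ => ?_
  rw [← sub_mul, ← SignedChannel.signed_apply _ _ (measurableSet_singleton _), h.signed_eq,
    ← mul_prod_erase univ (fun j => (Φ (x j)).real {y j}) (mem_univ i)]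
  ring

variable [Fintype Y]

/-- The kernel into a finite space with prescribed weights. -/
def weightKernel (g : X → Y → ℝ) (hg : ∀ y, Measurable fun x => g x y) : Kernel X Y where
  toFun x := ∑ y, ENNReal.ofReal (g x y) • Measure.dirac y
  measurable' := by
    refine Measure.measurable_of_measurable_coe _ fun B hB => ?_
    simp only [Measure.finsetSum_apply, Measure.smul_apply, smul_eq_mul]
    exact Finset.measurable_sum _ fun y _ => (hg y).ennreal_ofReal.mul_const _

lemma isMarkovKernel_weightKernel {g : X → Y → ℝ} (hg : ∀ y, Measurable fun x => g x y)
    (h0 : ∀ x y, 0 ≤ g x y) (h1 : ∀ x, ∑ y, g x y = 1) : IsMarkovKernel (weightKernel g hg) := by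
  refine ⟨fun x => ⟨?_⟩⟩
  simp only [weightKernel, Kernel.coe_mk, Measure.finsetSum_apply, Measure.smul_apply, smul_eq_mul,
    measure_univ, mul_one]
  rw [← ENNReal.ofReal_sum_of_nonneg fun y _ => h0 x y, h1, ENNReal.ofReal_one]

variable [MeasurableSingletonClass Y]

lemma measureReal_eq_sum_ite (μ : Measure Y) [IsFiniteMeasure μ] (B : Set Y)
    [DecidablePred (· ∈ B)] : μ.real B = ∑ y, if y ∈ B then μ.real {y} else 0 := by
  rw [← sum_filter, sum_measureReal_singleton]
  congr; ext; simp

lemma sum_measureReal_singleton_univ (μ : Measure Y) [IsProbabilityMeasure μ] :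
    ∑ y, μ.real {y} = 1 := by
  rw [sum_measureReal_singleton]; simp

lemma signedMeasure_eq_sum_ite (δ : SignedMeasure Y) (B : Set Y) [DecidablePred (· ∈ B)] :
    δ B = ∑ y, if y ∈ B then δ {y} else 0 := by
  rw [← sum_filter, ← VectorMeasure.of_biUnion_finset]
  · congr; ext; simp
  · intro a _ b _ hab
    simpa [Function.onFun] using hab
  · exact fun b _ => measurableSet_singleton b

lemma signedMeasure_ext_singleton {δ δ' : SignedMeasure Y} (h : ∀ y, δ {y} = δ' {y}) : δ = δ' := by
  classical
  ext B _
  rw [signedMeasure_eq_sum_ite, signedMeasure_eq_sum_ite δ']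
  simp only [h]

lemma fisherInfo_eq_sum {p : Measure Y} [IsProbabilityMeasure p] {δ : SignedMeasure Y}
    (h : ∀ y, p.real {y} = 0 → δ {y} = 0) :
    fisherInfo p δ = ENNReal.ofReal (∑ y, δ {y} ^ 2 / p.real {y}) := by
  have hi : Integrable (fun y => δ {y} / p.real {y}) p := .of_finite
  have e : δ = p.withDensityᵥ fun y => δ {y} / p.real {y} := by
    refine signedMeasure_ext_singleton fun y => ?_
    rw [withDensityᵥ_apply hi (measurableSet_singleton y), Measure.restrict_singleton,
      integral_smul_measure, integral_dirac, ← measureReal_def, smul_eq_mul]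
    by_cases hy : p.real {y} = 0
    · rw [hy, h y hy]; simp
    · field_simp
  conv_lhs => rw [e]
  rw [fisherInfo_withDensity p hi, lintegral_fintype, ENNReal.ofReal_sum_of_nonneg]
  · refine sum_congr rfl fun y _ => ?_
    rw [← ofReal_measureReal, ← ENNReal.ofReal_mul (sq_nonneg _)]
    congr 1
    by_cases hy : p.real {y} = 0
    · rw [hy]; simp
    · field_simp
  · exact fun y _ => div_nonneg (sq_nonneg _) measureReal_nonneg

/-- By Jensen's inequality the pointwise bound passes to all mixtures `Φ(p)`, `Δ(p)`, after which
each output symbol contributes at most `|C|`. -/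
lemma isTangent_of_sq_le {Φ : Kernel X Y} [IsMarkovKernel Φ] {Δ : SignedChannel X Y} {C : ℝ}
    (hC : ∀ x y, Δ.signed x {y} ^ 2 ≤ C * (Φ x).real {y}) : IsTangent Φ Δ := by
  refine lt_of_le_of_lt (iSup_le fun p => ?_)
    (ENNReal.ofReal_lt_top (r := ∑ _ : Y, |C|))
  have key : ∀ y, Δ.apply p {y} ^ 2 ≤ C * (Φ ∘ₘ (p : Measure X)).real {y} := fun y => by
    have hy := measurableSet_singleton y
    have hi := (integrable_kernel_real Φ (p : Measure X) hy).const_mul C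
    have hi2 : Integrable (fun x => Δ.signed x {y} ^ 2) (p : Measure X) := by
      refine hi.mono' ((Δ.measurable_signed hy).pow_const 2).aestronglyMeasurable
        (ae_of_all _ fun x => ?_)
      rw [Real.norm_eq_abs, abs_of_nonneg (sq_nonneg _)]
      exact hC x y
    rw [Δ.apply_apply p hy, measureReal_bind _ _ hy, ← integral_const_mul]
    exact (sq_integral_le_integral_sq (Δ.integrable_signed _ hy) hi2).trans
      (integral_mono hi2 hi fun x => hC x y)
  rw [fisherInfo_eq_sum fun y hy => ?_]
  · refine ENNReal.ofReal_le_ofReal (sum_le_sum fun y _ => ?_)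
    rcases eq_or_lt_of_le (measureReal_nonneg (μ := Φ ∘ₘ (p : Measure X)) (s := {y})) with h | h
    · rw [← h, div_zero]; exact abs_nonneg _
    · rw [div_le_iff₀ h]
      exact (key y).trans (mul_le_mul_of_nonneg_right (le_abs_self _) h.le)
  · have := key y
    rw [hy, mul_zero] at this
    exact pow_eq_zero_iff two_ne_zero |>.1 (le_antisymm this (sq_nonneg _))

namespace IsTangent

variable {Φ : Kernel X Y} [IsMarkovKernel Φ] {Δ : SignedChannel X Y}

lemma sum_score (h : IsTangent Φ Δ) (x : X) : ∑ y, (Φ x).real {y} * score Φ Δ x y = 0 := by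
  simp only [← h.signed_eq]
  classical
  have := signedMeasure_eq_sum_ite (Δ.signed x) Set.univ
  simpa [Δ.signed_univ] using this.symm

lemma sum_score_sq_le (h : IsTangent Φ Δ) (x : X) :
    ∑ y, (Φ x).real {y} * score Φ Δ x y ^ 2 ≤ (gMin Φ Δ).toReal := by
  have hle := fisherInfo_le_gMin Φ Δ x
  have hlt := hle.trans_lt h
  rw [fisherInfo_eq_sum (apply_singleton_eq_zero_of_fisherInfo_lt_top hlt),
    ENNReal.ofReal_le_iff_le_toReal h.ne] at hle
  refine le_trans (le_of_eq (sum_congr rfl fun y _ => ?_)) hle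
  rw [score]
  by_cases hy : (Φ x).real {y} = 0
  · rw [hy]; simp
  · field_simp

end IsTangent

lemma SignedChannel.postcomp_signed_eq_sum {Y' : Type} [MeasurableSpace Y']
    (Δ : SignedChannel X Y) (Ψ : Kernel Y Y') [IsMarkovKernel Ψ] (x : X) {B : Set Y'}
    (hB : MeasurableSet B) :
    (Δ.postcomp Ψ).signed x B = ∑ y, Δ.signed x {y} * (Ψ y).real B := by
  rw [Δ.postcomp_signed_apply Ψ x hB, integral_fintype .of_finite, integral_fintype .of_finite,
    ← sum_sub_distrib]
  refine sum_congr rfl fun y _ => ?_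
  rw [Δ.signed_apply _ (measurableSet_singleton y), sub_mul, smul_eq_mul, smul_eq_mul]

lemma measureReal_bind_eq_sum {Y' : Type} [MeasurableSpace Y'] (μ : Measure Y) [IsFiniteMeasure μ]
    (Ψ : Kernel Y Y') [IsMarkovKernel Ψ] {B : Set Y'} (hB : MeasurableSet B) :
    (Ψ ∘ₘ μ).real B = ∑ y, μ.real {y} * (Ψ y).real B := by
  rw [measureReal_bind _ _ hB, integral_fintype .of_finite]
  rfl

lemma weightKernel_singleton {g : X → Y → ℝ} (hg : ∀ y, Measurable fun x => g x y) (x : X)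
    (y : Y) : weightKernel g hg x {y} = ENNReal.ofReal (g x y) := by
  classical
  simp only [weightKernel, Kernel.coe_mk, Measure.finsetSum_apply, Measure.smul_apply, smul_eq_mul,
    Measure.dirac_apply, Set.indicator_apply, Set.mem_singleton_iff]
  simp

lemma weightKernel_real_singleton {g : X → Y → ℝ} (hg : ∀ y, Measurable fun x => g x y) {x : X}
    {y : Y} (h : 0 ≤ g x y) : (weightKernel g hg x).real {y} = g x y := by
  rw [measureReal_def, weightKernel_singleton, ENNReal.toReal_ofReal h]

end FiniteOutput

/-! ### Channels simulated from one Gaussian variable -/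

section GaussianResource

/-- The channel `Unit × Z → ℝ × Z` producing an independent standard Gaussian variable. -/
abbrev gaussianResource (Z : Type) [MeasurableSpace Z] : Kernel (Unit × Z) (ℝ × Z) :=
  Kernel.const Unit (gaussianReal 0 1) ∥ₖ Kernel.id

lemma lintegral_sq_gaussianReal : ∫⁻ r, ENNReal.ofReal (r ^ 2) ∂(gaussianReal 0 1) ≤ (1 : ℝ≥0) := by
  have hi : Integrable (fun r : ℝ => r ^ 2) (gaussianReal 0 1) :=
    (memLp_id_gaussianReal (μ := 0) (v := 1) 2).integrable_sq
  rw [← ofReal_integral_eq_lintegral_ofReal hi (ae_of_all _ fun r => sq_nonneg r),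
    integral_gaussianReal_eq_integral_smul one_ne_zero]
  have := integral_sq_mul_gaussianPDFReal 0 (one_ne_zero : (1 : ℝ≥0) ≠ 0)
  simp only [smul_eq_mul, mul_comm (gaussianPDFReal _ _ _)]
  rw [this]
  simp

lemma isTangent_gaussianShift :
    IsTangent (Kernel.const Unit (gaussianReal 0 1)) gaussianShift :=
  isTangent_of_density measurable_id (fun _ => rfl) (fun _ => rfl)
    fun _ => lintegral_sq_gaussianReal

lemma isTangent_gaussianShift_tensorId (Z : Type) [MeasurableSpace Z] :
    IsTangent (gaussianResource Z) (gaussianShift.tensorId Z) := by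
  refine isTangent_of_density (h := fun y => y.1) measurable_fst (fun x => ?_) (fun x => ?_)
    (C := 1) fun x => ?_
  · simp only [SignedChannel.tensorId, Kernel.parallelComp_apply]
    exact prod_withDensity_left (by fun_prop)
  · simp only [SignedChannel.tensorId, Kernel.parallelComp_apply]
    exact prod_withDensity_left (f := fun x : ℝ => ENNReal.ofReal (-x)) (by fun_prop)
  · rw [Kernel.parallelComp_apply, Kernel.id_apply, Kernel.const_apply, Measure.prod_dirac,
      lintegral_map (by fun_prop) measurable_prodMk_right]
    exact lintegral_sq_gaussianReal

variable {Z Y : Type} [MeasurableSpace Z] [MeasurableSpace Y]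

lemma integral_withDensity_ofReal_sub {μ : Measure Y} {h f : Y → ℝ} (hm : Measurable h)
    (hi : Integrable h μ) (hf : Measurable f) (hb : ∀ y, ‖f y‖ ≤ 1) :
    ∫ y, f y ∂(μ.withDensity fun y => ENNReal.ofReal (h y))
      - ∫ y, f y ∂(μ.withDensity fun y => ENNReal.ofReal (-h y)) = ∫ y, h y * f y ∂μ := by
  have key : ∀ g : Y → ℝ, Measurable g → Integrable g μ →
      Integrable (fun y => (ENNReal.ofReal (g y)).toReal • f y) μ := fun g hg hgi => by
    refine Integrable.mul_bdd (c := 1) ?_ hf.aestronglyMeasurable (ae_of_all _ hb)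
    refine hgi.mono hg.ennreal_ofReal.ennreal_toReal.aestronglyMeasurable (ae_of_all _ fun y => ?_)
    rw [Real.norm_eq_abs, abs_of_nonneg ENNReal.toReal_nonneg, Real.norm_eq_abs,
      ENNReal.toReal_ofReal']
    exact max_le (le_abs_self _) (abs_nonneg _)
  rw [integral_withDensity_eq_integral_toReal_smul (by fun_prop) (ae_of_all _ fun _ => by simp),
    integral_withDensity_eq_integral_toReal_smul (by fun_prop) (ae_of_all _ fun _ => by simp),
    ← integral_sub (key h hm hi) (key (fun y => -h y) hm.neg hi.neg)]
  refine integral_congr_ae (ae_of_all _ fun y => ?_)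
  simp only [smul_eq_mul, ← sub_mul, ENNReal.toReal_ofReal']
  congr 1
  rcases le_total 0 (h y) with h | h
  · rw [max_eq_left h, max_eq_right (by linarith), sub_zero]
  · rw [max_eq_right h, max_eq_left (by linarith)]; ring

/-- The channel `z ↦ ((), z)`. -/
abbrev unitInput (Z : Type) [MeasurableSpace Z] : Kernel Z (Unit × Z) :=
  Kernel.deterministic (fun z => ((), z)) (by fun_prop)

/-- The channel simulated from a Gaussian variable by `Ψ`. -/
def simulated (Ψ : Kernel (ℝ × Z) Y) : Kernel Z Y := Ψ ∘ₖ (gaussianResource Z ∘ₖ unitInput Z)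

instance (Ψ : Kernel (ℝ × Z) Y) [IsMarkovKernel Ψ] : IsMarkovKernel (simulated Ψ) := by
  unfold simulated; infer_instance

/-- The tangent simulated from the Gaussian shift by `Ψ`. -/
def simulatedTangent (Ψ : Kernel (ℝ × Z) Y) [IsMarkovKernel Ψ] : SignedChannel Z Y :=
  ((gaussianShift.tensorId Z).precomp (unitInput Z)).postcomp Ψ

lemma simulated_real (Ψ : Kernel (ℝ × Z) Y) [IsMarkovKernel Ψ] (z : Z) {B : Set Y}
    (hB : MeasurableSet B) :
    (simulated Ψ z).real B = ∫ r, gaussianPDFReal 0 1 r * (Ψ (r, z)).real B := by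
  rw [simulated, Kernel.comp_apply, measureReal_bind _ _ hB, Kernel.comp_deterministic_eq_comap,
    Kernel.comap_apply, Kernel.parallelComp_apply, Kernel.id_apply, Kernel.const_apply,
    Measure.prod_dirac, integral_map (by fun_prop)
      (measurable_kernel_real Ψ hB).aestronglyMeasurable,
    integral_gaussianReal_eq_integral_smul one_ne_zero]
  rfl

lemma simulatedTangent_signed (Ψ : Kernel (ℝ × Z) Y) [IsMarkovKernel Ψ] (z : Z) {B : Set Y}
    (hB : MeasurableSet B) :
    (simulatedTangent Ψ).signed z B
      = ∫ r, gaussianPDFReal 0 1 r * (r * (Ψ (r, z)).real B) := by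
  have hm : Measurable fun r => (Ψ (r, z)).real B :=
    (measurable_kernel_real Ψ hB).comp measurable_prodMk_right
  have key : ∀ (κ : Kernel Unit ℝ) (_ : IsFiniteKernel κ),
      ∫ y, (Ψ y).real B ∂(((κ ∥ₖ (Kernel.id : Kernel Z Z)) ∘ₖ unitInput Z) z)
        = ∫ r, (Ψ (r, z)).real B ∂(κ ()) := fun κ _ => by
    rw [Kernel.comp_deterministic_eq_comap, Kernel.comap_apply, Kernel.parallelComp_apply,
      Kernel.id_apply, Measure.prod_dirac, integral_map (by fun_prop)
      (measurable_kernel_real Ψ hB).aestronglyMeasurable]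
  have hid : Integrable (fun r : ℝ => r) (gaussianReal 0 1) :=
    (memLp_id_gaussianReal (μ := 0) (v := 1) 1).integrable le_rfl
  have hb : ∀ r, ‖(Ψ (r, z)).real B‖ ≤ 1 := fun r => by
    rw [Real.norm_eq_abs, abs_of_nonneg measureReal_nonneg]
    exact measureReal_le_one
  rw [simulatedTangent, SignedChannel.postcomp_signed_apply _ _ _ hB]
  simp only [SignedChannel.precomp, SignedChannel.tensorId]
  have hfp := gaussianShift.finite_pos
  have hfn := gaussianShift.finite_neg
  rw [key _ hfp, key _ hfn]
  have e := integral_gaussianReal_eq_integral_smul (μ := 0) (one_ne_zero : (1 : ℝ≥0) ≠ 0)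
    (f := fun r => r * (Ψ (r, z)).real B)
  simp only [smul_eq_mul] at e
  rw [← e]
  exact integral_withDensity_ofReal_sub measurable_id hid hm hb

namespace ChannelMetric

variable {G : ChannelMetric} [StandardBorelSpace Z] [Nonempty Z] [StandardBorelSpace Y] [Nonempty Y]

/-- Simulation is pre- and postprocessing of the Gaussian shift alongside an identity channel, so
its value cannot exceed that of the shift. -/
lemma simulated_le_one (hM1 : G.M1) (hM2 : G.M2) (hE : G.E) (hN0 : G.N0) (Ψ : Kernel (ℝ × Z) Y)
    [IsMarkovKernel Ψ] : G (simulated Ψ) (simulatedTangent Ψ) ≤ 1 := by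
  have ht := isTangent_gaussianShift_tensorId Z
  calc G (simulated Ψ) (simulatedTangent Ψ) ≤ G (gaussianResource Z ∘ₖ unitInput Z)
        ((gaussianShift.tensorId Z).precomp (unitInput Z)) := hM2 _ _ Ψ (ht.precomp _)
    _ ≤ G (gaussianResource Z) (gaussianShift.tensorId Z) := hM1 _ _ _ ht
    _ = G (Kernel.const Unit (gaussianReal 0 1)) gaussianShift :=
        hE _ _ isTangent_gaussianShift
    _ = 1 := hN0

end ChannelMetric

/-- Cauchy–Schwarz for `N(0,1)`: with `q r` the probability of `y` given `r`, the square of `∫ r q`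
is at most `∫ q · ∫ r² q`, and the last factor is at most 1. -/
lemma isTangent_simulated [Fintype Y] [MeasurableSingletonClass Y] (Ψ : Kernel (ℝ × Z) Y)
    [IsMarkovKernel Ψ] : IsTangent (simulated Ψ) (simulatedTangent Ψ) := by
  refine isTangent_of_sq_le (C := 1) fun z y => ?_
  have hy := measurableSet_singleton y
  rw [simulatedTangent_signed Ψ z hy, simulated_real Ψ z hy, one_mul]
  set q : ℝ → ℝ := fun r => (Ψ (r, z)).real {y} with hq
  have hm : Measurable q := (measurable_kernel_real Ψ hy).comp measurable_prodMk_right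
  have hq0 : ∀ r, 0 ≤ q r := fun r => measureReal_nonneg
  have hq1 : ∀ r, q r ≤ 1 := fun r => measureReal_le_one
  have hqn : ∀ᵐ r : ℝ, ‖q r‖ ≤ 1 := ae_of_all _ fun r => by
    rw [Real.norm_eq_abs, abs_of_nonneg (hq0 r)]
    exact hq1 r
  have i0 := integrable_gaussianPDFReal 0 1
  have i2 := integrable_sq_mul_gaussianPDFReal 0 (one_ne_zero : (1 : ℝ≥0) ≠ 0)
  have i1 : Integrable fun r => gaussianPDFReal 0 1 r * r := by
    simpa only [mul_comm] using integrable_mul_gaussianPDFReal 0 (one_ne_zero : (1 : ℝ≥0) ≠ 0)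
  have j0 : Integrable fun r => gaussianPDFReal 0 1 r * q r :=
    i0.mul_bdd (c := 1) hm.aestronglyMeasurable hqn
  have j1 : Integrable fun r => gaussianPDFReal 0 1 r * (r * q r) := by
    simpa only [mul_assoc] using i1.mul_bdd (c := 1) hm.aestronglyMeasurable hqn
  have j2 : Integrable fun r => r ^ 2 * gaussianPDFReal 0 1 r * q r :=
    i2.mul_bdd (c := 1) hm.aestronglyMeasurable hqn
  have hA : ∫ r, r ^ 2 * gaussianPDFReal 0 1 r * q r ≤ 1 := by
    have := integral_mono j2 i2 fun r => mul_le_of_le_one_right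
      (mul_nonneg (sq_nonneg r) (gaussianPDFReal_nonneg 0 1 r)) (hq1 r)
    refine this.trans_eq ?_
    rw [integral_sq_mul_gaussianPDFReal 0 one_ne_zero]
    simp
  have hQ : 0 ≤ ∫ r, gaussianPDFReal 0 1 r * q r :=
    integral_nonneg fun r => mul_nonneg (gaussianPDFReal_nonneg 0 1 r) (hq0 r)
  -- Cauchy–Schwarz as the discriminant of the nonnegative quadratic `t ↦ ∫ φ q (r - t)²`, with `φ`
  -- the standard Gaussian density.
  have hdisc := discrim_le_zero (a := ∫ r, gaussianPDFReal 0 1 r * q r)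
    (b := -2 * ∫ r, gaussianPDFReal 0 1 r * (r * q r))
    (c := ∫ r, r ^ 2 * gaussianPDFReal 0 1 r * q r) fun t => by
      have h : 0 ≤ ∫ r, gaussianPDFReal 0 1 r * q r * (r - t) ^ 2 := integral_nonneg fun r =>
        mul_nonneg (mul_nonneg (gaussianPDFReal_nonneg 0 1 r) (hq0 r)) (sq_nonneg _)
      have e : ∀ r, gaussianPDFReal 0 1 r * q r * (r - t) ^ 2
          = (t * t) * (gaussianPDFReal 0 1 r * q r)
            + (-2 * t) * (gaussianPDFReal 0 1 r * (r * q r))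
            + r ^ 2 * gaussianPDFReal 0 1 r * q r := fun r => by ring
      simp only [e] at h
      have k1 : Integrable fun r => (t * t) * (gaussianPDFReal 0 1 r * q r) := j0.const_mul _
      have k2 : Integrable fun r => (-2 * t) * (gaussianPDFReal 0 1 r * (r * q r)) :=
        j1.const_mul _
      have k3 : Integrable fun r => (t * t) * (gaussianPDFReal 0 1 r * q r)
          + (-2 * t) * (gaussianPDFReal 0 1 r * (r * q r)) := k1.add k2
      rw [integral_add k3 j2, integral_add k1 k2, integral_const_mul,
        integral_const_mul] at h
      linarith
  rw [discrim] at hdisc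
  nlinarith

end GaussianResource

/-! ### Multiples of tangents -/

section Scaling

variable {X Y : Type} [MeasurableSpace X] [MeasurableSpace Y]

/-- The kernel `a • κ`. -/
def scaleKernel (a : ℝ≥0) (κ : Kernel X Y) : Kernel X Y where
  toFun x := a • κ x
  measurable' := by
    refine Measure.measurable_of_measurable_coe _ fun B hB => ?_
    simp only [Measure.smul_apply]
    exact (Kernel.measurable_coe κ hB).const_smul a

instance (a : ℝ≥0) (κ : Kernel X Y) [IsFiniteKernel κ] : IsFiniteKernel (scaleKernel a κ) := by
  refine ⟨⟨a * κ.bound, ENNReal.mul_lt_top ENNReal.coe_lt_top (Kernel.bound_lt_top κ), fun x => ?_⟩⟩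
  simp only [scaleKernel, Kernel.coe_mk, Measure.smul_apply, ENNReal.smul_def, smul_eq_mul]
  gcongr
  exact Kernel.measure_le_bound κ x _

namespace SignedChannel

/-- The signed kernel `a • Δ`. -/
def scale (a : ℝ≥0) (Δ : SignedChannel X Y) : SignedChannel X Y where
  pos := scaleKernel a Δ.pos
  neg := scaleKernel a Δ.neg
  finite_pos := inferInstance
  finite_neg := inferInstance
  mass_eq x := by simp [scaleKernel, Δ.mass_eq x]

lemma scale_signed_apply (a : ℝ≥0) (Δ : SignedChannel X Y) (x : X) {B : Set Y}
    (hB : MeasurableSet B) : (Δ.scale a).signed x B = a * Δ.signed x B := by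
  rw [signed_apply _ _ hB, signed_apply _ _ hB]
  simp only [scale, scaleKernel, Kernel.coe_mk, measureReal_def, Measure.smul_apply,
    ENNReal.smul_def, smul_eq_mul, ENNReal.toReal_mul, ENNReal.coe_toReal]
  ring

lemma scale_signed (a : ℝ≥0) (Δ : SignedChannel X Y) (x : X) :
    (Δ.scale a).signed x = (a : ℝ) • Δ.signed x := by
  ext B hB
  rw [scale_signed_apply a Δ x hB]
  rfl

lemma ofChannels_signed_apply (Φ Φ' : Kernel X Y) [IsMarkovKernel Φ] [IsMarkovKernel Φ'] (x : X)
    {B : Set Y} (hB : MeasurableSet B) :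
    (ofChannels Φ Φ').signed x B = (Φ x).real B - (Φ' x).real B :=
  signed_apply _ _ hB

lemma sub_signed_apply (Δ Δ' : SignedChannel X Y) (x : X) {B : Set Y} (hB : MeasurableSet B) :
    (Δ.sub Δ').signed x B = Δ.signed x B - Δ'.signed x B := by
  rw [signed_apply _ _ hB, signed_apply _ _ hB, signed_apply _ _ hB]
  simp only [sub, add_apply]
  rw [measureReal_add_apply (by finiteness) (by finiteness),
    measureReal_add_apply (by finiteness) (by finiteness)]
  ring

end SignedChannel

lemma IsTangent.sq_signed_le [Fintype Y] [MeasurableSingletonClass Y] {Φ : Kernel X Y}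
    [IsMarkovKernel Φ] {Δ : SignedChannel X Y} (h : IsTangent Φ Δ) (x : X) (y : Y) :
    Δ.signed x {y} ^ 2 ≤ (gMin Φ Δ).toReal * (Φ x).real {y} := by
  have h1 : (Φ x).real {y} * score Φ Δ x y ^ 2 ≤ (gMin Φ Δ).toReal :=
    (Finset.single_le_sum (f := fun y => (Φ x).real {y} * score Φ Δ x y ^ 2)
      (fun y _ => mul_nonneg measureReal_nonneg (sq_nonneg _)) (Finset.mem_univ y)).trans
      (h.sum_score_sq_le x)
  rw [h.signed_eq]
  calc _ = (Φ x).real {y} * score Φ Δ x y ^ 2 * (Φ x).real {y} := by ring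
    _ ≤ _ := mul_le_mul_of_nonneg_right h1 measureReal_nonneg

lemma IsTangent.scale [Fintype Y] [MeasurableSingletonClass Y] {Φ : Kernel X Y} [IsMarkovKernel Φ]
    {Δ : SignedChannel X Y} (h : IsTangent Φ Δ) (a : ℝ≥0) : IsTangent Φ (Δ.scale a) := by
  refine isTangent_of_sq_le (C := a ^ 2 * (gMin Φ Δ).toReal) fun x y => ?_
  rw [Δ.scale_signed_apply a x (measurableSet_singleton y), mul_pow, mul_assoc]
  exact mul_le_mul_of_nonneg_left (h.sq_signed_le x y) (by positivity)

lemma score_scale [MeasurableSingletonClass Y] (Φ : Kernel X Y) (Δ : SignedChannel X Y) (a : ℝ≥0)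
    (x : X) (y : Y) : score Φ (Δ.scale a) x y = a * score Φ Δ x y := by
  rw [score, score, Δ.scale_signed_apply a x (measurableSet_singleton y), mul_div_assoc]

end Scaling

/-! ### The posterior kernel and its exact identities -/

section UpperBound

open Finset

variable {X Y : Type} [MeasurableSpace X] [MeasurableSpace Y]

/-- The weights `Φ^{⊗n}(y|x)`. -/
def powWeight (Φ : Kernel X Y) {n : ℕ} (x : Fin n → X) (y : Fin n → Y) : ℝ :=
  ∏ i, (Φ (x i)).real {y i}

/-- The normalized score of `Φ^{⊗n}` in the direction `Δ^{(n)}`. -/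
def powScore (Φ : Kernel X Y) (Δ : SignedChannel X Y) {n : ℕ} (x : Fin n → X) (y : Fin n → Y) : ℝ :=
  ∑ i, score Φ Δ (x i) (y i) / √n

lemma powWeight_nonneg (Φ : Kernel X Y) {n : ℕ} (x : Fin n → X) (y : Fin n → Y) :
    0 ≤ powWeight Φ x y :=
  prod_nonneg fun _ _ => measureReal_nonneg

lemma measurable_powWeight [MeasurableSingletonClass Y] (Φ : Kernel X Y) {n : ℕ} (y : Fin n → Y) :
    Measurable fun x => powWeight Φ x y :=
  Finset.measurable_prod _ fun i _ =>
    (measurable_kernel_real Φ (measurableSet_singleton _)).comp (measurable_pi_apply i)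

lemma measurable_powScore [MeasurableSingletonClass Y] (Φ : Kernel X Y)
    (Δ : SignedChannel X Y) {n : ℕ} (y : Fin n → Y) :
    Measurable fun x => powScore Φ Δ x y :=
  Finset.measurable_sum _ fun i _ =>
    ((measurable_score Φ Δ (y i)).comp (measurable_pi_apply i)).div_const _

lemma IsTangent.pow_signed_eq_powScore [MeasurableSingletonClass Y] {Φ : Kernel X Y}
    [IsMarkovKernel Φ] {Δ : SignedChannel X Y}
    (hΔ : IsTangent Φ Δ) {n : ℕ} (x : Fin n → X) (y : Fin n → Y) :
    (Δ.pow Φ n).signed x {y} = √n * (powWeight Φ x y * powScore Φ Δ x y) := by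
  rw [hΔ.pow_signed_singleton, powWeight, powScore, ← sum_div]
  rcases Nat.eq_zero_or_pos n with rfl | hn
  · simp
  · have : (0 : ℝ) < √n := Real.sqrt_pos.2 (by exact_mod_cast hn)
    field_simp

variable [Fintype Y]

/-- The variance of the normalized score. -/
def powVar (Φ : Kernel X Y) (Δ : SignedChannel X Y) {n : ℕ} (x : Fin n → X) : ℝ≥0 :=
  (∑ i, ∑ b, (Φ (x i)).real {b} * (score Φ Δ (x i) b / √n) ^ 2).toNNReal

lemma coe_powVar (Φ : Kernel X Y) (Δ : SignedChannel X Y) {n : ℕ} (x : Fin n → X) :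
    (powVar Φ Δ x : ℝ) = ∑ i, ∑ b, (Φ (x i)).real {b} * (score Φ Δ (x i) b / √n) ^ 2 :=
  Real.coe_toNNReal _ (sum_nonneg fun _ _ => sum_nonneg fun _ _ =>
    mul_nonneg measureReal_nonneg (sq_nonneg _))

/-- The variance of the normalized score is the average over positions of the one-letter variances.
-/
lemma powVar_le {Φ : Kernel X Y} {Δ : SignedChannel X Y} {γ : ℝ} (hγ : 0 ≤ γ)
    (h : ∀ x, ∑ b, (Φ x).real {b} * score Φ Δ x b ^ 2 ≤ γ) {n : ℕ} (x : Fin n → X) :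
    (powVar Φ Δ x : ℝ) ≤ γ := by
  rw [coe_powVar]
  rcases Nat.eq_zero_or_pos n with rfl | hn
  · simpa using hγ
  have hn' : (0 : ℝ) < n := by exact_mod_cast hn
  calc _ = ∑ i : Fin n, (∑ b, (Φ (x i)).real {b} * score Φ Δ (x i) b ^ 2) / n := by
        refine sum_congr rfl fun i _ => ?_
        rw [sum_div]
        refine sum_congr rfl fun b _ => ?_
        rw [div_pow, Real.sq_sqrt hn'.le, mul_div_assoc]
    _ ≤ ∑ _i : Fin n, γ / n := sum_le_sum fun i _ => by gcongr; exact h _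
    _ = γ := by
        rw [sum_const, card_univ, Fintype.card_fin, nsmul_eq_mul]
        field_simp

/-- The conditional law of the output sequence given the smoothed score. -/
def bayesWeight (Φ : Kernel X Y) (Δ : SignedChannel X Y) {n : ℕ} (z : ℝ × (Fin n → X))
    (y : Fin n → Y) : ℝ :=
  powWeight Φ z.2 y * gaussianPDFReal (powScore Φ Δ z.2 y) (1 - powVar Φ Δ z.2) z.1
    / mixDensity (powWeight Φ z.2) (powScore Φ Δ z.2) (1 - powVar Φ Δ z.2) z.1

lemma bayesWeight_nonneg (Φ : Kernel X Y) (Δ : SignedChannel X Y) {n : ℕ} (z : ℝ × (Fin n → X))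
    (y : Fin n → Y) : 0 ≤ bayesWeight Φ Δ z y :=
  div_nonneg (mul_nonneg (powWeight_nonneg _ _ _) (gaussianPDFReal_nonneg _ _ _))
    (mixDensity_nonneg (powWeight_nonneg _ _) _ _ _)

variable [MeasurableSingletonClass Y]

lemma sum_powWeight (Φ : Kernel X Y) [IsMarkovKernel Φ] {n : ℕ} (x : Fin n → X) :
    ∑ y, powWeight Φ x y = 1 := by
  simp only [powWeight]
  rw [sum_prod_mul fun i b => (Φ (x i)).real {b}]
  simp

lemma measurable_powVar (Φ : Kernel X Y) (Δ : SignedChannel X Y) (n : ℕ) :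
    Measurable fun x : Fin n → X => powVar Φ Δ x := by
  refine Measurable.real_toNNReal ?_
  refine Finset.measurable_sum _ fun i _ => Finset.measurable_sum _ fun b _ => ?_
  exact ((measurable_kernel_real Φ (measurableSet_singleton _)).comp (measurable_pi_apply i)).mul
    ((((measurable_score Φ Δ b).comp (measurable_pi_apply i)).div_const _).pow_const 2)

lemma measurable_bayesWeight (Φ : Kernel X Y) (Δ : SignedChannel X Y) {n : ℕ} (y : Fin n → Y) :
    Measurable fun z : ℝ × (Fin n → X) => bayesWeight Φ Δ z y := by
  have h : ∀ y : Fin n → Y, Measurable fun z : ℝ × (Fin n → X) => powWeight Φ z.2 y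
      * gaussianPDFReal (powScore Φ Δ z.2 y) (1 - powVar Φ Δ z.2) z.1 := fun y => by
    refine ((measurable_powWeight Φ y).comp measurable_snd).mul ?_
    exact measurable_uncurry_gaussianPDFReal.comp
      (((measurable_powScore Φ Δ y).comp measurable_snd).prodMk
        ((measurable_const.sub ((measurable_powVar Φ Δ n).comp measurable_snd)).prodMk
          measurable_fst))
  exact (h y).div (Finset.measurable_sum _ fun y _ => h y)

/-- The kernel sampling the output sequence given the smoothed score. -/
def bayesKernel (Φ : Kernel X Y) (Δ : SignedChannel X Y) (n : ℕ) :
    Kernel (ℝ × (Fin n → X)) (Fin n → Y) :=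
  weightKernel (bayesWeight Φ Δ) (measurable_bayesWeight Φ Δ)

/-- The strict bound makes the truncated difference `1 - powVar` a genuine positive noise variance,
so that the normalizing density never vanishes. -/
lemma isMarkovKernel_bayesKernel {Φ : Kernel X Y} [IsMarkovKernel Φ] {Δ : SignedChannel X Y}
    {n : ℕ} (h : ∀ x : Fin n → X, powVar Φ Δ x < 1) : IsMarkovKernel (bayesKernel Φ Δ n) := by
  refine isMarkovKernel_weightKernel _ (bayesWeight_nonneg Φ Δ) fun z => ?_
  simp only [bayesWeight]
  rw [← sum_div]
  exact div_self (mixDensity_pos (powWeight_nonneg _ _) (sum_powWeight Φ _) _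
    (tsub_pos_of_lt (h z.2)).ne' _).ne'

/-- Bayes' formula: posterior times marginal density is the joint density. -/
lemma bayesKernel_real_mul_mixDensity {Φ : Kernel X Y} [IsMarkovKernel Φ] {Δ : SignedChannel X Y}
    {n : ℕ} (h : ∀ x : Fin n → X, powVar Φ Δ x < 1) (x : Fin n → X) (r : ℝ) (B : Set (Fin n → Y))
    [DecidablePred (· ∈ B)] :
    (bayesKernel Φ Δ n (r, x)).real B
        * mixDensity (powWeight Φ x) (powScore Φ Δ x) (1 - powVar Φ Δ x) r
      = ∑ y, if y ∈ B then
          powWeight Φ x y * gaussianPDFReal (powScore Φ Δ x y) (1 - powVar Φ Δ x) r else 0 := by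
  have := isMarkovKernel_bayesKernel h
  rw [measureReal_eq_sum_ite, sum_mul]
  refine sum_congr rfl fun y _ => ?_
  split_ifs
  · rw [bayesKernel, weightKernel_real_singleton _ (bayesWeight_nonneg _ _ _ _), bayesWeight]
    exact div_mul_cancel₀ _ (mixDensity_pos (powWeight_nonneg _ _) (sum_powWeight Φ _) _
      (tsub_pos_of_lt (h x)).ne' _).ne'
  · rw [zero_mul]

/-- Integrating the smoothed variable out of the joint law leaves the law of the output sequence. -/
lemma integral_bayesKernel_mul_mixDensity {Φ : Kernel X Y} [IsMarkovKernel Φ]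
    {Δ : SignedChannel X Y} {n : ℕ} (h : ∀ x : Fin n → X, powVar Φ Δ x < 1) (x : Fin n → X)
    (B : Set (Fin n → Y)) :
    ∫ r, (bayesKernel Φ Δ n (r, x)).real B
        * mixDensity (powWeight Φ x) (powScore Φ Δ x) (1 - powVar Φ Δ x) r
      = (channelPow Φ n x).real B := by
  classical
  have hw : 1 - powVar Φ Δ x ≠ 0 := (tsub_pos_of_lt (h x)).ne'
  simp only [bayesKernel_real_mul_mixDensity h, ← ite_zero_mul]
  rw [integral_finsetSum _ fun y _ => (integrable_gaussianPDFReal _ _).const_mul _,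
    measureReal_eq_sum_ite]
  refine sum_congr rfl fun y _ => ?_
  rw [integral_const_mul, integral_gaussianPDFReal_eq_one _ hw, mul_one, channelPow_real_singleton]
  rfl

/-- The noise is centred, so given `y` the smoothed variable has mean `powScore`; times `√n` this is
the score of `Φ^{⊗n}`. -/
lemma integral_mul_bayesKernel_mul_mixDensity {Φ : Kernel X Y} [IsMarkovKernel Φ]
    {Δ : SignedChannel X Y} (hΔ : IsTangent Φ Δ) {n : ℕ}
    (h : ∀ x : Fin n → X, powVar Φ Δ x < 1) (x : Fin n → X) (B : Set (Fin n → Y)) :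
    √n * ∫ r, r * ((bayesKernel Φ Δ n (r, x)).real B
        * mixDensity (powWeight Φ x) (powScore Φ Δ x) (1 - powVar Φ Δ x) r)
      = (Δ.pow Φ n).signed x B := by
  classical
  have hw : 1 - powVar Φ Δ x ≠ 0 := (tsub_pos_of_lt (h x)).ne'
  simp only [bayesKernel_real_mul_mixDensity h, ← ite_zero_mul, mul_sum,
    mul_left_comm _ (ite _ _ _)]
  rw [integral_finsetSum _ fun y _ => (integrable_mul_gaussianPDFReal _ hw).const_mul _,
    signedMeasure_eq_sum_ite, mul_sum]
  refine sum_congr rfl fun y _ => ?_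
  rw [integral_const_mul, integral_mul_gaussianPDFReal _ hw, hΔ.pow_signed_eq_powScore]
  split_ifs <;> simp

end UpperBound

/-! ### Upper bound for bounded scores -/

section UpperBoundLimit

variable {X Y : Type} [MeasurableSpace X] [MeasurableSpace Y]

lemma abs_score_mul_le {Φ : Kernel X Y} {Δ : SignedChannel X Y} {b : ℝ}
    (hb : ∀ x y, |score Φ Δ x y| ≤ b) {n : ℕ} (x : Fin n → X) (i : Fin n) (y : Y) :
    |score Φ Δ (x i) y / √n| ≤ b / √n := by
  rw [abs_div, abs_of_nonneg (Real.sqrt_nonneg _)]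
  exact div_le_div_of_nonneg_right (hb _ _) (Real.sqrt_nonneg _)

variable [Fintype Y] [MeasurableSingletonClass Y]

lemma integral_mul_sub_le {q f g h : ℝ → ℝ} {δ : ℝ} (hq : Measurable q) (hq0 : ∀ r, 0 ≤ q r)
    (hq1 : ∀ r, q r ≤ 1) (hf : Integrable f) (hg : Integrable g) (hfg : ∀ r, |f r - g r| ≤ h r)
    (hh : Integrable h) (hδ : ∫ r, h r ≤ δ) : (∫ r, q r * f r) - ∫ r, q r * g r ≤ δ := by
  have hqn : ∀ᵐ r : ℝ, ‖q r‖ ≤ 1 := ae_of_all _ fun r => by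
    rw [Real.norm_eq_abs, abs_of_nonneg (hq0 r)]
    exact hq1 r
  rw [← integral_sub (hf.bdd_mul hq.aestronglyMeasurable hqn)
    (hg.bdd_mul hq.aestronglyMeasurable hqn)]
  refine (integral_mono ((hf.bdd_mul hq.aestronglyMeasurable hqn).sub
    (hg.bdd_mul hq.aestronglyMeasurable hqn)) hh fun r => ?_).trans hδ
  simp only [Pi.sub_apply, ← mul_sub]
  calc q r * (f r - g r) ≤ q r * |f r - g r| := mul_le_mul_of_nonneg_left (le_abs_self _) (hq0 r)
    _ ≤ |f r - g r| := mul_le_of_le_one_left (abs_nonneg _) (hq1 r)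
    _ ≤ h r := hfg r

lemma integrable_mul_mixDensity {Ω : Type} [Fintype Ω] (P S : Ω → ℝ) {w : ℝ≥0} (hw : w ≠ 0) :
    Integrable fun r => r * mixDensity P S w r := by
  simp only [mixDensity, Finset.mul_sum, mul_left_comm _ (P _)]
  exact integrable_finsetSum _ fun ω _ => (integrable_mul_gaussianPDFReal _ hw).const_mul _

lemma integrable_weighted_abs_mixDensity_sub {Ω : Type} [Fintype Ω] (P S : Ω → ℝ) {w : ℝ≥0}
    (hw : w ≠ 0) :
    Integrable fun r => (1 + |r|) * |mixDensity P S w r - gaussianPDFReal 0 1 r| := by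
  have h0 := ((integrable_mixDensity P S w).sub (integrable_gaussianPDFReal 0 1)).abs
  have h1 := ((integrable_mul_mixDensity P S hw).sub
    (integrable_mul_gaussianPDFReal 0 (one_ne_zero : (1 : ℝ≥0) ≠ 0))).abs
  refine (h0.add h1).congr (ae_of_all _ fun r => ?_)
  simp only [Pi.add_apply, Pi.sub_apply, ← mul_sub, abs_mul]
  ring

/-- A memoryless channel and its tangent are asymptotically simulated by a Gaussian variable. -/
lemma eventually_simulated_sub_le {Φ : Kernel X Y} [IsMarkovKernel Φ] {Δ : SignedChannel X Y}
    (hΔ : IsTangent Φ Δ) {b γ : ℝ} (hb : ∀ x y, |score Φ Δ x y| ≤ b) (hγ : γ < 1)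
    (hv : ∀ (n : ℕ) (x : Fin n → X), (powVar Φ Δ x : ℝ) ≤ γ)
    [∀ n, IsMarkovKernel (bayesKernel Φ Δ n)] {δ : ℝ} (hδ : 0 < δ) :
    ∀ᶠ n : ℕ in atTop, ∀ x B, MeasurableSet B →
      (simulated (bayesKernel Φ Δ n) x).real B - (channelPow Φ n x).real B ≤ δ ∧
      √n * (simulatedTangent (bayesKernel Φ Δ n)).signed x B - (Δ.pow Φ n).signed x B
        ≤ √n * δ := by
  -- The noise variance is at least `1 - γ` for every input sequence, which makes the estimate
  -- uniform in `x`.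
  filter_upwards [eventually_product_approx b (sub_pos.2 hγ) hδ] with n hn x B hB
  have hlt : ∀ x : Fin n → X, powVar Φ Δ x < 1 := fun x => by
    rw [← NNReal.coe_lt_coe]
    exact (hv n x).trans_lt hγ
  have hw : 1 - powVar Φ Δ x ≠ 0 := (tsub_pos_of_lt (hlt x)).ne'
  obtain ⟨h1, -⟩ := hn (fun i y => (Φ (x i)).real {y}) (fun i y => score Φ Δ (x i) y / √n)
    (powVar Φ Δ x) (1 - powVar Φ Δ x) (fun _ _ => measureReal_nonneg)
    (fun i => sum_measureReal_singleton_univ _)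
    (fun i => by
      simp only [← mul_div_assoc]
      rw [← Finset.sum_div, hΔ.sum_score, zero_div])
    (fun i y => abs_score_mul_le hb x i y) (add_tsub_cancel_of_le (hlt x).le)
    (coe_powVar Φ Δ x).symm
    (by rw [NNReal.coe_sub (hlt x).le, NNReal.coe_one]; linarith [hv n x])
  change ∫ r, (1 + |r|) * |mixDensity (powWeight Φ x) (powScore Φ Δ x) (1 - powVar Φ Δ x) r
    - gaussianPDFReal 0 1 r| ≤ δ at h1
  have hint := integrable_weighted_abs_mixDensity_sub (powWeight Φ x) (powScore Φ Δ x) hw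
  have hqm : Measurable fun r => (bayesKernel Φ Δ n (r, x)).real B :=
    (measurable_kernel_real _ hB).comp measurable_prodMk_right
  constructor
  · rw [simulated_real _ _ hB, ← integral_bayesKernel_mul_mixDensity hlt x B]
    simp only [mul_comm (gaussianPDFReal _ _ _)]
    refine integral_mul_sub_le hqm (fun _ => measureReal_nonneg) (fun _ => measureReal_le_one)
      (integrable_gaussianPDFReal 0 1) (integrable_mixDensity _ _ _) (fun r => ?_) hint h1
    rw [abs_sub_comm]
    exact le_mul_of_one_le_left (abs_nonneg _) (by linarith [abs_nonneg r])
  -- The tangents have the densities of the two laws times `r`; the weight `1 + |r|` absorbs this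
  -- factor.
  · rw [simulatedTangent_signed _ _ hB, ← integral_mul_bayesKernel_mul_mixDensity hΔ hlt x B,
      ← mul_sub]
    refine mul_le_mul_of_nonneg_left ?_ (Real.sqrt_nonneg _)
    have e1 : ∀ r, gaussianPDFReal 0 1 r * (r * (bayesKernel Φ Δ n (r, x)).real B)
        = (bayesKernel Φ Δ n (r, x)).real B * (r * gaussianPDFReal 0 1 r) := fun r => by ring
    simp only [e1, mul_left_comm _ ((bayesKernel Φ Δ n (_, x)).real B)]
    refine integral_mul_sub_le hqm (fun _ => measureReal_nonneg) (fun _ => measureReal_le_one)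
      (integrable_mul_gaussianPDFReal 0 one_ne_zero) (integrable_mul_mixDensity _ _ hw)
      (fun r => ?_) hint h1
    rw [← mul_sub, abs_mul, abs_sub_comm]
    exact mul_le_mul_of_nonneg_right (by linarith) (abs_nonneg _)

lemma tendsto_cbNorm_zero {ι : Type} {l : Filter ι} {X Y : ι → Type}
    [∀ n, MeasurableSpace (X n)] [∀ n, MeasurableSpace (Y n)]
    {Λ : (n : ι) → SignedChannel (X n) (Y n)}
    (h : ∀ δ > 0, ∀ᶠ n in l, ∀ x B, MeasurableSet B → (Λ n).signed x B ≤ δ) :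
    Tendsto (fun n => (Λ n).cbNorm) l (𝓝 0) := by
  rw [ENNReal.tendsto_nhds_zero]
  intro ε hε
  rcases eq_or_ne ε ⊤ with rfl | hε'
  · simp
  have : 0 < ε.toReal := ENNReal.toReal_pos hε.ne' hε'
  filter_upwards [h (ε.toReal / 2) (by positivity)] with n hn
  refine (SignedChannel.cbNorm_le hn).trans ?_
  rw [mul_div_cancel₀ _ two_ne_zero, ENNReal.ofReal_toReal hε']

lemma tendsto_cbNorm_div_sqrt_zero {X Y : ℕ → Type} [∀ n, MeasurableSpace (X n)]
    [∀ n, MeasurableSpace (Y n)] {Λ : (n : ℕ) → SignedChannel (X n) (Y n)}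
    (h : ∀ δ > 0, ∀ᶠ n : ℕ in atTop, ∀ x B, MeasurableSet B → (Λ n).signed x B ≤ √n * δ) :
    Tendsto (fun n : ℕ => (Λ n).cbNorm / ENNReal.ofReal √(n : ℝ)) atTop (𝓝 0) := by
  rw [ENNReal.tendsto_nhds_zero]
  intro ε hε
  rcases eq_or_ne ε ⊤ with rfl | hε'
  · simp
  have : 0 < ε.toReal := ENNReal.toReal_pos hε.ne' hε'
  filter_upwards [h (ε.toReal / 2) (by positivity), eventually_gt_atTop 0] with n hn hn0
  have hs : (0 : ℝ) < √n := Real.sqrt_pos.2 (by exact_mod_cast hn0)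
  refine ENNReal.div_le_of_le_mul ((SignedChannel.cbNorm_le hn).trans ?_)
  have : 2 * (√(n : ℝ) * (ε.toReal / 2)) = ε.toReal * √n := by ring
  rw [this, ENNReal.ofReal_mul ENNReal.toReal_nonneg, ENNReal.ofReal_toReal hε']

/-- If the values of the metric on approximations cost at most `c` per use asymptotically, weak
asymptotic continuity bounds the metric by `c`. -/
lemma le_of_zero_le_liminf {a a' g : ℕ → ℝ} {c G : ℝ} (ha : ∀ n, a n ≤ a' n)
    (ha' : Tendsto (fun n : ℕ => (1 / (n : ℝ)) * a' n) atTop (𝓝 c))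
    (hg : Tendsto (fun n : ℕ => (1 / (n : ℝ)) * g n) atTop (𝓝 G))
    (h : 0 ≤ liminf (fun n : ℕ => (((1 / (n : ℝ)) * (a n - g n) : ℝ) : EReal)) atTop) : G ≤ c := by
  have hlim : Tendsto (fun n : ℕ => (((1 / (n : ℝ)) * a' n - (1 / (n : ℝ)) * g n : ℝ) : EReal))
      atTop (𝓝 ((c - G : ℝ) : EReal)) :=
    (continuous_coe_real_ereal.tendsto _).comp (ha'.sub hg)
  have hle : liminf (fun n : ℕ => (((1 / (n : ℝ)) * (a n - g n) : ℝ) : EReal)) atTop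
      ≤ ((c - G : ℝ) : EReal) := by
    rw [← hlim.liminf_eq]
    refine liminf_le_liminf (Eventually.of_forall fun n => ?_)
    rw [EReal.coe_le_coe_iff, ← mul_sub]
    exact mul_le_mul_of_nonneg_left (by linarith [ha n]) (by positivity)
  have := h.trans hle
  rw [← EReal.coe_zero, EReal.coe_le_coe_iff] at this
  linarith

namespace ChannelMetric

variable {G : ChannelMetric} [StandardBorelSpace X] [Nonempty X]

/-- In (C) the simulated channels approximate `Φ^{⊗n}`. Their tangents are `√n` times a simulated
Gaussian shift, so by homogeneity the metric there is at most `n`. -/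
lemma le_one_of_bounded_score (hM1 : G.M1) (hM2 : G.M2) (hE : G.E) (hA : G.A) (hC : G.C)
    (hN0 : G.N0) {Φ : Kernel X Y} [IsMarkovKernel Φ] {Δ : SignedChannel X Y}
    (hΔ : IsTangent Φ Δ) {b γ : ℝ} (hb : ∀ x y, |score Φ Δ x y| ≤ b) (hγ0 : 0 ≤ γ) (hγ : γ < 1)
    (hs : ∀ x, ∑ y, (Φ x).real {y} * score Φ Δ x y ^ 2 ≤ γ) : G Φ Δ ≤ 1 := by
  have : Nonempty Y := nonempty_of_isProbabilityMeasure (Φ (Classical.arbitrary X))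
  have hv : ∀ (n : ℕ) (x : Fin n → X), (powVar Φ Δ x : ℝ) ≤ γ := fun n x => powVar_le hγ0 hs x
  have hmk : ∀ n, IsMarkovKernel (bayesKernel Φ Δ n) := fun n =>
    isMarkovKernel_bayesKernel fun x => by
      rw [← NNReal.coe_lt_coe]
      exact (hv n x).trans_lt hγ
  have ht : ∀ n, IsTangent (simulated (bayesKernel Φ Δ n)) (simulatedTangent (bayesKernel Φ Δ n)) :=
    fun n => isTangent_simulated _
  -- At `n = 0` the product is `0`, so it equals 1 only eventually.
  have hone : Tendsto (fun n : ℕ => (1 / (n : ℝ)) * n) atTop (𝓝 1) := by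
    refine tendsto_const_nhds.congr' ?_
    filter_upwards [eventually_gt_atTop 0] with n hn
    have : (n : ℝ) ≠ 0 := by positivity
    field_simp
  refine le_of_zero_le_liminf (fun n => ?_) hone (hA Φ Δ hΔ)
    (hC Φ Δ (fun n => simulated (bayesKernel Φ Δ n))
      (fun n => (simulatedTangent (bayesKernel Φ Δ n)).scale (NNReal.sqrt n)) hΔ
      (fun n => (ht n).scale _) (tendsto_cbNorm_zero fun δ hδ => ?_)
      (tendsto_cbNorm_div_sqrt_zero fun δ hδ => ?_))
  · rw [G.homogeneous _ _ _ (NNReal.sqrt n : ℝ) (ht n) fun x => SignedChannel.scale_signed _ _ x]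
    rw [← NNReal.coe_pow, NNReal.sq_sqrt, NNReal.coe_natCast]
    exact mul_le_of_le_one_right (Nat.cast_nonneg n) (simulated_le_one hM1 hM2 hE hN0 _)
  · filter_upwards [eventually_simulated_sub_le hΔ hb hγ hv hδ] with n hn x B hB
    rw [SignedChannel.ofChannels_signed_apply _ _ _ hB]
    exact (hn x B hB).1
  · filter_upwards [eventually_simulated_sub_le hΔ hb hγ hv hδ] with n hn x B hB
    rw [SignedChannel.sub_signed_apply _ _ _ hB, SignedChannel.scale_signed_apply _ _ _ hB,
      Real.coe_sqrt, NNReal.coe_natCast]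
    exact (hn x B hB).2

/-- For `c > γ`, scaling by `c^(-1/2)` brings the variance strictly below 1 and leaves room for the
noise; then `c` decreases to `γ`. -/
lemma le_of_bounded_score (hM1 : G.M1) (hM2 : G.M2) (hE : G.E) (hA : G.A) (hC : G.C)
    (hN0 : G.N0) {Φ : Kernel X Y} [IsMarkovKernel Φ] {Δ : SignedChannel X Y}
    (hΔ : IsTangent Φ Δ) {b γ : ℝ} (hb : ∀ x y, |score Φ Δ x y| ≤ b) (hγ0 : 0 ≤ γ)
    (hs : ∀ x, ∑ y, (Φ x).real {y} * score Φ Δ x y ^ 2 ≤ γ) : G Φ Δ ≤ γ := by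
  have : Nonempty Y := nonempty_of_isProbabilityMeasure (Φ (Classical.arbitrary X))
  refine le_of_forall_gt_imp_ge_of_dense fun c hc => ?_
  have hc0 : 0 < c := hγ0.trans_lt hc
  set a : ℝ≥0 := (√c⁻¹).toNNReal with ha
  have ha' : (a : ℝ) = √c⁻¹ := Real.coe_toNNReal _ (Real.sqrt_nonneg _)
  have ha2 : (a : ℝ) ^ 2 = c⁻¹ := by rw [ha', Real.sq_sqrt (by positivity)]
  have h := le_one_of_bounded_score hM1 hM2 hE hA hC hN0 (hΔ.scale a) (b := a * b)
    (γ := c⁻¹ * γ) (fun x y => ?_) (by positivity) ?_ fun x => ?_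
  · rw [G.homogeneous Φ Δ _ (a : ℝ) hΔ fun x => SignedChannel.scale_signed _ _ x, ha2,
      inv_mul_le_one₀ hc0] at h
    exact h
  · rw [score_scale, abs_mul, NNReal.abs_eq]
    exact mul_le_mul_of_nonneg_left (hb x y) a.2
  · rw [inv_mul_lt_one₀ hc0]
    exact hc
  · calc _ = c⁻¹ * ∑ y, (Φ x).real {y} * score Φ Δ x y ^ 2 := by
          rw [Finset.mul_sum]
          refine Finset.sum_congr rfl fun y _ => ?_
          rw [score_scale, mul_pow, ha2]
          ring
      _ ≤ _ := mul_le_mul_of_nonneg_left (hs x) (by positivity)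

end ChannelMetric

end UpperBoundLimit

/-! ### Gaussian sequences and sufficiency of the normalized sum -/

section GaussianSequences

open Finset

/-- The law of `n` independent standard Gaussian variables. -/
abbrev stdGaussianPi (n : ℕ) : Measure (Fin n → ℝ) := Measure.pi fun _ => gaussianReal 0 1

/-- The normalized sum of a real sequence. -/
def normalizedSum (n : ℕ) (r : Fin n → ℝ) : ℝ := (∑ i, r i) / √n

lemma measurable_normalizedSum (n : ℕ) : Measurable (normalizedSum n) :=
  (Finset.measurable_sum _ fun i _ => measurable_pi_apply i).div_const _

lemma map_normalizedSum {n : ℕ} (hn : 0 < n) :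
    (stdGaussianPi n).map (normalizedSum n) = gaussianReal 0 1 := by
  have hsum : (stdGaussianPi n).map (fun r => ∑ i, r i) = gaussianReal 0 n := by
    have : IsProbabilityMeasure ((stdGaussianPi n).map fun r => ∑ i, r i) :=
      Measure.isProbabilityMeasure_map (by fun_prop)
    refine Measure.ext_of_charFun ?_
    rw [charFun_map_sum_pi_eq_prod]
    ext t
    simp only [prod_const, card_univ, Fintype.card_fin, Pi.pow_apply, charFun_gaussianReal,
      ← Complex.exp_nat_mul]
    congr 1
    push_cast
    ring
  have : normalizedSum n = (fun r => r / √n) ∘ fun r => ∑ i, r i := rfl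
  rw [this, ← Measure.map_map (by fun_prop) (by fun_prop), hsum, gaussianReal_map_div_const]
  congr 1
  · simp
  · have : (n : ℝ) ≠ 0 := by positivity
    rw [← NNReal.coe_inj]
    simp [Real.sq_sqrt, this]

/-- The conditional law of `n` independent standard Gaussian variables given their normalized
sum. -/
def gaussianSplit (n : ℕ) : Kernel ℝ (Fin n → ℝ) :=
  condDistrib id (normalizedSum n) (stdGaussianPi n)

instance (n : ℕ) : IsMarkovKernel (gaussianSplit n) := by
  unfold gaussianSplit; infer_instance

lemma integral_gaussianSplit {n : ℕ} (hn : 0 < n) {B : Set (Fin n → ℝ)} (hB : MeasurableSet B) :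
    ∫ r, (gaussianSplit n r).real B * gaussianPDFReal 0 1 r = (stdGaussianPi n).real B := by
  have h := condDistrib_comp_map (μ := stdGaussianPi n) (Y := id)
    (measurable_normalizedSum n).aemeasurable aemeasurable_id
  rw [map_normalizedSum hn, Measure.map_id] at h
  conv_rhs => rw [← h]
  rw [measureReal_bind _ _ hB, integral_gaussianReal_eq_integral_smul one_ne_zero]
  simp only [smul_eq_mul, mul_comm, gaussianSplit]

lemma integrable_id_gaussianReal : Integrable (fun r : ℝ => r) (gaussianReal 0 1) :=
  (memLp_id_gaussianReal (μ := 0) (v := 1) 1).integrable le_rfl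

/-- The factor `r` is a function of the conditioning variable, so under the joint law it becomes the
normalized sum. This is sufficiency of the sum for the shift. -/
lemma integral_mul_gaussianSplit {n : ℕ} (hn : 0 < n) {B : Set (Fin n → ℝ)}
    (hB : MeasurableSet B) :
    ∫ r, (gaussianSplit n r).real B * (r * gaussianPDFReal 0 1 r)
      = ∫ r in B, normalizedSum n r ∂(stdGaussianPi n) := by
  have hs := measurable_normalizedSum n
  have h : (stdGaussianPi n).map (normalizedSum n) ⊗ₘ gaussianSplit n
      = (stdGaussianPi n).map fun r => (normalizedSum n r, id r) :=
    compProd_map_condDistrib aemeasurable_id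
  rw [map_normalizedSum hn] at h
  have hi : Integrable (fun z : ℝ × (Fin n → ℝ) => B.indicator (fun _ => z.1) z.2)
      (gaussianReal 0 1 ⊗ₘ gaussianSplit n) := by
    have h1 : Integrable (fun z : ℝ × (Fin n → ℝ) => z.1)
        (gaussianReal 0 1 ⊗ₘ gaussianSplit n) := by
      rw [h]
      refine (integrable_map_measure (by fun_prop) (by fun_prop)).2 ?_
      have := integrable_id_gaussianReal
      rw [← map_normalizedSum hn] at this
      exact this.comp_measurable hs
    exact h1.indicator (measurable_snd hB)
  have e1 := Measure.integral_compProd hi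
  rw [h, integral_map (by fun_prop) (by
    rw [← h]; exact hi.aestronglyMeasurable)] at e1
  have e2 : ∀ r : ℝ, ∫ b, B.indicator (fun _ => r) b
      ∂(gaussianSplit n r)
      = r * (gaussianSplit n r).real B := fun r => by
    rw [integral_indicator hB, setIntegral_const, smul_eq_mul, mul_comm]
  simp only [e2, id] at e1
  rw [← integral_indicator hB]
  refine Eq.trans ?_ e1.symm
  rw [integral_gaussianReal_eq_integral_smul one_ne_zero]
  refine integral_congr_ae (ae_of_all _ fun r => ?_)
  simp only [smul_eq_mul]
  ring

/-- Checked on boxes, where the integral depends on coordinate `i` alone and the other factors split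
off. -/
lemma pi_withDensity_slot {n : ℕ} {Y : Type} [MeasurableSpace Y] (μ : Measure Y)
    [IsProbabilityMeasure μ] {g : Y → ℝ≥0∞} (hg : Measurable g)
    [IsFiniteMeasure (μ.withDensity g)] (i : Fin n) (ν : Fin n → Measure Y)
    [∀ j, IsFiniteMeasure (ν j)] (hi : ν i = μ.withDensity g) (hν : ∀ j ≠ i, ν j = μ) :
    Measure.pi ν = (Measure.pi fun _ : Fin n => μ).withDensity fun y => g (y i) := by
  refine (Measure.pi_eq fun s hs => ?_)
  rw [withDensity_apply _ (MeasurableSet.univ_pi hs), Measure.restrict_pi_pi]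
  have h := lintegral_map hg (measurable_pi_apply i)
    (μ := Measure.pi fun j => μ.restrict (s j))
  change _ = ∫⁻ y : Fin n → Y, g (y i) ∂_ at h
  rw [← h]
  have h2 := Measure.pi_map_eval (fun j => μ.restrict (s j)) i
  change Measure.map (fun y : Fin n → Y => y i) _ = _ at h2
  rw [h2, lintegral_smul_measure, ← mul_prod_erase univ _ (mem_univ i), hi,
    withDensity_apply _ (hs i), smul_eq_mul, mul_comm]
  congr 1
  refine prod_congr rfl fun j hj => ?_
  rw [hν j (ne_of_mem_erase hj), Measure.restrict_apply_univ]

/-- The density is the sum of the one-letter densities `r i`, hence a function of the sufficient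
statistic. -/
lemma gaussianShift_pow_signed {n : ℕ} (hn : 0 < n) (x : Fin n → Unit) {B : Set (Fin n → ℝ)}
    (hB : MeasurableSet B) :
    (gaussianShift.pow (Kernel.const Unit (gaussianReal 0 1)) n).signed x B
      = √n * ∫ r in B, normalizedSum n r ∂(stdGaussianPi n) := by
  have hi : ∀ i : Fin n, Integrable (fun r : Fin n → ℝ => r i) (stdGaussianPi n) := fun i =>
    integrable_comp_eval (μ := fun _ : Fin n => gaussianReal 0 1) (f := fun r : ℝ => r)
      integrable_id_gaussianReal
  have hp : ∀ i : Fin n, piKernel (slot (Kernel.const Unit (gaussianReal 0 1)) gaussianShift.pos i)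
      x
      = (stdGaussianPi n).withDensity fun r => ENNReal.ofReal (r i) := fun i => by
    have : IsFiniteMeasure ((gaussianReal 0 1).withDensity fun r => ENNReal.ofReal r) :=
      isFiniteMeasure_withDensity_ofReal integrable_id_gaussianReal.2
    exact pi_withDensity_slot (gaussianReal 0 1) (g := fun r => ENNReal.ofReal r) (by fun_prop) i _
      (by simp [slot, gaussianShift]) fun j hj => by simp [slot, hj]
  have hq : ∀ i : Fin n, piKernel (slot (Kernel.const Unit (gaussianReal 0 1)) gaussianShift.neg i)
      x
      = (stdGaussianPi n).withDensity fun r => ENNReal.ofReal (-r i) := fun i => by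
    have : IsFiniteMeasure ((gaussianReal 0 1).withDensity fun r => ENNReal.ofReal (-r)) :=
      isFiniteMeasure_withDensity_ofReal integrable_id_gaussianReal.neg.2
    exact pi_withDensity_slot (gaussianReal 0 1) (g := fun r => ENNReal.ofReal (-r)) (by fun_prop) i
      _ (by simp [slot, gaussianShift]) fun j hj => by simp [slot, hj]
  have hn' : (√n : ℝ) ≠ 0 := (Real.sqrt_pos.2 (by exact_mod_cast hn)).ne'
  have e : ∀ i : Fin n, (piKernel (slot (Kernel.const Unit (gaussianReal 0 1)) gaussianShift.pos i)
        x).real B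
      - (piKernel (slot (Kernel.const Unit (gaussianReal 0 1)) gaussianShift.neg i) x).real B
      = ∫ r in B, r i ∂(stdGaussianPi n) := fun i => by
    have h := withDensityᵥ_eq_withDensity_pos_part_sub_withDensity_neg_part (hi i)
    have hfp := isFiniteMeasure_withDensity_ofReal (hi i).2
    have hfn := isFiniteMeasure_withDensity_ofReal (hi i).neg.2
    rw [← withDensityᵥ_apply (hi i) hB, h, hp, hq]
    exact (Measure.toSignedMeasure_sub_apply hB).symm
  have hsum : ∀ κ : Kernel Unit ℝ, ∀ _ : IsFiniteKernel κ,
      ((∑ i : Fin n, piKernel (slot (Kernel.const Unit (gaussianReal 0 1)) κ i)) x).real B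
      = ∑ i : Fin n, (piKernel (slot (Kernel.const Unit (gaussianReal 0 1)) κ i) x).real B :=
      fun κ hκ => by
    rw [measureReal_def, Kernel.finsetSum_apply', ENNReal.toReal_sum fun i _ => measure_ne_top _ _]
    rfl
  rw [SignedChannel.signed_apply _ _ hB]
  simp only [SignedChannel.pow]
  rw [hsum _ gaussianShift.finite_pos, hsum _ gaussianShift.finite_neg, ← sum_sub_distrib]
  simp only [e, normalizedSum]
  rw [integral_div, integral_finsetSum _ fun i _ => (hi i).integrableOn]
  field_simp

end GaussianSequences

/-! ### Lower bound: converting distributions into Gaussian shifts -/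

section LowerBound

open Finset

variable {Y : Type} [MeasurableSpace Y] [Fintype Y] [MeasurableSingletonClass Y]

/-- The statistic `S / J` smoothed by an independent Gaussian variable of variance `1 - 1 / J`,
where `S` is the normalized score. -/
def smoothedScoreKernel (Φ : Kernel Unit Y) (Δ : SignedChannel Unit Y) (J : ℝ≥0) (n : ℕ) :
    Kernel (Fin n → Y) ℝ :=
  Kernel.ofFunOfCountable fun y =>
    gaussianReal (powScore Φ Δ (fun _ : Fin n => ()) y / J) (1 - J⁻¹)

instance (Φ : Kernel Unit Y) (Δ : SignedChannel Unit Y) (J : ℝ≥0) (n : ℕ) :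
    IsMarkovKernel (smoothedScoreKernel Φ Δ J n) :=
  ⟨fun _ => by
    simp only [smoothedScoreKernel, Kernel.ofFunOfCountable, Kernel.coe_mk]; infer_instance⟩

/-- The kernel converting the output of `Φ^{⊗n}` into approximately Gaussian sequences. -/
def gaussianizer (Φ : Kernel Unit Y) (Δ : SignedChannel Unit Y) (J : ℝ≥0) (n : ℕ) :
    Kernel (Fin n → Y) (Fin n → ℝ) :=
  gaussianSplit n ∘ₖ smoothedScoreKernel Φ Δ J n

instance (Φ : Kernel Unit Y) (Δ : SignedChannel Unit Y) (J : ℝ≥0) (n : ℕ) :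
    IsMarkovKernel (gaussianizer Φ Δ J n) := by
  unfold gaussianizer; infer_instance

lemma gaussianizer_real (Φ : Kernel Unit Y) (Δ : SignedChannel Unit Y) {J : ℝ≥0} (hJ : 1 < J)
    {n : ℕ} (y : Fin n → Y) {B : Set (Fin n → ℝ)} (hB : MeasurableSet B) :
    (gaussianizer Φ Δ J n y).real B = ∫ r, (gaussianSplit n r).real B
      * gaussianPDFReal (powScore Φ Δ (fun _ : Fin n => ()) y / J) (1 - J⁻¹) r := by
  have hw : 1 - J⁻¹ ≠ 0 := (tsub_pos_of_lt (inv_lt_one_of_one_lt₀ hJ)).ne'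
  rw [gaussianizer, Kernel.comp_apply, measureReal_bind _ _ hB]
  simp only [smoothedScoreKernel, Kernel.ofFunOfCountable, Kernel.coe_mk]
  rw [integral_gaussianReal_eq_integral_smul hw]
  simp only [smul_eq_mul, mul_comm]

lemma integrable_gaussianSplit_mul {n : ℕ} {B : Set (Fin n → ℝ)} (hB : MeasurableSet B)
    {f : ℝ → ℝ} (hf : Integrable f) : Integrable fun r => (gaussianSplit n r).real B * f r := by
  refine hf.bdd_mul (c := 1) (measurable_kernel_real _ hB).aestronglyMeasurable
    (ae_of_all _ fun r => ?_)
  rw [Real.norm_eq_abs, abs_of_nonneg measureReal_nonneg]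
  exact measureReal_le_one

lemma sum_mul_gaussianizer_real (Φ : Kernel Unit Y) (Δ : SignedChannel Unit Y) {J : ℝ≥0}
    (hJ : 1 < J) {n : ℕ} (c : (Fin n → Y) → ℝ) {B : Set (Fin n → ℝ)} (hB : MeasurableSet B) :
    ∑ y, c y * (gaussianizer Φ Δ J n y).real B = ∫ r, (gaussianSplit n r).real B
      * ∑ y, c y * gaussianPDFReal (powScore Φ Δ (fun _ : Fin n => ()) y / J) (1 - J⁻¹) r := by
  simp only [gaussianizer_real Φ Δ hJ _ hB, mul_sum, ← integral_const_mul]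
  rw [← integral_finsetSum _ fun y _ =>
    (integrable_gaussianSplit_mul hB (integrable_gaussianPDFReal _ _)).const_mul _]
  refine integral_congr_ae (ae_of_all _ fun r => sum_congr rfl fun y _ => ?_)
  ring

/-- `S / J` has variance `1 / J`, which noise of variance `1 - 1/J` completes to 1. Dividing by `J`
rather than `√J` also fits the tangent: the score is `√n J` times `S / J`, and the smoothed score of
`S / J` is nearly `J⁻¹ r` times the Gaussian density, so `J` cancels. -/
lemma eventually_gaussianizer_sub_le {Φ : Kernel Unit Y} [IsMarkovKernel Φ]
    {Δ : SignedChannel Unit Y} (hΔ : IsTangent Φ Δ) {J : ℝ≥0} (hJ : 1 < J)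
    (hs : ∑ y, (Φ ()).real {y} * score Φ Δ () y ^ 2 = J) {δ : ℝ} (hδ : 0 < δ) :
    ∀ᶠ n : ℕ in atTop, ∀ x B, MeasurableSet B →
      ((gaussianizer Φ Δ J n ∘ₖ channelPow Φ n) x).real B
        - (channelPow (Kernel.const Unit (gaussianReal 0 1)) n x).real B ≤ δ ∧
      ((Δ.pow Φ n).postcomp (gaussianizer Φ Δ J n)).signed x B
        - (gaussianShift.pow (Kernel.const Unit (gaussianReal 0 1)) n).signed x B ≤ √n * δ := by
  have hJ0 : (0 : ℝ) < J := zero_lt_one.trans (by exact_mod_cast hJ)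
  have hJi : J⁻¹ < 1 := inv_lt_one_of_one_lt₀ hJ
  have hw : 1 - J⁻¹ ≠ 0 := (tsub_pos_of_lt hJi).ne'
  have hε : (0 : ℝ) < (1 - J⁻¹ : ℝ≥0) := by positivity
  have hδ' : 0 < δ / J := by positivity
  -- The tangent estimate is later multiplied by `J`, hence the accuracy `δ / J`.
  filter_upwards [eventually_product_approx ((∑ y, |score Φ Δ () y|) / J) hε (lt_min hδ hδ'),
    eventually_gt_atTop 0] with n hn hn0 x B hB
  have hx : x = fun _ => () := rfl
  subst hx
  have hn' : (0 : ℝ) < n := by exact_mod_cast hn0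
  have hsn : (0 : ℝ) < √n := Real.sqrt_pos.2 hn'
  obtain ⟨h1, h2⟩ := hn (fun _ y => (Φ ()).real {y}) (fun _ y => score Φ Δ () y / √n / J)
    J⁻¹ (1 - J⁻¹) (fun _ _ => measureReal_nonneg) (fun _ => sum_measureReal_singleton_univ _)
    (fun _ => by
      simp only [← mul_div_assoc]
      rw [← sum_div, ← sum_div, hΔ.sum_score, zero_div, zero_div])
    (fun _ y => by
      rw [abs_div, abs_div, abs_of_pos hJ0, abs_of_pos hsn, div_right_comm]
      have := single_le_sum (f := fun y => |score Φ Δ () y|) (fun y _ => abs_nonneg _) (mem_univ y)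
      gcongr)
    (add_tsub_cancel_of_le hJi.le)
    (by
      have e : ∀ y, (Φ ()).real {y} * (score Φ Δ () y / √n / J) ^ 2
          = (Φ ()).real {y} * score Φ Δ () y ^ 2 / (n * J ^ 2) := fun y => by
        rw [div_pow, div_pow, Real.sq_sqrt hn'.le]
        field_simp
      simp only [e]
      rw [← sum_div, hs, sum_const, card_univ, Fintype.card_fin, nsmul_eq_mul, NNReal.coe_inv]
      field_simp)
    le_rfl
  set P : (Fin n → Y) → ℝ := powWeight Φ fun _ => () with hP
  set S : (Fin n → Y) → ℝ := fun y => powScore Φ Δ (fun _ : Fin n => ()) y / J with hS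
  have hPe : (fun y : Fin n → Y => ∏ i, (Φ ()).real {y i}) = P := rfl
  have hSe : (fun y : Fin n → Y => ∑ i, score Φ Δ () (y i) / √n / J) = S := by
    funext y
    simp only [hS, powScore, sum_div]
  rw [hPe, hSe] at h1 h2
  have hqm : Measurable fun r => (gaussianSplit n r).real B := measurable_kernel_real _ hB
  have hN : channelPow (Kernel.const Unit (gaussianReal 0 1)) n (fun _ => ())
      = stdGaussianPi n := rfl
  constructor
  · have e : ((gaussianizer Φ Δ J n ∘ₖ channelPow Φ n) fun _ => ()).real B
        = ∫ r, (gaussianSplit n r).real B * mixDensity P S (1 - J⁻¹) r := by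
      rw [Kernel.comp_apply, measureReal_bind_eq_sum _ _ hB, sum_mul_gaussianizer_real _ _ hJ _ hB]
      simp only [channelPow_real_singleton]
      rfl
    rw [e, hN, ← integral_gaussianSplit hn0 hB]
    refine integral_mul_sub_le hqm (fun _ => measureReal_nonneg) (fun _ => measureReal_le_one)
      (integrable_mixDensity _ _ _) (integrable_gaussianPDFReal 0 1) (fun r => ?_)
      (integrable_weighted_abs_mixDensity_sub P S hw) (h1.trans (min_le_left _ _))
    exact le_mul_of_one_le_left (abs_nonneg _) (by linarith [abs_nonneg r])
  · have e : ((Δ.pow Φ n).postcomp (gaussianizer Φ Δ J n)).signed (fun _ => ()) B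
        = √n * J * ∫ r, (gaussianSplit n r).real B * mixScore P S (1 - J⁻¹) r := by
      rw [SignedChannel.postcomp_signed_eq_sum _ _ _ hB, sum_mul_gaussianizer_real _ _ hJ _ hB,
        ← integral_const_mul]
      refine integral_congr_ae (ae_of_all _ fun r => ?_)
      simp only [hΔ.pow_signed_eq_powScore, mixScore, hP, hS, mul_sum]
      refine sum_congr rfl fun y _ => ?_
      field_simp
    rw [e, gaussianShift_pow_signed hn0 _ hB, ← integral_mul_gaussianSplit hn0 hB]
    have hi := (integrable_mul_gaussianPDFReal 0 (one_ne_zero : (1 : ℝ≥0) ≠ 0)).const_mul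
      ((J⁻¹ : ℝ≥0) : ℝ)
    have hmain := integral_mul_sub_le hqm (fun _ => measureReal_nonneg)
      (fun _ => measureReal_le_one) (integrable_mixScore P S (1 - J⁻¹)) hi (fun r => le_rfl)
      ((integrable_mixScore P S (1 - J⁻¹)).sub hi).abs (h2.trans (min_le_right _ _))
    simp only [mul_left_comm _ ((J⁻¹ : ℝ≥0) : ℝ)] at hmain
    rw [integral_const_mul, NNReal.coe_inv] at hmain
    have := mul_le_mul_of_nonneg_left hmain (by positivity : 0 ≤ √n * (J : ℝ))
    calc _ = _ := ?_
      _ ≤ _ := this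
      _ = _ := by field_simp
    field_simp

namespace ChannelMetric

variable {G : ChannelMetric}

/-- Here (C) is applied around the Gaussian shift. The approximants are images of `Φ^{⊗n}`, bounded
through (M2); by (A) the two rates are `G Φ Δ` and 1. -/
lemma one_le_of_one_lt (hM2 : G.M2) (hA : G.A) (hC : G.C) (hN0 : G.N0) {Φ : Kernel Unit Y}
    [IsMarkovKernel Φ] {Δ : SignedChannel Unit Y} (hΔ : IsTangent Φ Δ) {J : ℝ≥0} (hJ : 1 < J)
    (hs : ∑ y, (Φ ()).real {y} * score Φ Δ () y ^ 2 = J) : 1 ≤ G Φ Δ := by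
  have : Nonempty Y := nonempty_of_isProbabilityMeasure (Φ ())
  -- With one input the score is bounded. This domination survives postprocessing and yields
  -- tangency of the powers and of their images.
  have hdom : ∀ n (x : Fin n → Unit) (y : Fin n → Y),
      |(Δ.pow Φ n).signed x {y}| ≤ (n * ∑ y, |score Φ Δ () y|) * (channelPow Φ n x).real {y} := by
    intro n x y
    rw [hΔ.pow_signed_singleton, channelPow_real_singleton, abs_mul,
      abs_of_nonneg (prod_nonneg fun _ _ => measureReal_nonneg), mul_comm]
    refine mul_le_mul_of_nonneg_right ?_ (prod_nonneg fun _ _ => measureReal_nonneg)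
    refine (abs_sum_le_sum_abs _ _).trans ?_
    calc _ ≤ ∑ _i : Fin n, ∑ y, |score Φ Δ () y| := sum_le_sum fun i _ =>
          single_le_sum (f := fun y => |score Φ Δ () y|) (fun y _ => abs_nonneg _) (mem_univ _)
      _ = _ := by rw [sum_const, card_univ, Fintype.card_fin, nsmul_eq_mul]
  have hpow : ∀ n, IsTangent (channelPow Φ n) (Δ.pow Φ n) := fun n => by
    refine isTangent_of_sq_le (C := (n * ∑ y, |score Φ Δ () y|) ^ 2) fun x y => ?_
    rw [← sq_abs]
    calc _ ≤ ((n * ∑ y, |score Φ Δ () y|) * (channelPow Φ n x).real {y}) ^ 2 :=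
          pow_le_pow_left₀ (abs_nonneg _) (hdom n x y) 2
      _ ≤ _ := by
          rw [mul_pow]
          refine mul_le_mul_of_nonneg_left ?_ (sq_nonneg _)
          exact pow_le_of_le_one measureReal_nonneg measureReal_le_one two_ne_zero
  have ht : ∀ n, IsTangent (gaussianizer Φ Δ J n ∘ₖ channelPow Φ n)
      ((Δ.pow Φ n).postcomp (gaussianizer Φ Δ J n)) := fun n => by
    refine isTangent_of_abs_le (C := n * ∑ y, |score Φ Δ () y|) fun x B hB => ?_
    rw [SignedChannel.postcomp_signed_eq_sum _ _ _ hB, Kernel.comp_apply,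
      measureReal_bind_eq_sum _ _ hB, mul_sum]
    refine (abs_sum_le_sum_abs _ _).trans (sum_le_sum fun y _ => ?_)
    rw [abs_mul, abs_of_nonneg (measureReal_nonneg (μ := gaussianizer Φ Δ J n y)), ← mul_assoc]
    exact mul_le_mul_of_nonneg_right (hdom n x y) measureReal_nonneg
  have hlim := hA _ _ isTangent_gaussianShift
  rw [hN0] at hlim
  refine le_of_zero_le_liminf (fun n => hM2 _ _ (gaussianizer Φ Δ J n) (hpow n)) (hA Φ Δ hΔ) hlim
    (hC _ _ (fun n => gaussianizer Φ Δ J n ∘ₖ channelPow Φ n)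
      (fun n => (Δ.pow Φ n).postcomp (gaussianizer Φ Δ J n)) isTangent_gaussianShift ht
      (tendsto_cbNorm_zero fun δ hδ => ?_) (tendsto_cbNorm_div_sqrt_zero fun δ hδ => ?_))
  · filter_upwards [eventually_gaussianizer_sub_le hΔ hJ hs hδ] with n hn x B hB
    rw [SignedChannel.ofChannels_signed_apply _ _ _ hB]
    exact (hn x B hB).1
  · filter_upwards [eventually_gaussianizer_sub_le hΔ hJ hs hδ] with n hn x B hB
    rw [SignedChannel.sub_signed_apply _ _ _ hB]
    exact (hn x B hB).2

/-- For `0 < c < J`, scaling by `c^(-1/2)` lifts the Fisher information to `J / c > 1`; then `c`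
increases to `J`. -/
lemma sum_score_sq_le_of_unit (hM2 : G.M2) (hA : G.A) (hC : G.C) (hN0 : G.N0) {Φ : Kernel Unit Y}
    [IsMarkovKernel Φ] {Δ : SignedChannel Unit Y} (hΔ : IsTangent Φ Δ) :
    ∑ y, (Φ ()).real {y} * score Φ Δ () y ^ 2 ≤ G Φ Δ := by
  have : Nonempty Y := nonempty_of_isProbabilityMeasure (Φ ())
  set J := ∑ y, (Φ ()).real {y} * score Φ Δ () y ^ 2 with hJ
  refine le_of_forall_lt_imp_le_of_dense fun c hc => ?_
  rcases le_or_gt c 0 with hc0 | hc0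
  · exact hc0.trans (G.nonneg Φ Δ hΔ)
  set a : ℝ≥0 := (√c⁻¹).toNNReal with ha
  have ha' : (a : ℝ) = √c⁻¹ := Real.coe_toNNReal _ (Real.sqrt_nonneg _)
  have ha2 : (a : ℝ) ^ 2 = c⁻¹ := by rw [ha', Real.sq_sqrt (by positivity)]
  have hcJ : 1 < c⁻¹ * J := by rwa [← div_eq_inv_mul, one_lt_div hc0]
  have h := one_le_of_one_lt hM2 hA hC hN0 (hΔ.scale a) (J := (c⁻¹ * J).toNNReal) ?_ ?_
  · rw [G.homogeneous Φ Δ _ (a : ℝ) hΔ fun x => SignedChannel.scale_signed _ _ x, ha2,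
      ← div_eq_inv_mul, one_le_div hc0] at h
    exact h
  · rwa [← NNReal.coe_lt_coe, Real.coe_toNNReal _ (by linarith)]
  · rw [Real.coe_toNNReal _ (by linarith), hJ, mul_sum]
    refine sum_congr rfl fun y _ => ?_
    rw [score_scale, mul_pow, ha2]
    ring

/-- A fixed input distribution is a channel from the one-point space, so (M1) reduces the claim to
single distributions. -/
lemma gMin_le {X : Type} [MeasurableSpace X] [StandardBorelSpace X] [Nonempty X] (hM1 : G.M1)
    (hM2 : G.M2) (hA : G.A) (hC : G.C) (hN0 : G.N0) {Φ : Kernel X Y} [IsMarkovKernel Φ]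
    {Δ : SignedChannel X Y} (hΔ : IsTangent Φ Δ) : gMin Φ Δ ≤ ENNReal.ofReal (G Φ Δ) := by
  have : Nonempty Y := nonempty_of_isProbabilityMeasure (Φ (Classical.arbitrary X))
  refine iSup_le fun p => ?_
  set Ψ : Kernel Unit X := Kernel.const Unit (p : Measure X)
  have ht := hΔ.precomp Ψ
  have e1 : (Φ ∘ₖ Ψ) () = Φ ∘ₘ (p : Measure X) := by rw [Kernel.comp_apply, Kernel.const_apply]
  have e2 : (Δ.precomp Ψ).signed () = Δ.apply p := by
    ext B hB
    rw [SignedChannel.precomp_signed_apply _ _ _ hB, Δ.apply_apply _ hB, Kernel.const_apply]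
  have hlt := (fisherInfo_le_gMin (Φ ∘ₖ Ψ) (Δ.precomp Ψ) ()).trans_lt ht
  rw [← e1, ← e2, fisherInfo_eq_sum (apply_singleton_eq_zero_of_fisherInfo_lt_top hlt)]
  refine ENNReal.ofReal_le_ofReal ((le_of_eq (sum_congr rfl fun y _ => ?_)).trans
    ((sum_score_sq_le_of_unit hM2 hA hC hN0 ht).trans (hM1 Φ Δ Ψ hΔ)))
  rw [score]
  by_cases hy : ((Φ ∘ₖ Ψ) ()).real {y} = 0
  · rw [hy]; simp
  · field_simp

end ChannelMetric

end LowerBound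

/-! ### Uniform output noise and removal of the bounded-score assumption -/

section Noise

open Finset

/-- The probability with which the channel `noise` below replaces its input. -/
def noiseLevel (t : ℝ) : ℝ := |t| / (1 + |t|)

lemma noiseLevel_nonneg (t : ℝ) : 0 ≤ noiseLevel t := by unfold noiseLevel; positivity

lemma noiseLevel_pos {t : ℝ} (ht : 0 < t) : 0 < noiseLevel t := by
  have := abs_pos.2 ht.ne'
  unfold noiseLevel; positivity

/-- Needed at every real `t`, since the family in (C2) is indexed by all of `ℝ`; this explains the
form `|t| / (1 + |t|)`. -/
lemma noiseLevel_le_one (t : ℝ) : noiseLevel t ≤ 1 := by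
  have := abs_nonneg t
  rw [noiseLevel, div_le_one (by positivity)]
  linarith

lemma tendsto_noiseLevel : Tendsto noiseLevel (𝓝[>] 0) (𝓝 0) := by
  have h : Continuous noiseLevel := by
    unfold noiseLevel
    exact continuous_abs.div (by fun_prop) fun t => by positivity
  have := h.tendsto 0
  simp only [noiseLevel, abs_zero, zero_div] at this
  exact this.mono_left nhdsWithin_le_nhds

lemma noiseWeight_nonneg (t : ℝ) (c : ℕ) (p : Prop) [Decidable p] :
    0 ≤ (1 - noiseLevel t) * (if p then 1 else 0) + noiseLevel t / c := by
  have h0 := noiseLevel_nonneg t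
  have h1 := sub_nonneg.2 (noiseLevel_le_one t)
  split_ifs <;> positivity

variable {Y : Type} [MeasurableSpace Y] [Fintype Y] [MeasurableSingletonClass Y]

open Classical in
/-- The channel that replaces its input by a uniformly distributed output with probability
`noiseLevel t`. -/
def noise (Y : Type) [MeasurableSpace Y] [Fintype Y] [MeasurableSingletonClass Y] (t : ℝ) :
    Kernel Y Y :=
  weightKernel (fun y y' => (1 - noiseLevel t) * (if y = y' then 1 else 0)
    + noiseLevel t / Fintype.card Y) fun _ => measurable_of_finite _

instance (t : ℝ) : IsMarkovKernel (noise Y t) := by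
  classical
  refine isMarkovKernel_weightKernel _ (fun _ _ => noiseWeight_nonneg t _ _) fun y => ?_
  have : Nonempty Y := ⟨y⟩
  have : (Fintype.card Y : ℝ) ≠ 0 := by positivity
  rw [sum_add_distrib, ← mul_sum, sum_ite_eq, if_pos (mem_univ _), sum_const, card_univ,
    nsmul_eq_mul]
  field_simp
  ring

open Classical in
lemma noise_real_singleton (t : ℝ) (y y' : Y) :
    (noise Y t y).real {y'} = (1 - noiseLevel t) * (if y = y' then 1 else 0)
      + noiseLevel t / Fintype.card Y :=
  weightKernel_real_singleton _ (noiseWeight_nonneg t _ _)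

variable {X : Type} [MeasurableSpace X]

lemma noise_comp_real_singleton (Φ : Kernel X Y) [IsMarkovKernel Φ] (t : ℝ) (x : X) (y : Y) :
    ((noise Y t ∘ₖ Φ) x).real {y}
      = (1 - noiseLevel t) * (Φ x).real {y} + noiseLevel t / Fintype.card Y := by
  classical
  rw [Kernel.comp_apply, measureReal_bind_eq_sum _ _ (measurableSet_singleton y)]
  simp only [noise_real_singleton, mul_add, sum_add_distrib, ← sum_mul,
    sum_measureReal_singleton_univ, one_mul]
  simp [mul_comm]

/-- The uniform part of the noise annihilates `Δ`, whose total mass is zero. -/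
lemma postcomp_noise_signed_singleton (Δ : SignedChannel X Y) (t : ℝ) (x : X) (y : Y) :
    (Δ.postcomp (noise Y t)).signed x {y} = (1 - noiseLevel t) * Δ.signed x {y} := by
  classical
  have h0 : ∑ y, Δ.signed x {y} = 0 := by
    have := signedMeasure_eq_sum_ite (Δ.signed x) Set.univ
    simpa [Δ.signed_univ] using this.symm
  rw [Δ.postcomp_signed_eq_sum _ _ (measurableSet_singleton y)]
  simp only [noise_real_singleton, mul_add, sum_add_distrib, ← sum_mul, h0, zero_mul, add_zero]
  simp [mul_comm]

lemma tendsto_cbNorm_noise (Φ : Kernel X Y) [IsMarkovKernel Φ] :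
    Tendsto (fun t => (SignedChannel.ofChannels (noise Y t ∘ₖ Φ) Φ).cbNorm) (𝓝[>] 0) (𝓝 0) := by
  classical
  refine tendsto_cbNorm_zero (X := fun _ => X) (Y := fun _ => Y) fun δ hδ => ?_
  filter_upwards [tendsto_noiseLevel.eventually_le_const hδ] with t ht x B hB
  have : Nonempty Y := nonempty_of_isProbabilityMeasure (Φ x)
  rw [SignedChannel.ofChannels_signed_apply _ _ _ hB, measureReal_eq_sum_ite,
    measureReal_eq_sum_ite (Φ x), ← sum_sub_distrib]
  have h0 := noiseLevel_nonneg t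
  calc _ ≤ ∑ _ : Y, noiseLevel t / Fintype.card Y := sum_le_sum fun y _ => by
        have := mul_nonneg h0 (measureReal_nonneg (μ := Φ x) (s := {y}))
        split_ifs
        · rw [noise_comp_real_singleton]; linarith
        · rw [sub_zero]; positivity
    _ = noiseLevel t := by
        rw [sum_const, card_univ, nsmul_eq_mul]
        field_simp
    _ ≤ δ := ht

lemma IsTangent.abs_signed_le {Φ : Kernel X Y} [IsMarkovKernel Φ] {Δ : SignedChannel X Y}
    (h : IsTangent Φ Δ) (x : X) (y : Y) : |Δ.signed x {y}| ≤ 1 + (gMin Φ Δ).toReal := by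
  have h1 := h.sq_signed_le x y
  have hg : 0 ≤ (gMin Φ Δ).toReal := ENNReal.toReal_nonneg
  have h2 := mul_le_of_le_one_right hg (measureReal_le_one (μ := Φ x) (s := {y}))
  exact abs_le_of_sq_le_sq (by nlinarith) (by positivity)

lemma tendsto_cbNorm_postcomp_noise {Φ : Kernel X Y} [IsMarkovKernel Φ] {Δ : SignedChannel X Y}
    (h : IsTangent Φ Δ) :
    Tendsto (fun t => ((Δ.postcomp (noise Y t)).sub Δ).cbNorm) (𝓝[>] 0) (𝓝 0) := by
  classical
  refine tendsto_cbNorm_zero (X := fun _ => X) (Y := fun _ => Y) fun δ hδ => ?_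
  have hlim := tendsto_noiseLevel.const_mul (Fintype.card Y * (1 + (gMin Φ Δ).toReal))
  rw [mul_zero] at hlim
  filter_upwards [hlim.eventually_le_const hδ] with t ht x B hB
  rw [SignedChannel.sub_signed_apply _ _ _ hB, signedMeasure_eq_sum_ite,
    signedMeasure_eq_sum_ite (Δ.signed x), ← sum_sub_distrib]
  have h0 := noiseLevel_nonneg t
  calc _ ≤ ∑ _ : Y, (1 + (gMin Φ Δ).toReal) * noiseLevel t := sum_le_sum fun y _ => by
        have := mul_le_mul_of_nonneg_right ((neg_le_abs _).trans (h.abs_signed_le x y)) h0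
        split_ifs
        · rw [postcomp_noise_signed_singleton]; linarith
        · rw [sub_zero]; positivity
    _ = Fintype.card Y * (1 + (gMin Φ Δ).toReal) * noiseLevel t := by
        rw [sum_const, card_univ, nsmul_eq_mul, mul_assoc]
    _ ≤ δ := ht

lemma sq_postcomp_noise_le {Φ : Kernel X Y} [IsMarkovKernel Φ] {Δ : SignedChannel X Y}
    (h : IsTangent Φ Δ) (t : ℝ) (x : X) (y : Y) :
    (Δ.postcomp (noise Y t)).signed x {y} ^ 2
      ≤ (gMin Φ Δ).toReal * ((noise Y t ∘ₖ Φ) x).real {y} := by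
  have h0 := noiseLevel_nonneg t
  have h1 := sub_nonneg.2 (noiseLevel_le_one t)
  have hp := measureReal_nonneg (μ := Φ x) (s := {y})
  have hg : 0 ≤ (gMin Φ Δ).toReal := ENNReal.toReal_nonneg
  rw [postcomp_noise_signed_singleton, noise_comp_real_singleton, mul_pow]
  calc _ ≤ (1 - noiseLevel t) ^ 2 * ((gMin Φ Δ).toReal * (Φ x).real {y}) :=
        mul_le_mul_of_nonneg_left (h.sq_signed_le x y) (sq_nonneg _)
    _ ≤ (1 - noiseLevel t) * ((gMin Φ Δ).toReal * (Φ x).real {y}) :=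
        mul_le_mul_of_nonneg_right (pow_le_of_le_one h1 (by linarith) two_ne_zero) (by positivity)
    _ = (gMin Φ Δ).toReal * ((1 - noiseLevel t) * (Φ x).real {y}) := by ring
    _ ≤ _ := mul_le_mul_of_nonneg_left (le_add_of_nonneg_right (by positivity)) hg

lemma noiseLevel_div_le_noise_comp (Φ : Kernel X Y) [IsMarkovKernel Φ] (t : ℝ) (x : X) (y : Y) :
    noiseLevel t / Fintype.card Y ≤ ((noise Y t ∘ₖ Φ) x).real {y} := by
  rw [noise_comp_real_singleton]
  exact le_add_of_nonneg_left
    (mul_nonneg (sub_nonneg.2 (noiseLevel_le_one t)) measureReal_nonneg)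

/-- The noise keeps all output probabilities away from zero. The bound may blow up as `t` tends to
zero; only the variance bound has to be uniform in `t`. -/
lemma abs_score_noise_le {Φ : Kernel X Y} [IsMarkovKernel Φ] {Δ : SignedChannel X Y}
    (h : IsTangent Φ Δ) {t : ℝ} (ht : 0 < t) (x : X) (y : Y) :
    |score (noise Y t ∘ₖ Φ) (Δ.postcomp (noise Y t)) x y|
      ≤ (1 + (gMin Φ Δ).toReal) / (noiseLevel t / Fintype.card Y) := by
  have : Nonempty Y := ⟨y⟩
  have h0 := noiseLevel_pos ht
  have h1 := sub_nonneg.2 (noiseLevel_le_one t)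
  rw [score, abs_div, abs_of_nonneg (measureReal_nonneg (μ := (noise Y t ∘ₖ Φ) x) (s := {y})),
    postcomp_noise_signed_singleton, abs_mul, abs_of_nonneg h1]
  refine div_le_div₀ (by positivity) ?_ (by positivity) (noiseLevel_div_le_noise_comp Φ t x y)
  exact (mul_le_of_le_one_left (abs_nonneg _) (by linarith)).trans (h.abs_signed_le x y)

/-- A termwise contraction: with `p`, `q` the old and new probabilities, `l` the noise level and `s`
the old score, the new term is `((1 - l) p)² s² / q`, and `(1 - l) p` is at most both `p` and `q`.
-/
lemma sum_score_sq_noise_le {Φ : Kernel X Y} [IsMarkovKernel Φ] {Δ : SignedChannel X Y}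
    (h : IsTangent Φ Δ) {t : ℝ} (ht : 0 < t) (x : X) :
    ∑ y, ((noise Y t ∘ₖ Φ) x).real {y}
      * score (noise Y t ∘ₖ Φ) (Δ.postcomp (noise Y t)) x y ^ 2 ≤ (gMin Φ Δ).toReal := by
  refine (sum_le_sum fun y _ => ?_).trans (h.sum_score_sq_le x)
  have : Nonempty Y := ⟨y⟩
  have h0 := noiseLevel_pos ht
  have h1 := sub_nonneg.2 (noiseLevel_le_one t)
  have hp := measureReal_nonneg (μ := Φ x) (s := {y})
  have hq : 0 < ((noise Y t ∘ₖ Φ) x).real {y} :=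
    (by positivity : 0 < noiseLevel t / Fintype.card Y).trans_le
      (noiseLevel_div_le_noise_comp Φ t x y)
  have hle : (1 - noiseLevel t) * (Φ x).real {y} ≤ ((noise Y t ∘ₖ Φ) x).real {y} := by
    rw [noise_comp_real_singleton]
    exact le_add_of_nonneg_right (by positivity)
  rw [score, postcomp_noise_signed_singleton, h.signed_eq]
  set q := ((noise Y t ∘ₖ Φ) x).real {y}
  set p := (Φ x).real {y}
  set s := score Φ Δ x y
  have e : q * ((1 - noiseLevel t) * (p * s) / q) ^ 2
      = ((1 - noiseLevel t) * p) * ((1 - noiseLevel t) * p) * s ^ 2 / q := by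
    field_simp
  rw [e, div_le_iff₀ hq]
  have hs := sq_nonneg s
  calc (1 - noiseLevel t) * p * ((1 - noiseLevel t) * p) * s ^ 2
      ≤ p * q * s ^ 2 := mul_le_mul_of_nonneg_right
        (mul_le_mul (mul_le_of_le_one_left hp (by linarith)) hle (by positivity) hp) hs
    _ = p * s ^ 2 * q := by ring

/-- The upper bound: the metric is at most the smallest one. -/
lemma ChannelMetric.le_gMin {G : ChannelMetric} [StandardBorelSpace X] [Nonempty X] (hM1 : G.M1)
    (hM2 : G.M2) (hE : G.E) (hA : G.A) (hC : G.C) (hN0 : G.N0) (hC2 : G.C2) {Φ : Kernel X Y}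
    [IsMarkovKernel Φ] {Δ : SignedChannel X Y} (hΔ : IsTangent Φ Δ) :
    G Φ Δ ≤ (gMin Φ Δ).toReal := by
  have : Nonempty Y := nonempty_of_isProbabilityMeasure (Φ (Classical.arbitrary X))
  have ht : ∀ t, IsTangent (noise Y t ∘ₖ Φ) (Δ.postcomp (noise Y t)) := fun t =>
    isTangent_of_sq_le (sq_postcomp_noise_le hΔ t)
  have h := hC2 Φ Δ (fun t => noise Y t ∘ₖ Φ) (fun t => Δ.postcomp (noise Y t)) hΔ ht
    (tendsto_cbNorm_noise Φ) (tendsto_cbNorm_postcomp_noise hΔ)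
  rw [← EReal.coe_le_coe_iff]
  refine h.trans ((liminf_le_liminf ?_).trans_eq
    (liminf_const (f := 𝓝[>] (0 : ℝ)) (((gMin Φ Δ).toReal : ℝ) : EReal)))
  filter_upwards [self_mem_nhdsWithin] with t h0
  rw [EReal.coe_le_coe_iff]
  exact le_of_bounded_score hM1 hM2 hE hA hC hN0 (ht t) (abs_score_noise_le hΔ h0)
    ENNReal.toReal_nonneg (sum_score_sq_noise_le hΔ h0)

end Noise

end ChannelGeometry

end

/-! ### The two bounds combined -/

theorem mainTheorem3 {d : ℕ} (K : Set (EuclideanSpace ℝ (Fin d))) (hK : IsCompact K)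
    (hne : K.Nonempty)
    {Y : Type} [Finite Y] [MeasurableSpace Y] [MeasurableSingletonClass Y]
    (Φ : Kernel K Y) [IsMarkovKernel Φ] (Δ : ChannelGeometry.SignedChannel K Y)
    (hΔ : ChannelGeometry.IsTangent Φ Δ)
    (f : ℝ → ℝ) (hf : Tendsto f (𝓝[>] 0) (𝓝 0))
    (hcont : ∀ x x' : K,
      max (ChannelGeometry.tvNorm ((Φ x).toSignedMeasure - (Φ x').toSignedMeasure))
          (ChannelGeometry.tvNorm (Δ.signed x - Δ.signed x'))
        ≤ ENNReal.ofReal (f ‖(x : EuclideanSpace ℝ (Fin d)) - (x' : EuclideanSpace ℝ (Fin d))‖))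
    (G : ChannelGeometry.ChannelMetric)
    (hM1 : G.M1) (hM2 : G.M2) (hE : G.E) (hA : G.A) (hC : G.C) (hN0 : G.N0) (hC2 : G.C2) :
    G Φ Δ = (ChannelGeometry.gMin Φ Δ).toReal := by
  have := Fintype.ofFinite Y
  have : Nonempty K := hne.to_subtype
  -- A compact set is Borel, so as a subspace it is standard Borel.
  have : StandardBorelSpace K := hK.measurableSet.standardBorel
  have : Nonempty Y := nonempty_of_isProbabilityMeasure (Φ (Classical.arbitrary K))
  exact le_antisymm (ChannelGeometry.ChannelMetric.le_gMin hM1 hM2 hE hA hC hN0 hC2 hΔ)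
    (ENNReal.toReal_le_of_le_ofReal (G.nonneg Φ Δ hΔ)
      (ChannelGeometry.ChannelMetric.gMin_le hM1 hM2 hA hC hN0 hΔ))
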